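/- **Conventions.** Let $d\ge 2$ and let $\mathbb H^d$ be the $d$-dimensional hyperbolic space $\{(y,z)\in\mathbb R^d\times\mathbb R: z^2-|y|^2=1,\ z>0\}$ with the Riemannian metric $\mathbf g$ induced by the Minkowski metric, volume $\mu$, and geodesic polar coordinates $(r,\omega)\mapsto(\sinh r\,\omega,\cosh r)$, so that $r$ is the distance to the origin $(0,1)$. $H^1(\mathbb H^d)$ is the completion of $C_c^\infty(\mathbb H^d)$ under $\|f\|_{H^1}=\|(-\Delta_{\mathbb H^d})^{1/2}f\|_{L^2}=\|\nabla f\|_{L^2}$ (a space of $L^2$ functions, since $d\ge2$), and $\mathcal H=H^1\times L^2(\mathbb H^d)$ with $\|(f,g)\|_{\mathcal H}^2=\|\nabla f\|_{L^2}^2+\|g\|_{L^2}^2$. Put, for $r>0$, $$\mathbf c^2(r)=\frac{\cosh r}{\sinh^d r}\int_0^r\frac{\sinh^{d-1}r'}{\cosh^2 r'}\,dr'.$$ **Assumptions.** Let $V:\mathbb H^d\to\mathbb R$ be bounded, of class $C^1$ and repulsive, i.e. $-\partial_rV\ge0$ away from the origin. Let $F:\mathbb R\to\mathbb R$ be continuous,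 $G(\sigma)=\int_0^\sigma F(\sigma')\,d\sigma'$, and $N(u)=\tfrac12uF(u)-G(u)$. Let $J\subseteq\mathbb R$ be an interval and let $\vec u=(u,\partial_tu)\in C(J;\mathcal H)$, real-valued, with $F(u)\in L^1_{\rm loc}(J;L^2(\mathbb H^d))$, be a solution of $$u_{tt}-\Delta_{\mathbb H^d}u+Vu+F(u)=0$$ in the sense of distributions: for every $\psi\in C_c^\infty(\mathbb H^d)$ and all $t_1,t_2\in J$, $$\int u\,\psi\,d\mu\Big|_{t_1}^{t_2}=\int_{t_1}^{t_2}\!\!\int\partial_tu\,\psi\,d\mu\,dt,\qquad \int\partial_tu\,\psi\,d\mu\Big|_{t_1}^{t_2}=-\int_{t_1}^{t_2}\!\!\int\big(\mathbf g(\nabla u,\nabla\psi)+Vu\psi+F(u)\psi\big)\,d\mu\,dt.$$ ($L^1_{\rm loc}(J;L^2)$ means $L^1([t_1,t_2];L^2)$ for all $t_1\le t_2$ in $J$.) **Lemma.** The weight $\mathbf c^2$ is positive on $(0,\infty)$, and there is a constant $C$ depending only on $d$ such that, for all $V,F,J,u$ as above, $N(u)$ is integrable on $[t_1,t_2]\times\mathbb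 H^d$ for all $t_1\le t_2$ in $J$, and, if $\|\vec u\|_{L^\infty(J;\mathcal H)}=\sup_{t\in J}\|\vec u(t)\|_{\mathcal H}<\infty$, the following hold. 1. (Defocusing case.) If $\tfrac12\sigma F(\sigma)-G(\sigma)\ge0$ for all $\sigma\in\mathbb R$, then $\mathbf c^2|\nabla u|_{\mathbf g}^2$, $\tanh r\,(-\partial_rV)|u|^2$ and $N(u)$ are integrable on $J\times\mathbb H^d$, and $$\iint_{J\times\mathbb H^d}\mathbf c^2|\nabla u|^2_{\mathbf g}+\tanh r\,(-\partial_rV)|u|^2+\Big(\tfrac12uF(u)-G(u)\Big)\,dt\,\mu(dx)\le C\,\|\vec u\|^2_{L^\infty(J;\mathcal H)}.$$ 2. (No sign condition on $F$.) If the negative part of $N(u)$ is integrable on $J\times\mathbb H^d$ (which is automatic when $J$ is compact), then the same three functions are integrable on $J\times\mathbb H^d$, and $$\iint_{J\times\mathbb H^d}\mathbf c^2|\nabla u|^2_{\mathbf g}+\tfrac1{2d}\tanh r\,(-\partial_rV)|u|^2+\Big(\tfrac12uF(u)-G(u)\Big)\,dt\,\mu(dx)\le C\,\|\vec u\|^2_{L^\infty(J;\mathcal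 H)}.$$ -/

import Mathlib

open MeasureTheory Set Filter Topology
open scoped ENNReal RealInnerProductSpace

noncomputable section

/-! ### Hyperbolic space

The hyperboloid `{(y, z) ∈ ℝ^d × ℝ | z² - |y|² = 1, z > 0}` is described by its global chart
`y ∈ ℝ^d`, the vertical projection; the inverse of the chart is `hypEmbed`.  In geodesic polar
coordinates a point is `y = sinh r • ω`, and the origin of hyperbolic space is `y = 0`. -/

/-- The global chart domain of `d`-dimensional hyperbolic space. -/
abbrev HypChart (d : ℕ) : Type := EuclideanSpace ℝ (Fin d)

/-- The inverse of the chart: the point of the hyperboloid above `y`. -/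
def hypEmbed {d : ℕ} (y : HypChart d) : HypChart d × ℝ := (y, √(1 + ‖y‖ ^ 2))

/-- The upper sheet of the unit hyperboloid. -/
def hyperboloid (d : ℕ) : Set (HypChart d × ℝ) := {p | p.2 ^ 2 - ‖p.1‖ ^ 2 = 1 ∧ 0 < p.2}

/-- The hyperbolic metric in the chart. -/
def hypMetric {d : ℕ} (y v w : HypChart d) : ℝ :=
  ⟪v, w⟫ - ⟪y, v⟫ * ⟪y, w⟫ / (1 + ‖y‖ ^ 2)

/-- The inverse metric `g^{ij} ξ_i η_j` on covectors; a covector is written as the vector of its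
components in the chart. -/
def hypCoMetric {d : ℕ} (y ξ η : HypChart d) : ℝ := ⟪ξ, η⟫ + ⟪y, ξ⟫ * ⟪y, η⟫

/-- The Riemannian volume `√(det g) dy = dy / √(1 + |y|²)`
(that is, `sinh^{d-1} r dr dω` in polar coordinates). -/
def hypVolume (d : ℕ) : Measure (HypChart d) :=
  volume.withDensity (fun y => ENNReal.ofReal (1 / √(1 + ‖y‖ ^ 2)))

/-- The hyperbolic distance to the origin: `|y| = sinh r`. -/
def hypRadius {d : ℕ} (y : HypChart d) : ℝ := Real.arsinh ‖y‖

/-- The radial derivative `∂_r f` in polar coordinates: the derivative of `s ↦ f (sinh s • ω)`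
at `s = r`, where `y = sinh r • ω` (its value at the origin is irrelevant). -/
def radialDeriv {d : ℕ} (f : HypChart d → ℝ) (y : HypChart d) : ℝ :=
  deriv (fun s : ℝ => f (Real.sinh s • (‖y‖⁻¹ • y))) (hypRadius y)

/-- The chart describes exactly the hyperboloid. -/
theorem hypEmbed_bijOn (d : ℕ) : BijOn (hypEmbed (d := d)) univ (hyperboloid d) := by
  refine ⟨fun y _ => ?_, fun a _ b _ h => congrArg Prod.fst h, fun p hp => ?_⟩
  · have h : (0 : ℝ) < 1 + ‖y‖ ^ 2 := by positivity
    refine ⟨?_, Real.sqrt_pos.2 h⟩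
    simp only [hypEmbed]
    rw [Real.sq_sqrt h.le]; ring
  · obtain ⟨h1, h2⟩ := hp
    refine ⟨p.1, mem_univ _, ?_⟩
    have : (1 + ‖p.1‖ ^ 2) = p.2 ^ 2 := by linarith
    ext1
    · rfl
    · simp only [hypEmbed]
      rw [this, Real.sqrt_sq h2.le]

/-- The hyperbolic metric is the pull-back of the Minkowski metric `diag(1, …, 1, -1)`. -/
theorem hypMetric_eq_pullback {d : ℕ} (y v w : HypChart d) :
    hypMetric y v w =
      ⟪(fderiv ℝ (hypEmbed (d := d)) y v).1, (fderiv ℝ (hypEmbed (d := d)) y w).1⟫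
        - (fderiv ℝ (hypEmbed (d := d)) y v).2 * (fderiv ℝ (hypEmbed (d := d)) y w).2 := by
  have h : (0 : ℝ) < 1 + ‖y‖ ^ 2 := by positivity
  have h1 : HasFDerivAt (fun z : HypChart d => 1 + ‖z‖ ^ 2) (2 • innerSL ℝ y) y :=
    ((hasStrictFDerivAt_norm_sq y).hasFDerivAt).const_add 1
  have h2 := h1.sqrt h.ne'
  have h3 : HasFDerivAt (hypEmbed (d := d)) _ y := (hasFDerivAt_id y).prodMk h2
  rw [h3.fderiv]
  have hs : √(1 + ‖y‖ ^ 2) ^ 2 = 1 + ‖y‖ ^ 2 := Real.sq_sqrt h.le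
  have hs0 : √(1 + ‖y‖ ^ 2) ≠ 0 := (Real.sqrt_pos.2 h).ne'
  simp [hypMetric]
  field_simp
  rw [hs]

/-- `hypCoMetric` is the inverse of `hypMetric`: raising the index of `ξ` gives
`ξ + ⟪y, ξ⟫ y`. -/
theorem hypCoMetric_inverse {d : ℕ} (y ξ η w : HypChart d) :
    hypMetric y (ξ + ⟪y, ξ⟫ • y) w = ⟪ξ, w⟫ ∧
      ⟪ξ, η + ⟪y, η⟫ • y⟫ = hypCoMetric y ξ η := by
  have h : (1 : ℝ) + ‖y‖ ^ 2 ≠ 0 := by positivity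
  constructor
  · simp only [hypMetric, inner_add_left, inner_add_right, inner_smul_left, inner_smul_right,
      real_inner_self_eq_norm_sq, RCLike.conj_to_real]
    field_simp
    ring
  · simp only [hypCoMetric, inner_add_right, inner_smul_right, real_inner_comm y ξ]
    ring

/-- The determinant of the metric in the chart. -/
theorem hypMetric_det {d : ℕ} (y : HypChart d) :
    (Matrix.of fun i j : Fin d => hypMetric y (EuclideanSpace.single i 1)
      (EuclideanSpace.single j 1)).det = 1 / (1 + ‖y‖ ^ 2) := by
  have h : (1 : ℝ) + ‖y‖ ^ 2 ≠ 0 := by positivity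
  have e : (Matrix.of fun i j : Fin d => hypMetric y (EuclideanSpace.single i 1)
      (EuclideanSpace.single j 1)) =
      1 + Matrix.replicateCol Unit (fun i => -(y i) / (1 + ‖y‖ ^ 2)) *
        Matrix.replicateRow Unit (fun j => y j) := by
    ext i j
    simp [hypMetric, Matrix.mul_apply, Matrix.one_apply, EuclideanSpace.inner_single_right,
      eq_comm (a := j)]
    ring
  rw [e, Matrix.det_one_add_replicateCol_mul_replicateRow, dotProduct]
  have : ∑ i, y i * (-(y i) / (1 + ‖y‖ ^ 2)) = -‖y‖ ^ 2 / (1 + ‖y‖ ^ 2) := by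
    rw [EuclideanSpace.real_norm_sq_eq, neg_div, Finset.sum_div, ← Finset.sum_neg_distrib]
    exact Finset.sum_congr rfl fun i _ => by ring
  rw [this]
  field_simp
  ring

/-! ### Function spaces -/

/-- Test functions `C_c^∞`. -/
def IsTestFn {d : ℕ} (φ : HypChart d → ℝ) : Prop := ContDiff ℝ ((⊤ : ℕ∞) : WithTop ℕ∞) φ ∧ HasCompactSupport φ

/-- The `L²` norm of a covector field, `(∫ |ξ|_g² dμ)^{1/2}`. -/
def covecL2 {d : ℕ} (ξ : HypChart d → HypChart d) : ℝ≥0∞ :=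
  eLpNorm (fun y => √(hypCoMetric y (ξ y) (ξ y))) 2 (hypVolume d)

/-- `f` belongs to `H¹`, the completion of `C_c^∞`, and `Df` is its differential (in chart
components): both are `L²` limits along one sequence of test functions. -/
structure IsH1 {d : ℕ} (f : HypChart d → ℝ) (Df : HypChart d → HypChart d) : Prop where
  memLp : MemLp f 2 (hypVolume d)
  meas : AEStronglyMeasurable Df (hypVolume d)
  approx : ∃ φ : ℕ → HypChart d → ℝ, (∀ n, IsTestFn (φ n)) ∧
    Tendsto (fun n => eLpNorm (fun y => φ n y - f y) 2 (hypVolume d)) atTop (𝓝 0) ∧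
    Tendsto (fun n => covecL2 (fun y => gradient (φ n) y - Df y)) atTop (𝓝 0)

/-- The square of the norm of `(f, g)` in `H¹ × L²`, where
`‖f‖_{H¹} = ‖(-Δ)^{1/2} f‖_{L²} = ‖∇f‖_{L²}`. -/
def energyNormSq {d : ℕ} (Df : HypChart d → HypChart d) (g : HypChart d → ℝ) : ℝ≥0∞ :=
  covecL2 Df ^ 2 + eLpNorm g 2 (hypVolume d) ^ 2

/-- The square of the norm of `(u, ∂_t u)` in `L^∞(J; H¹ × L²)`. -/
def energySupSq {d : ℕ} (J : Set ℝ) (Du : ℝ → HypChart d → HypChart d)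
    (ut : ℝ → HypChart d → ℝ) : ℝ≥0∞ :=
  ⨆ t ∈ J, energyNormSq (Du t) (ut t)

/-! ### The equation -/

/-- `(u, ut)` is a solution of `u_tt - Δu + V u + F(u) = 0` in `C(J; H¹ × L²)` with
`F(u) ∈ L¹_loc(J; L²)`; `Du t` is the differential of `u t`.  The equation holds in the weak
sense: tested against every `ψ ∈ C_c^∞` and integrated in time. -/
structure IsEnergySolution {d : ℕ} (V : HypChart d → ℝ) (F : ℝ → ℝ) (J : Set ℝ)
    (u : ℝ → HypChart d → ℝ) (Du : ℝ → HypChart d → HypChart d)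
    (ut : ℝ → HypChart d → ℝ) : Prop where
  meas_u : AEStronglyMeasurable (fun p : ℝ × HypChart d => u p.1 p.2)
    ((volume.restrict J).prod (hypVolume d))
  meas_Du : AEStronglyMeasurable (fun p : ℝ × HypChart d => Du p.1 p.2)
    ((volume.restrict J).prod (hypVolume d))
  meas_ut : AEStronglyMeasurable (fun p : ℝ × HypChart d => ut p.1 p.2)
    ((volume.restrict J).prod (hypVolume d))
  mem_H1 : ∀ t ∈ J, IsH1 (u t) (Du t)
  mem_L2 : ∀ t ∈ J, MemLp (ut t) 2 (hypVolume d)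
  continuous : ∀ t ∈ J, Tendsto
    (fun s => energyNormSq (fun y => Du s y - Du t y) (fun y => ut s y - ut t y)) (𝓝[J] t) (𝓝 0)
  nonlin : ∀ t₁ ∈ J, ∀ t₂ ∈ J,
    ∫⁻ t in Icc t₁ t₂, eLpNorm (fun y => F (u t y)) 2 (hypVolume d) < ⊤
  eq_dt : ∀ ψ, IsTestFn ψ → ∀ t₁ ∈ J, ∀ t₂ ∈ J,
    ∫ y, u t₂ y * ψ y ∂(hypVolume d) - ∫ y, u t₁ y * ψ y ∂(hypVolume d)
      = ∫ t in t₁..t₂, ∫ y, ut t y * ψ y ∂(hypVolume d)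
  eq_wave : ∀ ψ, IsTestFn ψ → ∀ t₁ ∈ J, ∀ t₂ ∈ J,
    ∫ y, ut t₂ y * ψ y ∂(hypVolume d) - ∫ y, ut t₁ y * ψ y ∂(hypVolume d)
      = -∫ t in t₁..t₂, ∫ y, (hypCoMetric y (Du t y) (gradient ψ y)
          + V y * u t y * ψ y + F (u t y) * ψ y) ∂(hypVolume d)

/-! ### The quantities of the estimate -/

/-- The weight `c²(r) = (cosh r / sinh^d r) ∫₀^r sinh^{d-1} s / cosh² s ds`. -/
def weightSq (d : ℕ) (r : ℝ) : ℝ :=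
  Real.cosh r / Real.sinh r ^ d * ∫ s in (0 : ℝ)..r, Real.sinh s ^ (d - 1) / Real.cosh s ^ 2

/-- `c² |∇u|²_g`. -/
def gradDensity {d : ℕ} (Du : ℝ → HypChart d → HypChart d) (p : ℝ × HypChart d) : ℝ :=
  weightSq d (hypRadius p.2) * hypCoMetric p.2 (Du p.1 p.2) (Du p.1 p.2)

/-- `tanh r (-∂_r V) |u|²`. -/
def potDensity {d : ℕ} (V : HypChart d → ℝ) (u : ℝ → HypChart d → ℝ) (p : ℝ × HypChart d) : ℝ :=
  Real.tanh (hypRadius p.2) * (-radialDeriv V p.2) * u p.1 p.2 ^ 2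

/-- The primitive `G(σ) = ∫₀^σ F`. -/
def primitiveOf (F : ℝ → ℝ) (σ : ℝ) : ℝ := ∫ s in (0 : ℝ)..σ, F s

/-- `½ u F(u) - G(u)`. -/
def nonlinDensity {d : ℕ} (F : ℝ → ℝ) (u : ℝ → HypChart d → ℝ) (p : ℝ × HypChart d) : ℝ :=
  1 / 2 * u p.1 p.2 * F (u p.1 p.2) - primitiveOf F (u p.1 p.2)

end

/-! The multiplier is the radial field X = f(r) ∂_r with f(r) = sinh^{1-d} r ∫_0^r sinh^{d-1},
chosen so that div X = 1. In the chart it is √(1+|y|²) κ(|y|²) y, where κ is `kap d`. Formally,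
pairing the equation with Xu + u/2 on [a,c] × ℍ^d gives an identity between the momentum at the two
endpoints and the space-time integral of ∇X(∇u,∇u) - ½(XV)u² + N(u). No other zero-order term
appears, because div X is constant. Relative to the metric, ∇X has the eigenvalue f' = 1 - (d-1) f
coth r in the radial direction, which is exactly the weight c² (`weightSq_eq`), and f coth r ≥ 1/d ≥
f' in the others, so it dominates c² times the metric (`le_quadLim`). The same lower bound reads f ≥
tanh r / d and produces the coefficient 1/(2d) of the potential term. The momentum is bounded by the
energy because |X| ≤ 1 and because div X = 1 also implies the Poincaré inequality (`IsH1.lTwo_le`).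

The difficulty is regularity: u(t) is only in H¹, so Xu is only in L² and cannot be used to test the
equation. The field X is written as ∑ b_j K_j, where K_j generates the Lorentz boosts in the j-th
coordinate direction and b_j = κ(|y|²) y_j. With U_s the composition with the boost by s, each b K
is replaced by the difference operator (b U_s - U_{-s} b)/2s (`multOp`), which preserves H¹ and is
skew on L². Skewness removes the kinetic term. Since boosts are isometries, the Dirichlet pairing of
u with this operator applied to u reduces to a difference quotient of u alone against a weight
involving ∇b and Δb (`IsH1.dirichlet_multOpGrad`); this converges as s → 0 by weak differentiability
along boosts (`IsH1.tendsto_boost`). Summing over j gives `IsEnergySolution.virial_identity`. The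
b_j are harmonic, which is the counterpart of div X being constant.

The nonlinearity F is merely continuous and the volume is infinite. F(0) = 0 is forced by F(u) ∈ L².
Truncating F away from 0 and ∞ and using an L¹ Poincaré inequality for Ψ(u) gives G(u) ∈ L¹ together
with the divergence theorem for G(u).

All this is done with X cut off at |y| ~ R. The coefficients obey bounds uniform in R, so as R → ∞
every term except the potential one converges by domination; the potential term is nonnegative and
is treated by Fatou's lemma. The result on compact intervals has a constant independent of the
interval and extends to J by exhaustion. In the defocusing case all densities are nonnegative, and
multiplying by 2d restores the full potential term. -/

/-! ### The volume measure and the coframe -/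

/-- The Minkowski height `√(1 + |y|²) = cosh r`. -/
noncomputable def height {d : ℕ} (y : HypChart d) : ℝ := √(1 + ‖y‖ ^ 2)

section Height
variable {d : ℕ}

theorem height_sq (y : HypChart d) : height y ^ 2 = 1 + ‖y‖ ^ 2 := Real.sq_sqrt (by positivity)

theorem one_le_height (y : HypChart d) : 1 ≤ height y := by
  rw [height, Real.one_le_sqrt]; nlinarith [sq_nonneg ‖y‖]

theorem height_pos (y : HypChart d) : 0 < height y := zero_lt_one.trans_le (one_le_height y)

theorem norm_le_height (y : HypChart d) : ‖y‖ ≤ height y :=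
  Real.le_sqrt_of_sq_le (by linarith)

theorem height_le (y : HypChart d) : height y ≤ 1 + ‖y‖ := by
  rw [height, Real.sqrt_le_left (by positivity)]; nlinarith [norm_nonneg y]

theorem contDiff_height {n : WithTop ℕ∞} : ContDiff ℝ n (height (d := d)) :=
  (contDiff_const.add (contDiff_norm_sq ℝ)).sqrt fun y => by positivity

theorem hasFDerivAt_height (y : HypChart d) :
    HasFDerivAt (height (d := d)) ((1 / height y) • innerSL ℝ y) y := by
  have h1 : HasFDerivAt (fun z : HypChart d => 1 + ‖z‖ ^ 2) (2 • innerSL ℝ y) y :=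
    ((hasStrictFDerivAt_norm_sq y).hasFDerivAt).const_add 1
  have h2 := h1.sqrt (by positivity)
  convert! h2 using 1
  ext v
  simp [height]
  field_simp

end Height

section Volume
variable {d : ℕ}

theorem hypVolume_le_volume : hypVolume d ≤ volume := by
  have : hypVolume d ≤ volume.withDensity 1 := by
    apply withDensity_mono
    refine Eventually.of_forall fun y => ?_
    rw [Pi.one_apply, ENNReal.ofReal_le_one]
    exact div_le_one_of_le₀ (one_le_height y) (height_pos y).le
  rwa [withDensity_one] at this

instance instSigmaFiniteHypVolume : SigmaFinite (hypVolume d) := by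
  unfold hypVolume; infer_instance

instance instFiniteOnCompactsHypVolume : IsFiniteMeasureOnCompacts (hypVolume d) :=
  ⟨fun _ hK => (hypVolume_le_volume _).trans_lt hK.measure_lt_top⟩

theorem measurable_hypDensity :
    Measurable fun y : HypChart d => ENNReal.ofReal (1 / √(1 + ‖y‖ ^ 2)) := by fun_prop

theorem integral_hypVolume (f : HypChart d → ℝ) :
    ∫ y, f y ∂(hypVolume d) = ∫ y, 1 / height y * f y := by
  unfold hypVolume
  rw [integral_withDensity_eq_integral_toReal_smul measurable_hypDensity
    (Eventually.of_forall fun _ => ENNReal.ofReal_lt_top)]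
  refine integral_congr_ae (Eventually.of_forall fun y => ?_)
  simp only [smul_eq_mul]
  rw [ENNReal.toReal_ofReal (by positivity)]; rfl

end Volume

/-- The square root of the inverse metric: `|coframe y ξ| = |ξ|_g`. -/
noncomputable def coframe {d : ℕ} (y ξ : HypChart d) : HypChart d :=
  ξ + (⟪y, ξ⟫ / (1 + height y)) • y

section Coframe
variable {d : ℕ}

/-- With z = height y, the matrix 1 + y yᵀ/(1+z) squares to 1 + y yᵀ because |y|² = (z-1)(z+1). -/
theorem inner_coframe (y ξ η : HypChart d) :
    ⟪coframe y ξ, coframe y η⟫ = hypCoMetric y ξ η := by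
  have h := height_sq y
  have h1 : 1 + height y ≠ 0 := by linarith [height_pos y]
  have h2 : ‖y‖ ^ 2 = height y ^ 2 - 1 := by linarith
  simp only [coframe, hypCoMetric, inner_add_left, inner_add_right, inner_smul_left,
    inner_smul_right, real_inner_self_eq_norm_sq, RCLike.conj_to_real, h2, real_inner_comm y]
  field_simp
  ring

theorem norm_coframe_sq (y ξ : HypChart d) : ‖coframe y ξ‖ ^ 2 = ‖ξ‖ ^ 2 + ⟪y, ξ⟫ ^ 2 := by
  rw [← real_inner_self_eq_norm_sq, inner_coframe, hypCoMetric, real_inner_self_eq_norm_sq]; ring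

theorem norm_coframe (y ξ : HypChart d) : ‖coframe y ξ‖ = √(hypCoMetric y ξ ξ) := by
  rw [← inner_coframe, real_inner_self_eq_norm_sq, Real.sqrt_sq (norm_nonneg _)]

theorem norm_le_norm_coframe (y ξ : HypChart d) : ‖ξ‖ ≤ ‖coframe y ξ‖ := by
  have := norm_coframe_sq y ξ
  exact abs_le_of_sq_le_sq' (by nlinarith [sq_nonneg ⟪y, ξ⟫]) (norm_nonneg _) |>.2

theorem abs_inner_le_norm_coframe (y ξ : HypChart d) : |⟪y, ξ⟫| ≤ ‖coframe y ξ‖ := by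
  have := norm_coframe_sq y ξ
  exact abs_le_of_sq_le_sq (by nlinarith [sq_nonneg ‖ξ‖]) (norm_nonneg _)

theorem coframe_add (y ξ η : HypChart d) : coframe y (ξ + η) = coframe y ξ + coframe y η := by
  simp only [coframe, inner_add_right, add_div, add_smul]; abel

theorem coframe_smul (y : HypChart d) (c : ℝ) (ξ : HypChart d) :
    coframe y (c • ξ) = c • coframe y ξ := by
  simp only [coframe, inner_smul_right, smul_add, smul_smul, mul_div_assoc]

theorem coframe_sub (y ξ η : HypChart d) : coframe y (ξ - η) = coframe y ξ - coframe y η := by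
  rw [sub_eq_add_neg, coframe_add, ← neg_one_smul ℝ η, coframe_smul]; simp [sub_eq_add_neg]

theorem continuous_coframe : Continuous fun p : HypChart d × HypChart d => coframe p.1 p.2 := by
  unfold coframe
  have : Continuous (height (d := d)) := contDiff_height (n := 0) |>.continuous
  have h0 : ∀ p : HypChart d × HypChart d, 1 + height p.1 ≠ 0 := fun p => by
    linarith [height_pos p.1]
  have h1 : Continuous fun p : HypChart d × HypChart d => ⟪p.1, p.2⟫ / (1 + height p.1) :=
    Continuous.div (by fun_prop) (by fun_prop) h0
  exact continuous_snd.add (h1.smul continuous_fst)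

/-- Turns the covector norm into the L² norm of an ordinary vector-valued function, so that L²
arguments on differentials can be run on `coframe y (ξ y)`. -/
theorem covecL2_eq (ξ : HypChart d → HypChart d) :
    covecL2 ξ = eLpNorm (fun y => coframe y (ξ y)) 2 (hypVolume d) := by
  unfold covecL2
  refine eLpNorm_congr_norm_ae (Eventually.of_forall fun y => ?_)
  rw [norm_coframe, Real.norm_of_nonneg (Real.sqrt_nonneg _)]

theorem aestronglyMeasurable_coframe {ξ : HypChart d → HypChart d} {μ : Measure (HypChart d)}
    (h : AEStronglyMeasurable ξ μ) :
    AEStronglyMeasurable (fun y => coframe y (ξ y)) μ :=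
  continuous_coframe.comp_aestronglyMeasurable (aestronglyMeasurable_id.prodMk h)

end Coframe

/-! ### `L²` pairings -/

section LTwo
variable {α G : Type*} [MeasurableSpace α] {μ : Measure α} [NormedAddCommGroup G]

/-- The `L²` norm as a real number. -/
noncomputable def lTwo (μ : Measure α) (f : α → G) : ℝ := (eLpNorm f 2 μ).toReal

theorem lTwo_nonneg (f : α → G) : 0 ≤ lTwo μ f := ENNReal.toReal_nonneg

theorem lTwo_sq {f : α → G} (hf : AEStronglyMeasurable f μ) :
    lTwo μ f ^ 2 = ∫ x, ‖f x‖ ^ 2 ∂μ := by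
  by_cases h : MemLp f 2 μ
  · have := h.eLpNorm_eq_integral_rpow_norm (by norm_num) (by norm_num)
    rw [lTwo, this, ENNReal.toReal_ofReal (by positivity)]
    simp only [ENNReal.toReal_ofNat, Real.rpow_ofNat]
    rw [← Real.rpow_natCast, ← Real.rpow_mul (by positivity)]
    norm_num
  -- Outside L² both sides take default values: the norm is ⊤, whose `toReal` is 0, and the integral
  -- of a non-integrable function is 0.
  · rw [lTwo, integral_undef]
    · have : eLpNorm f 2 μ = ⊤ := by
        by_contra h'
        exact h ⟨hf, lt_top_iff_ne_top.2 h'⟩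
      simp [this]
    · intro h'
      exact h ((memLp_two_iff_integrable_sq_norm hf).2 h')

theorem lTwo_add_le {f g : α → G} (hf : MemLp f 2 μ) (hg : MemLp g 2 μ) :
    lTwo μ (fun x => f x + g x) ≤ lTwo μ f + lTwo μ g := by
  unfold lTwo
  rw [← ENNReal.toReal_add hf.2.ne hg.2.ne]
  exact ENNReal.toReal_mono (ENNReal.add_ne_top.2 ⟨hf.2.ne, hg.2.ne⟩)
    (eLpNorm_add_le hf.1 hg.1 (by norm_num))

theorem lTwo_sub_le {f g : α → G} (hf : MemLp f 2 μ) (hg : MemLp g 2 μ) :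
    lTwo μ (fun x => f x - g x) ≤ lTwo μ f + lTwo μ g := by
  unfold lTwo
  rw [← ENNReal.toReal_add hf.2.ne hg.2.ne]
  exact ENNReal.toReal_mono (ENNReal.add_ne_top.2 ⟨hf.2.ne, hg.2.ne⟩)
    (eLpNorm_sub_le hf.1 hg.1 (by norm_num))

theorem lTwo_sub_comm (f g : α → G) :
    lTwo μ (fun x => f x - g x) = lTwo μ (fun x => g x - f x) := by
  unfold lTwo; congr 1; exact eLpNorm_sub_comm f g 2 μ

theorem lTwo_le_of_norm_le {H : Type*} [NormedAddCommGroup H] {f : α → G} {g : α → H} {c : ℝ}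
    (hc : 0 ≤ c) (hg : MemLp g 2 μ) (h : ∀ x, ‖f x‖ ≤ c * ‖g x‖) : lTwo μ f ≤ c * lTwo μ g := by
  unfold lTwo
  have := eLpNorm_le_mul_eLpNorm_of_ae_le_mul (Eventually.of_forall h) (2 : ℝ≥0∞) (μ := μ)
  calc _ ≤ (ENNReal.ofReal c * eLpNorm g 2 μ).toReal :=
        ENNReal.toReal_mono (ENNReal.mul_ne_top ENNReal.ofReal_ne_top hg.2.ne) this
    _ = _ := by rw [ENNReal.toReal_mul, ENNReal.toReal_ofReal hc]

theorem lTwo_smul [NormedSpace ℝ G] (c : ℝ) (f : α → G) :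
    lTwo μ (fun x => c • f x) = |c| * lTwo μ f := by
  have := eLpNorm_const_smul c f 2 μ
  unfold lTwo
  rw [show (fun x => c • f x) = c • f from rfl, this, ENNReal.toReal_mul]
  simp

theorem tendsto_lTwo_iff {ι : Type*} {l : Filter ι} {f : ι → α → G} {g : α → G}
    (hf : ∀ i, MemLp (f i) 2 μ) (hg : MemLp g 2 μ) :
    Tendsto (fun i => lTwo μ (fun x => f i x - g x)) l (𝓝 0) ↔
      Tendsto (fun i => eLpNorm (fun x => f i x - g x) 2 μ) l (𝓝 0) := by
  unfold lTwo
  have h : ∀ i, eLpNorm (fun x => f i x - g x) 2 μ ≠ ⊤ := fun i => ((hf i).sub hg).2.ne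
  rw [← ENNReal.toReal_zero, ENNReal.tendsto_toReal_iff h (by simp)]

theorem MeasureTheory.MemLp.of_norm_le_mul {H : Type*} [NormedAddCommGroup H] {f : α → G} {g : α → H} {c : ℝ}
    (hg : MemLp g 2 μ) (hf : AEStronglyMeasurable f μ) (h : ∀ x, ‖f x‖ ≤ c * ‖g x‖) :
    MemLp f 2 μ := MemLp.of_le_mul hg hf (Eventually.of_forall h)

theorem integral_norm_mul_norm_le {H : Type*} [NormedAddCommGroup H] {f : α → G} {g : α → H}
    (hf : MemLp f 2 μ) (hg : MemLp g 2 μ) :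
    ∫ x, ‖f x‖ * ‖g x‖ ∂μ ≤ lTwo μ f * lTwo μ g := by
  have h := integral_mul_norm_le_Lp_mul_Lq (μ := μ) (f := fun x => ‖f x‖) (g := fun x => ‖g x‖)
    Real.HolderConjugate.two_two (by simpa using hf.norm) (by simpa using hg.norm)
  simp only [norm_norm, Real.rpow_two] at h
  refine h.trans (le_of_eq ?_)
  rw [← lTwo_sq hf.1, ← lTwo_sq hg.1, ← Real.sqrt_eq_rpow, ← Real.sqrt_eq_rpow,
    Real.sqrt_sq (lTwo_nonneg _), Real.sqrt_sq (lTwo_nonneg _)]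

variable [InnerProductSpace ℝ G]

theorem integrable_inner_of_memLp {f g : α → G} (hf : MemLp f 2 μ) (hg : MemLp g 2 μ) :
    Integrable (fun x => ⟪f x, g x⟫) μ := by
  have h1 : Integrable (fun x => ‖f x‖ * ‖g x‖) μ := hf.norm.integrable_mul hg.norm
  exact h1.mono' (hf.1.inner hg.1) (Eventually.of_forall fun x => norm_inner_le_norm _ _)

theorem abs_integral_inner_le {f g : α → G} (hf : MemLp f 2 μ) (hg : MemLp g 2 μ) :
    |∫ x, ⟪f x, g x⟫ ∂μ| ≤ lTwo μ f * lTwo μ g := by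
  rw [← Real.norm_eq_abs]
  refine (norm_integral_le_integral_norm _).trans (le_trans ?_ (integral_norm_mul_norm_le hf hg))
  exact integral_mono (integrable_inner_of_memLp hf hg).norm (hf.norm.integrable_mul hg.norm)
    fun x => norm_inner_le_norm _ _

theorem abs_integral_mul_le {f g : α → ℝ} (hf : MemLp f 2 μ) (hg : MemLp g 2 μ) :
    |∫ x, f x * g x ∂μ| ≤ lTwo μ f * lTwo μ g := by
  have := abs_integral_inner_le hf hg
  simpa [mul_comm] using this

theorem tendsto_integral_inner {ι : Type*} {l : Filter ι} {f g : ι → α → G} {f₀ g₀ : α → G}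
    (hf : ∀ i, MemLp (f i) 2 μ) (hg : ∀ i, MemLp (g i) 2 μ)
    (hf₀ : MemLp f₀ 2 μ) (hg₀ : MemLp g₀ 2 μ)
    (hfl : Tendsto (fun i => lTwo μ (fun x => f i x - f₀ x)) l (𝓝 0))
    (hgl : Tendsto (fun i => lTwo μ (fun x => g i x - g₀ x)) l (𝓝 0)) :
    Tendsto (fun i => ∫ x, ⟪f i x, g i x⟫ ∂μ) l (𝓝 (∫ x, ⟪f₀ x, g₀ x⟫ ∂μ)) := by
  rw [tendsto_iff_norm_sub_tendsto_zero]
  have hb : Tendsto (fun i => lTwo μ (fun x => f i x - f₀ x) *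
      (lTwo μ (fun x => g i x - g₀ x) + lTwo μ g₀) +
      lTwo μ f₀ * lTwo μ (fun x => g i x - g₀ x)) l (𝓝 0) := by
    have := (hfl.mul (hgl.add_const (lTwo μ g₀))).add (hgl.const_mul (lTwo μ f₀))
    simpa using this
  refine squeeze_zero (fun _ => norm_nonneg _) (fun i => ?_) hb
  have h1 := abs_integral_inner_le ((hf i).sub hf₀) (hg i)
  have h2 := abs_integral_inner_le hf₀ ((hg i).sub hg₀)
  have e : (∫ x, ⟪f i x, g i x⟫ ∂μ) - ∫ x, ⟪f₀ x, g₀ x⟫ ∂μ =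
      ∫ x, ⟪(f i - f₀) x, g i x⟫ ∂μ + ∫ x, ⟪f₀ x, (g i - g₀) x⟫ ∂μ := by
    rw [← integral_sub (integrable_inner_of_memLp (hf i) (hg i))
      (integrable_inner_of_memLp hf₀ hg₀),
      ← integral_add (integrable_inner_of_memLp ((hf i).sub hf₀) (hg i))
      (integrable_inner_of_memLp hf₀ ((hg i).sub hg₀))]
    refine integral_congr_ae (Eventually.of_forall fun x => ?_)
    simp [inner_sub_left, inner_sub_right]
  have h3 : lTwo μ (g i) ≤ lTwo μ (fun x => g i x - g₀ x) + lTwo μ g₀ := by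
    have := lTwo_add_le ((hg i).sub hg₀) hg₀
    simp only [Pi.sub_apply, sub_add_cancel] at this
    exact this
  rw [e, Real.norm_eq_abs]
  refine (abs_add_le _ _).trans (add_le_add (h1.trans ?_) h2)
  exact mul_le_mul_of_nonneg_left h3 (lTwo_nonneg _)

theorem tendsto_integral_mul {ι : Type*} {l : Filter ι} {f g : ι → α → ℝ} {f₀ g₀ : α → ℝ}
    (hf : ∀ i, MemLp (f i) 2 μ) (hg : ∀ i, MemLp (g i) 2 μ)
    (hf₀ : MemLp f₀ 2 μ) (hg₀ : MemLp g₀ 2 μ)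
    (hfl : Tendsto (fun i => lTwo μ (fun x => f i x - f₀ x)) l (𝓝 0))
    (hgl : Tendsto (fun i => lTwo μ (fun x => g i x - g₀ x)) l (𝓝 0)) :
    Tendsto (fun i => ∫ x, f i x * g i x ∂μ) l (𝓝 (∫ x, f₀ x * g₀ x ∂μ)) := by
  have := tendsto_integral_inner hf hg hf₀ hg₀ hfl hgl
  simpa [mul_comm] using this

end LTwo

/-! ### Divergence -/

section Divergence
variable {d : ℕ}

/-- The Euclidean divergence in the chart. -/
noncomputable def euclDiv (Y : HypChart d → HypChart d) (y : HypChart d) : ℝ :=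
  ∑ i, ⟪EuclideanSpace.basisFun (Fin d) ℝ i, fderiv ℝ Y y (EuclideanSpace.basisFun (Fin d) ℝ i)⟫

/-- The Riemannian divergence of a vector field given by its chart components. -/
noncomputable def hypDiv (Y : HypChart d → HypChart d) (y : HypChart d) : ℝ :=
  euclDiv Y y - ⟪y, Y y⟫ / (1 + ‖y‖ ^ 2)

theorem integral_euclDiv {Y : HypChart d → HypChart d} (hY : ContDiff ℝ 1 Y)
    (hc : HasCompactSupport Y) : ∫ y, euclDiv Y y = 0 := by
  have hint : ∀ v : HypChart d, Integrable (fun y => ⟪v, fderiv ℝ Y y v⟫) := by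
    intro v
    have h1 : Continuous fun y => ⟪v, fderiv ℝ Y y v⟫ :=
      continuous_const.inner ((hY.continuous_fderiv (by norm_num)).clm_apply continuous_const)
    refine h1.integrable_of_hasCompactSupport ?_
    exact (hc.fderiv ℝ).comp_left (g := fun L : HypChart d →L[ℝ] HypChart d => ⟪v, L v⟫) (by simp)
  unfold euclDiv
  rw [integral_finsetSum _ fun i _ => hint _]
  refine Finset.sum_eq_zero fun i _ => ?_
  set v := EuclideanSpace.basisFun (Fin d) ℝ i
  have hg : ∀ y, fderiv ℝ (fun y => ⟪v, Y y⟫) y v = ⟪v, fderiv ℝ Y y v⟫ := by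
    intro y
    have h := (hY.differentiable (by norm_num) y).hasFDerivAt
    have h2 : HasFDerivAt (fun y => ⟪v, Y y⟫) ((innerSL ℝ v).comp (fderiv ℝ Y y)) y :=
      (innerSL ℝ v).hasFDerivAt.comp y h
    rw [h2.fderiv]
    simp
  have hYi : Integrable fun y => ⟪v, Y y⟫ := by
    refine (continuous_const.inner hY.continuous).integrable_of_hasCompactSupport ?_
    exact hc.comp_left (g := fun w : HypChart d => ⟪v, w⟫) (by simp)
  -- Integration by parts of the i-th component against the constant 1.
  have := integral_mul_fderiv_eq_neg_fderiv_mul_of_integrable (μ := (volume : Measure (HypChart d)))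
    (f := fun _ => (1 : ℝ)) (g := fun y => ⟪v, Y y⟫) (v := v) (by simp) (by simpa [hg] using hint v)
    (by simpa using hYi) (fun x _ => by fun_prop) (fun x _ =>
      (differentiableAt_const v).inner ℝ (hY.differentiable (by norm_num) x))
  simpa [hg] using this

theorem euclDiv_smul {f : HypChart d → ℝ} {Y : HypChart d → HypChart d} {y : HypChart d}
    (hf : DifferentiableAt ℝ f y) (hY : DifferentiableAt ℝ Y y) :
    euclDiv (fun y => f y • Y y) y = f y * euclDiv Y y + ⟪gradient f y, Y y⟫ := by
  unfold euclDiv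
  rw [fderiv_fun_smul hf hY]
  simp only [add_apply, smul_apply,
    ContinuousLinearMap.smulRight_apply, inner_add_right, inner_smul_right, Finset.sum_add_distrib,
    ← Finset.mul_sum, ← inner_gradient_left]
  rw [OrthonormalBasis.sum_inner_mul_inner]

theorem continuous_euclDiv {Y : HypChart d → HypChart d} (hY : ContDiff ℝ 1 Y) :
    Continuous (euclDiv Y) := by
  unfold euclDiv
  exact continuous_finsetSum _ fun i _ =>
    continuous_const.inner ((hY.continuous_fderiv (by norm_num)).clm_apply continuous_const)

theorem continuous_hypDiv {Y : HypChart d → HypChart d} (hY : ContDiff ℝ 1 Y) :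
    Continuous (hypDiv Y) := by
  unfold hypDiv
  exact (continuous_euclDiv hY).sub ((continuous_id.inner hY.continuous).div (by fun_prop)
    fun y => by positivity)

theorem hasCompactSupport_hypDiv {Y : HypChart d → HypChart d} (hc : HasCompactSupport Y) :
    HasCompactSupport (hypDiv Y) := by
  refine HasCompactSupport.intro hc fun y hy => ?_
  have h1 : fderiv ℝ Y y = 0 := by
    have := (notMem_tsupport_iff_eventuallyEq.1 hy).fderiv_eq (𝕜 := ℝ)
    rw [this]; exact fderiv_const_apply 0
  simp [hypDiv, euclDiv, h1, image_eq_zero_of_notMem_tsupport hy]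

theorem gradient_comp {Ψ : ℝ → ℝ} {φ : HypChart d → ℝ} {c : ℝ} {y : HypChart d}
    (hΨ : HasDerivAt Ψ c (φ y)) (hφ : DifferentiableAt ℝ φ y) :
    gradient (fun y => Ψ (φ y)) y = c • gradient φ y := by
  have h : HasFDerivAt (fun y => Ψ (φ y)) (c • fderiv ℝ φ y) y :=
    hΨ.comp_hasFDerivAt y hφ.hasFDerivAt
  refine ext_inner_right ℝ fun v => ?_
  rw [inner_gradient_left, h.fderiv]
  simp [inner_smul_left, inner_gradient_left]

theorem gradient_height (y : HypChart d) : gradient (height (d := d)) y = (1 / height y) • y := by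
  refine ext_inner_right ℝ fun v => ?_
  rw [inner_gradient_left, (hasFDerivAt_height y).fderiv]
  simp [inner_smul_left]

theorem inner_gradient_inv_height (y v : HypChart d) :
    ⟪gradient (fun y : HypChart d => 1 / height y) y, v⟫ = -⟪y, v⟫ / height y ^ 3 := by
  have h0 := (height_pos y).ne'
  simp only [one_div]
  rw [gradient_comp (hasDerivAt_inv h0) (hasFDerivAt_height y).differentiableAt, gradient_height]
  simp only [inner_smul_left, RCLike.conj_to_real]
  field_simp

theorem gradient_fun_mul {f g : HypChart d → ℝ} {y : HypChart d} (hf : DifferentiableAt ℝ f y)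
    (hg : DifferentiableAt ℝ g y) :
    gradient (fun y => f y * g y) y = f y • gradient g y + g y • gradient f y := by
  refine ext_inner_right ℝ fun v => ?_
  rw [inner_gradient_left, fderiv_fun_mul hf hg]
  simp [inner_add_left, inner_smul_left, inner_gradient_left]

/-- The divergence theorem, tested against a `C¹` function. -/
theorem integral_hypDiv_mul {Y : HypChart d → HypChart d} (hY : ContDiff ℝ 1 Y)
    (hc : HasCompactSupport Y) {φ : HypChart d → ℝ} (hφ : ContDiff ℝ 1 φ) :
    ∫ y, (hypDiv Y y * φ y + ⟪Y y, gradient φ y⟫) ∂(hypVolume d) = 0 := by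
  rw [integral_hypVolume]
  have hw : ContDiff ℝ 1 (fun y : HypChart d => 1 / height y) :=
    contDiff_const.div contDiff_height fun y => (height_pos y).ne'
  -- The field φ Y / height absorbs the volume density: its Euclidean divergence is the integrand
  -- times that density.
  have hZ : ContDiff ℝ 1 fun y => (1 / height y * φ y) • Y y := (hw.mul hφ).smul hY
  have hZc : HasCompactSupport fun y => (1 / height y * φ y) • Y y :=
    hc.mono' fun y hy => subset_tsupport _ fun h0 => hy (by simp [h0])
  refine Eq.trans ?_ (integral_euclDiv hZ hZc)
  refine integral_congr_ae (Eventually.of_forall fun y => ?_)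
  have hwd := hw.differentiable (by norm_num) y
  have hφd := hφ.differentiable (by norm_num) y
  simp only
  rw [euclDiv_smul (hwd.fun_mul hφd) (hY.differentiable (by norm_num) y),
    gradient_fun_mul hwd hφd, inner_add_left, inner_smul_left, inner_smul_left,
    inner_gradient_inv_height, hypDiv, ← height_sq, real_inner_comm]
  have := (height_pos y).ne'
  simp
  field_simp
  ring

end Divergence

/-! ### Test functions -/

section Test
variable {d : ℕ} {φ ψ : HypChart d → ℝ}

theorem IsTestFn.differentiableAt (h : IsTestFn φ) (y : HypChart d) : DifferentiableAt ℝ φ y :=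
  h.1.differentiable (by simp) y

theorem IsTestFn.contDiff_one (h : IsTestFn φ) : ContDiff ℝ 1 φ :=
  h.1.of_le (by exact_mod_cast le_top)

theorem IsTestFn.sub (h : IsTestFn φ) (k : IsTestFn ψ) : IsTestFn fun y => φ y - ψ y :=
  ⟨h.1.sub k.1, h.2.sub k.2⟩

theorem IsTestFn.const_mul (c : ℝ) (h : IsTestFn φ) : IsTestFn fun y => c * φ y :=
  ⟨contDiff_const.mul h.1, h.2.mul_left⟩

theorem IsTestFn.mul (h : IsTestFn φ) (k : IsTestFn ψ) : IsTestFn fun y => φ y * ψ y :=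
  ⟨h.1.mul k.1, k.2.mul_left⟩

theorem gradient_eq_toDual_symm (φ : HypChart d → ℝ) :
    gradient φ = fun y => (InnerProductSpace.toDual ℝ (HypChart d)).symm (fderiv ℝ φ y) := rfl

theorem contDiff_gradient {m n : WithTop ℕ∞} (h : ContDiff ℝ n φ) (hmn : m + 1 ≤ n) :
    ContDiff ℝ m (gradient φ) :=
  (InnerProductSpace.toDual ℝ (HypChart d)).symm.contDiff.comp (h.fderiv_right hmn)

theorem hasCompactSupport_gradient (h : HasCompactSupport φ) : HasCompactSupport (gradient φ) :=
  (h.fderiv ℝ).comp_left (g := (InnerProductSpace.toDual ℝ (HypChart d)).symm) (map_zero _)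

theorem IsTestFn.continuous_gradient (h : IsTestFn φ) : Continuous (gradient φ) :=
  (contDiff_gradient (m := 0) h.contDiff_one (by norm_num)).continuous

theorem gradient_fun_sub {y : HypChart d} (hf : DifferentiableAt ℝ φ y)
    (hg : DifferentiableAt ℝ ψ y) :
    gradient (fun y => φ y - ψ y) y = gradient φ y - gradient ψ y := by
  refine ext_inner_right ℝ fun v => ?_
  rw [inner_gradient_left, fderiv_fun_sub hf hg]
  simp [inner_sub_left, inner_gradient_left]

theorem gradient_const_mul {y : HypChart d} (c : ℝ) (hf : DifferentiableAt ℝ φ y) :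
    gradient (fun y => c * φ y) y = c • gradient φ y := by
  refine ext_inner_right ℝ fun v => ?_
  rw [inner_gradient_left, fderiv_const_mul hf]
  simp [inner_smul_left, inner_gradient_left]

theorem continuous_coframe_comp {ξ : HypChart d → HypChart d} (h : Continuous ξ) :
    Continuous fun y => coframe y (ξ y) :=
  continuous_coframe.comp (continuous_id.prodMk h)

theorem hasCompactSupport_coframe {ξ : HypChart d → HypChart d} (h : HasCompactSupport ξ) :
    HasCompactSupport fun y => coframe y (ξ y) :=
  h.mono' fun y hy => subset_tsupport _ fun h0 => hy (by simp [coframe, h0])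

theorem memLp_coframe_of_continuous {ξ : HypChart d → HypChart d} (h : Continuous ξ)
    (hc : HasCompactSupport ξ) : MemLp (fun y => coframe y (ξ y)) 2 (hypVolume d) :=
  (continuous_coframe_comp h).memLp_of_hasCompactSupport (hasCompactSupport_coframe hc)

theorem IsTestFn.memLp (h : IsTestFn φ) : MemLp φ 2 (hypVolume d) :=
  h.1.continuous.memLp_of_hasCompactSupport h.2

theorem IsTestFn.memLp_coframe (h : IsTestFn φ) :
    MemLp (fun y => coframe y (gradient φ y)) 2 (hypVolume d) :=
  memLp_coframe_of_continuous h.continuous_gradient (hasCompactSupport_gradient h.2)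

end Test

/-! ### The space `H¹` -/

section HOne
variable {d : ℕ} {u v : HypChart d → ℝ} {Du Dv : HypChart d → HypChart d}

/-- `IsH1` only asks the differential to be measurable; a single approximant at finite distance from
it shows that it is square integrable. -/
theorem IsH1.memLp_coframe (h : IsH1 u Du) :
    MemLp (fun y => coframe y (Du y)) 2 (hypVolume d) := by
  obtain ⟨φ, hφ, -, hD⟩ := h.approx
  refine ⟨aestronglyMeasurable_coframe h.meas, ?_⟩
  obtain ⟨n, hn⟩ := (hD.eventually (gt_mem_nhds ENNReal.zero_lt_top)).exists
  rw [covecL2_eq] at hn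
  have h1 : MemLp (fun y => coframe y (gradient (φ n) y - Du y)) 2 (hypVolume d) :=
    ⟨aestronglyMeasurable_coframe
      ((hφ n).continuous_gradient.aestronglyMeasurable.sub h.meas), hn⟩
  have h2 := (hφ n).memLp_coframe.sub h1
  have e : (fun y => coframe y (gradient (φ n) y)) -
      (fun y => coframe y (gradient (φ n) y - Du y)) = fun y => coframe y (Du y) := by
    ext1 y; simp [coframe_sub]
  rw [e] at h2
  exact h2.2

/-- Approximation by test functions, in norm and almost everywhere. -/
theorem IsH1.exists_approx (h : IsH1 u Du) : ∃ φ : ℕ → HypChart d → ℝ, (∀ n, IsTestFn (φ n)) ∧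
    Tendsto (fun n => lTwo (hypVolume d) (fun y => φ n y - u y)) atTop (𝓝 0) ∧
    Tendsto (fun n => lTwo (hypVolume d)
      (fun y => coframe y (gradient (φ n) y) - coframe y (Du y))) atTop (𝓝 0) ∧
    ∀ᵐ y ∂(hypVolume d), Tendsto (fun n => φ n y) atTop (𝓝 (u y)) := by
  obtain ⟨φ, hφ, h1, h2⟩ := h.approx
  obtain ⟨ns, hns, hae⟩ := (tendstoInMeasure_of_tendsto_eLpNorm (p := 2) (by norm_num)
    (fun n => (hφ n).memLp.1) h.memLp.1 h1).exists_seq_tendsto_ae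
  refine ⟨fun n => φ (ns n), fun n => hφ _, ?_, ?_, hae⟩
  · exact ((tendsto_lTwo_iff (fun n => (hφ n).memLp) h.memLp).2 h1).comp hns.tendsto_atTop
  · refine ((tendsto_lTwo_iff (fun n => (hφ n).memLp_coframe) h.memLp_coframe).2 ?_).comp
      hns.tendsto_atTop
    simpa only [covecL2_eq, coframe_sub] using h2

theorem IsH1.of_approx (hu : MemLp u 2 (hypVolume d))
    (hD : MemLp (fun y => coframe y (Du y)) 2 (hypVolume d))
    (hm : AEStronglyMeasurable Du (hypVolume d)) {φ : ℕ → HypChart d → ℝ}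
    (hφ : ∀ n, IsTestFn (φ n))
    (h1 : Tendsto (fun n => lTwo (hypVolume d) (fun y => φ n y - u y)) atTop (𝓝 0))
    (h2 : Tendsto (fun n => lTwo (hypVolume d)
      (fun y => coframe y (gradient (φ n) y) - coframe y (Du y))) atTop (𝓝 0)) : IsH1 u Du := by
  refine ⟨hu, hm, φ, hφ, (tendsto_lTwo_iff (fun n => (hφ n).memLp) hu).1 h1, ?_⟩
  simpa only [covecL2_eq, coframe_sub] using
    (tendsto_lTwo_iff (fun n => (hφ n).memLp_coframe) hD).1 h2

theorem IsTestFn.isH1 (h : IsTestFn u) : IsH1 u (gradient u) := by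
  refine IsH1.of_approx h.memLp h.memLp_coframe h.continuous_gradient.aestronglyMeasurable
    (φ := fun _ => u) (fun _ => h) ?_ ?_ <;> simp [lTwo]

theorem IsH1.sub (hu : IsH1 u Du) (hv : IsH1 v Dv) :
    IsH1 (fun y => u y - v y) (fun y => Du y - Dv y) := by
  obtain ⟨φ, hφ, h1, h2, -⟩ := hu.exists_approx
  obtain ⟨ψ, hψ, k1, k2, -⟩ := hv.exists_approx
  refine IsH1.of_approx (φ := fun n y => φ n y - ψ n y) (hu.memLp.sub hv.memLp) ?_
    (hu.meas.sub hv.meas) (fun n => (hφ n).sub (hψ n)) ?_ ?_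
  · simp only [coframe_sub]; exact hu.memLp_coframe.sub hv.memLp_coframe
  · refine squeeze_zero (fun _ => lTwo_nonneg _) (fun n => ?_) (by simpa using h1.add k1)
    have := lTwo_sub_le ((hφ n).memLp.sub hu.memLp) ((hψ n).memLp.sub hv.memLp)
    refine le_trans (le_of_eq ?_) this
    congr 1
    ext1 y; simp only [Pi.sub_apply]; ring
  · refine squeeze_zero (fun _ => lTwo_nonneg _) (fun n => ?_) (by simpa using h2.add k2)
    have := lTwo_sub_le ((hφ n).memLp_coframe.sub hu.memLp_coframe)
      ((hψ n).memLp_coframe.sub hv.memLp_coframe)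
    refine le_trans (le_of_eq ?_) this
    congr 1
    ext1 y
    rw [gradient_fun_sub ((hφ n).differentiableAt y) ((hψ n).differentiableAt y)]
    simp only [coframe_sub, Pi.sub_apply]; abel

theorem IsH1.const_mul (c : ℝ) (hu : IsH1 u Du) : IsH1 (fun y => c * u y) (fun y => c • Du y) := by
  obtain ⟨φ, hφ, h1, h2, -⟩ := hu.exists_approx
  refine IsH1.of_approx (φ := fun n y => c * φ n y) (hu.memLp.const_mul c) ?_
    (hu.meas.const_smul c) (fun n => (hφ n).const_mul c) ?_ ?_
  · simp only [coframe_smul]; exact hu.memLp_coframe.const_smul c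
  · have := h1.const_mul |c|
    simp only [← lTwo_smul, mul_zero] at this
    simpa [mul_sub] using this
  · have := h2.const_mul |c|
    simp only [← lTwo_smul, mul_zero] at this
    convert this using 4 with n y
    rw [gradient_const_mul c ((hφ n).differentiableAt y), coframe_smul, coframe_smul, smul_sub]

theorem exists_bound_of_hasCompactSupport {G : Type*} [NormedAddCommGroup G] {f : HypChart d → G}
    (hf : Continuous f) (hc : HasCompactSupport f) : ∃ C : ℝ, 0 ≤ C ∧ ∀ y, ‖f y‖ ≤ C := by
  obtain ⟨C, hC⟩ := hc.exists_bound_of_continuous hf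
  exact ⟨C, (norm_nonneg _).trans (hC 0), hC⟩

/-- Bounds on b and on ∇b carry the approximating sequence of u to one for b u. Such products enter
the difference multiplier. -/
theorem IsH1.mul_test {b : HypChart d → ℝ} (hb : IsTestFn b) (hu : IsH1 u Du) :
    IsH1 (fun y => b y * u y) (fun y => b y • Du y + u y • gradient b y) := by
  obtain ⟨φ, hφ, h1, h2, -⟩ := hu.exists_approx
  obtain ⟨B, hB0, hB⟩ := exists_bound_of_hasCompactSupport hb.1.continuous hb.2
  obtain ⟨B', hB'0, hB'⟩ := exists_bound_of_hasCompactSupport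
    (continuous_coframe_comp hb.continuous_gradient)
    (hasCompactSupport_coframe (hasCompactSupport_gradient hb.2))
  have hbm := hb.1.continuous.aestronglyMeasurable (μ := hypVolume d)
  have hbm' := (continuous_coframe_comp hb.continuous_gradient).aestronglyMeasurable
    (μ := hypVolume d)
  have m1 : ∀ {w : HypChart d → ℝ}, MemLp w 2 (hypVolume d) →
      MemLp (fun y => b y * w y) 2 (hypVolume d) := fun hw =>
    hw.of_norm_le_mul (hbm.mul hw.1) fun y => by
      rw [norm_mul]; exact mul_le_mul_of_nonneg_right (hB y) (norm_nonneg _)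
  have n2 : ∀ (w : HypChart d → ℝ) y, ‖w y • coframe y (gradient b y)‖ ≤ B' * ‖w y‖ := by
    intro w y
    rw [norm_smul, mul_comm]; exact mul_le_mul_of_nonneg_right (hB' y) (norm_nonneg _)
  have n3 : ∀ (ξ : HypChart d → HypChart d) y, ‖b y • ξ y‖ ≤ B * ‖ξ y‖ := by
    intro w y
    rw [norm_smul]; exact mul_le_mul_of_nonneg_right (hB y) (norm_nonneg _)
  have m2 : ∀ {w : HypChart d → ℝ}, MemLp w 2 (hypVolume d) →
      MemLp (fun y => w y • coframe y (gradient b y)) 2 (hypVolume d) := fun hw =>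
    hw.of_norm_le_mul (hw.1.smul hbm') (n2 _)
  have m3 : ∀ {ξ : HypChart d → HypChart d}, MemLp ξ 2 (hypVolume d) →
      MemLp (fun y => b y • ξ y) 2 (hypVolume d) := fun hξ =>
    hξ.of_norm_le_mul (hbm.smul hξ.1) (n3 _)
  refine IsH1.of_approx (φ := fun n y => b y * φ n y) (m1 hu.memLp) ?_
    ((hbm.smul hu.meas).add (hu.memLp.1.smul hb.continuous_gradient.aestronglyMeasurable))
    (fun n => hb.mul (hφ n)) ?_ ?_
  · simp only [coframe_add, coframe_smul]; exact (m3 hu.memLp_coframe).add (m2 hu.memLp)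
  · refine squeeze_zero (fun _ => lTwo_nonneg _) (fun n => ?_) (by simpa using h1.const_mul B)
    refine lTwo_le_of_norm_le hB0 ((hφ n).memLp.sub hu.memLp) fun y => ?_
    rw [← mul_sub, norm_mul]; exact mul_le_mul_of_nonneg_right (hB y) (norm_nonneg _)
  · refine squeeze_zero (fun _ => lTwo_nonneg _) (fun n => ?_)
      (by simpa using (h2.const_mul B).add (h1.const_mul B'))
    have a1 := (hφ n).memLp_coframe.sub hu.memLp_coframe
    have a2 := (hφ n).memLp.sub hu.memLp
    have := lTwo_add_le (m3 a1) (m2 a2)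
    refine le_trans (le_of_eq ?_) (this.trans (add_le_add
      (lTwo_le_of_norm_le hB0 a1 (n3 _)) (lTwo_le_of_norm_le hB'0 a2 (n2 _))))
    congr 1
    ext1 y
    rw [gradient_fun_mul (hb.differentiableAt y) ((hφ n).differentiableAt y)]
    simp only [coframe_add, coframe_smul, Pi.sub_apply, smul_sub, sub_smul]; abel

theorem norm_inner_le_mul_coframe {Y : HypChart d → HypChart d} {C : ℝ} (hC : ∀ y, ‖Y y‖ ≤ C)
    (y ξ : HypChart d) : ‖⟪Y y, ξ⟫‖ ≤ C * ‖coframe y ξ‖ :=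
  (norm_inner_le_norm _ _).trans (mul_le_mul (hC y) (norm_le_norm_coframe y ξ) (norm_nonneg _)
    ((norm_nonneg _).trans (hC y)))

theorem memLp_inner_field {Y : HypChart d → HypChart d} (hY : Continuous Y)
    (hYc : HasCompactSupport Y) {ξ : HypChart d → HypChart d}
    (hm : AEStronglyMeasurable ξ (hypVolume d))
    (hξ : MemLp (fun y => coframe y (ξ y)) 2 (hypVolume d)) :
    MemLp (fun y => ⟪Y y, ξ y⟫) 2 (hypVolume d) := by
  obtain ⟨C, -, hC⟩ := exists_bound_of_hasCompactSupport hY hYc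
  exact hξ.of_norm_le_mul (hY.aestronglyMeasurable.inner hm)
    fun y => norm_inner_le_mul_coframe hC _ _

theorem memLp_bdd_mul {f w : HypChart d → ℝ} (hf : Continuous f) (hc : HasCompactSupport f)
    (hw : MemLp w 2 (hypVolume d)) : MemLp (fun y => f y * w y) 2 (hypVolume d) := by
  obtain ⟨B, -, hB⟩ := exists_bound_of_hasCompactSupport hf hc
  refine hw.of_norm_le_mul (hf.aestronglyMeasurable.mul hw.1) (c := B) fun y => ?_
  rw [norm_mul]; exact mul_le_mul_of_nonneg_right (hB y) (norm_nonneg _)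

theorem tendsto_lTwo_bdd_mul {f w : HypChart d → ℝ} (hf : Continuous f) (hc : HasCompactSupport f)
    {a : ℕ → HypChart d → ℝ} (ha : ∀ n, MemLp (a n) 2 (hypVolume d)) (hw : MemLp w 2 (hypVolume d))
    (h : Tendsto (fun n => lTwo (hypVolume d) (fun y => a n y - w y)) atTop (𝓝 0)) :
    Tendsto (fun n => lTwo (hypVolume d) (fun y => f y * a n y - f y * w y)) atTop (𝓝 0) := by
  obtain ⟨B, hB0, hB⟩ := exists_bound_of_hasCompactSupport hf hc
  refine squeeze_zero (fun _ => lTwo_nonneg _) (fun n => ?_) (by simpa using h.const_mul B)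
  refine lTwo_le_of_norm_le hB0 ((ha n).sub hw) fun y => ?_
  rw [← mul_sub, norm_mul]; exact mul_le_mul_of_nonneg_right (hB y) (norm_nonneg _)

theorem tendsto_lTwo_inner_field {Y : HypChart d → HypChart d} (hY : Continuous Y)
    (hYc : HasCompactSupport Y) (hu : IsH1 u Du) {φ : ℕ → HypChart d → ℝ}
    (hφ : ∀ n, IsTestFn (φ n)) (h : Tendsto (fun n => lTwo (hypVolume d)
      (fun y => coframe y (gradient (φ n) y) - coframe y (Du y))) atTop (𝓝 0)) :
    Tendsto (fun n => lTwo (hypVolume d) (fun y => ⟪Y y, gradient (φ n) y⟫ - ⟪Y y, Du y⟫))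
      atTop (𝓝 0) := by
  obtain ⟨C, hC0, hC⟩ := exists_bound_of_hasCompactSupport hY hYc
  refine squeeze_zero (fun _ => lTwo_nonneg _) (fun n => ?_) (by simpa using h.const_mul C)
  refine lTwo_le_of_norm_le hC0 ((hφ n).memLp_coframe.sub hu.memLp_coframe) fun y => ?_
  rw [← inner_sub_right]
  simpa only [coframe_sub] using norm_inner_le_mul_coframe hC y (gradient (φ n) y - Du y)

/-- The divergence theorem for products of two `H¹` functions. -/
theorem IsH1.integral_mul_hypDiv (hu : IsH1 u Du) (hv : IsH1 v Dv) {Y : HypChart d → HypChart d}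
    (hY : ContDiff ℝ 1 Y) (hYc : HasCompactSupport Y) :
    ∫ y, hypDiv Y y * u y * v y ∂(hypVolume d) =
      -(∫ y, ⟪Y y, Du y⟫ * v y ∂(hypVolume d)) - ∫ y, u y * ⟪Y y, Dv y⟫ ∂(hypVolume d) := by
  obtain ⟨φ, hφ, h1, h2, -⟩ := hu.exists_approx
  obtain ⟨ψ, hψ, k1, k2, -⟩ := hv.exists_approx
  have hd := continuous_hypDiv hY
  have hdc := hasCompactSupport_hypDiv hYc
  have t1 := tendsto_integral_mul (fun n => memLp_bdd_mul hd hdc (hφ n).memLp)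
    (fun n => (hψ n).memLp) (memLp_bdd_mul hd hdc hu.memLp) hv.memLp
    (tendsto_lTwo_bdd_mul hd hdc (fun n => (hφ n).memLp) hu.memLp h1) k1
  have t2 := tendsto_integral_mul
    (fun n => memLp_inner_field hY.continuous hYc
      (hφ n).continuous_gradient.aestronglyMeasurable (hφ n).memLp_coframe)
    (fun n => (hψ n).memLp) (memLp_inner_field hY.continuous hYc hu.meas hu.memLp_coframe)
    hv.memLp (tendsto_lTwo_inner_field hY.continuous hYc hu hφ h2) k1
  have t3 := tendsto_integral_mul (fun n => (hφ n).memLp)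
    (fun n => memLp_inner_field hY.continuous hYc
      (hψ n).continuous_gradient.aestronglyMeasurable (hψ n).memLp_coframe) hu.memLp
    (memLp_inner_field hY.continuous hYc hv.meas hv.memLp_coframe) h1
    (tendsto_lTwo_inner_field hY.continuous hYc hv hψ k2)
  refine tendsto_nhds_unique t1 (((t2.neg).sub t3).congr fun n => ?_)
  have i1 : Integrable (fun y => hypDiv Y y * φ n y * ψ n y) (hypVolume d) :=
    (memLp_bdd_mul hd hdc (hφ n).memLp).integrable_mul (hψ n).memLp
  have i2 : Integrable (fun y => ⟪Y y, gradient (φ n) y⟫ * ψ n y) (hypVolume d) :=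
    (memLp_inner_field hY.continuous hYc
      (hφ n).continuous_gradient.aestronglyMeasurable (hφ n).memLp_coframe).integrable_mul
      (hψ n).memLp
  have i3 : Integrable (fun y => φ n y * ⟪Y y, gradient (ψ n) y⟫) (hypVolume d) :=
    (hφ n).memLp.integrable_mul (memLp_inner_field hY.continuous hYc
      (hψ n).continuous_gradient.aestronglyMeasurable (hψ n).memLp_coframe)
  have := integral_hypDiv_mul hY hYc ((hφ n).mul (hψ n)).contDiff_one
  rw [show (∫ y, (hypDiv Y y * (φ n y * ψ n y) +
      ⟪Y y, gradient (fun y => φ n y * ψ n y) y⟫) ∂(hypVolume d)) =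
      ∫ y, (hypDiv Y y * φ n y * ψ n y + (⟪Y y, gradient (φ n) y⟫ * ψ n y +
        φ n y * ⟪Y y, gradient (ψ n) y⟫)) ∂(hypVolume d) from
    integral_congr_ae (Eventually.of_forall fun y => by
      simp only
      rw [gradient_fun_mul ((hφ n).differentiableAt y) ((hψ n).differentiableAt y),
        inner_add_right, inner_smul_right, inner_smul_right]
      ring), integral_add i1 (i2.fun_add i3), integral_add i2 i3] at this
  linarith

/-- The divergence theorem for `Ψ(u)`, `u ∈ H¹`. -/
theorem IsH1.integral_comp_hypDiv (hu : IsH1 u Du) {Ψ ψ : ℝ → ℝ} {B : ℝ}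
    (hΨ : ∀ σ, HasDerivAt Ψ (ψ σ) σ) (hψ : Continuous ψ) (hB : ∀ σ, |ψ σ| ≤ B) (h0 : Ψ 0 = 0)
    {Y : HypChart d → HypChart d} (hY : ContDiff ℝ 1 Y) (hYc : HasCompactSupport Y) :
    ∫ y, hypDiv Y y * Ψ (u y) ∂(hypVolume d) = -∫ y, ψ (u y) * ⟪Y y, Du y⟫ ∂(hypVolume d) := by
  obtain ⟨φ, hφ, h1, h2, h3⟩ := hu.exists_approx
  have hd := continuous_hypDiv hY
  have hdc := hasCompactSupport_hypDiv hYc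
  have hB0 : 0 ≤ B := (abs_nonneg _).trans (hB 0)
  have hΨc : Continuous Ψ := continuous_iff_continuousAt.2 fun σ => (hΨ σ).continuousAt
  have lip : ∀ a b, ‖Ψ a - Ψ b‖ ≤ B * ‖a - b‖ := fun a b =>
    Convex.norm_image_sub_le_of_norm_hasDerivWithin_le (s := univ)
      (fun x _ => (hΨ x).hasDerivWithinAt) (fun x _ => hB x) convex_univ (mem_univ b) (mem_univ a)
  have mΨ : ∀ {w : HypChart d → ℝ}, MemLp w 2 (hypVolume d) →
      MemLp (fun y => Ψ (w y)) 2 (hypVolume d) := fun hw =>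
    hw.of_norm_le_mul (hΨc.comp_aestronglyMeasurable hw.1) fun y => by
      simpa [h0] using lip _ 0
  have hdL : MemLp (hypDiv Y) 2 (hypVolume d) := hd.memLp_of_hasCompactSupport hdc
  have t1 := tendsto_integral_mul (l := atTop) (fun _ : ℕ => hdL) (fun n => mΨ (hφ n).memLp) hdL
    (mΨ hu.memLp) (by simp [lTwo]) (by
      refine squeeze_zero (fun _ => lTwo_nonneg _) (fun n => ?_) (by simpa using h1.const_mul B)
      exact lTwo_le_of_norm_le hB0 ((hφ n).memLp.sub hu.memLp) fun y => lip _ _)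
  have hYL : MemLp Y 2 (hypVolume d) := hY.continuous.memLp_of_hasCompactSupport hYc
  have hmψ : ∀ n, AEStronglyMeasurable (fun y => ψ (φ n y)) (hypVolume d) := fun n =>
    (hψ.comp (hφ n).1.continuous).aestronglyMeasurable
  have hint : Integrable (fun y => ⟪Y y, Du y⟫) (hypVolume d) := by
    refine (hYL.norm.integrable_mul hu.memLp_coframe.norm).mono' (hYL.1.inner hu.meas)
      (Eventually.of_forall fun y => (norm_inner_le_norm _ _).trans ?_)
    exact mul_le_mul_of_nonneg_left (norm_le_norm_coframe _ _) (norm_nonneg _)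
  -- Here ∇φ_n is split as Du + (∇φ_n - Du). Against Du the a.e. convergence of ψ(φ_n) suffices, by
  -- domination; against the difference the bound on ψ and the L² convergence of the gradients do.
  have t2 : Tendsto (fun n => ∫ y, ψ (φ n y) * ⟪Y y, Du y⟫ ∂(hypVolume d)) atTop
      (𝓝 (∫ y, ψ (u y) * ⟪Y y, Du y⟫ ∂(hypVolume d))) := by
    refine tendsto_integral_of_dominated_convergence (fun y => B * ‖⟪Y y, Du y⟫‖)
      (fun n => (hmψ n).mul hint.1) (hint.norm.const_mul B)
      (fun n => Eventually.of_forall fun y => ?_) (h3.mono fun y hy => ?_)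
    · rw [norm_mul]; exact mul_le_mul_of_nonneg_right (hB _) (norm_nonneg _)
    · exact ((hψ.tendsto _).comp hy).mul_const _
  have hdiff : ∀ n, MemLp (fun y => coframe y (gradient (φ n) y - Du y)) 2 (hypVolume d) := by
    intro n; simp only [coframe_sub]; exact (hφ n).memLp_coframe.sub hu.memLp_coframe
  have hm3 : ∀ n, AEStronglyMeasurable (fun y => ψ (φ n y) * ⟪Y y, gradient (φ n) y - Du y⟫)
      (hypVolume d) := fun n => (hmψ n).mul (hYL.1.inner
        ((hφ n).continuous_gradient.aestronglyMeasurable.sub hu.meas))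
  have hb3 : ∀ n y, ‖ψ (φ n y) * ⟪Y y, gradient (φ n) y - Du y⟫‖ ≤
      B * (‖Y y‖ * ‖coframe y (gradient (φ n) y - Du y)‖) := by
    intro n y
    rw [norm_mul]
    refine mul_le_mul (hB _) ((norm_inner_le_norm _ _).trans ?_) (norm_nonneg _) hB0
    exact mul_le_mul_of_nonneg_left (norm_le_norm_coframe _ _) (norm_nonneg _)
  have hi3 : ∀ n, Integrable (fun y => B * (‖Y y‖ * ‖coframe y (gradient (φ n) y - Du y)‖))
      (hypVolume d) := fun n => (hYL.norm.integrable_mul (hdiff n).norm).const_mul B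
  have t3 : Tendsto (fun n => ∫ y, ψ (φ n y) * ⟪Y y, gradient (φ n) y - Du y⟫ ∂(hypVolume d))
      atTop (𝓝 0) := by
    refine squeeze_zero_norm (a := fun n => B * (lTwo (hypVolume d) Y * lTwo (hypVolume d)
      (fun y => coframe y (gradient (φ n) y) - coframe y (Du y)))) (fun n => ?_)
      (by simpa using (h2.const_mul (lTwo (hypVolume d) Y)).const_mul B)
    refine (norm_integral_le_of_norm_le (hi3 n) (Eventually.of_forall (hb3 n))).trans ?_
    rw [integral_const_mul]
    refine mul_le_mul_of_nonneg_left ?_ hB0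
    simpa only [coframe_sub] using integral_norm_mul_norm_le hYL (hdiff n)
  refine tendsto_nhds_unique t1 ?_
  have t4 := (t2.add t3).neg
  rw [add_zero] at t4
  refine t4.congr fun n => ?_
  have hΨ1 : ContDiff ℝ 1 fun y => Ψ (φ n y) := by
    have : ContDiff ℝ 1 Ψ := contDiff_one_iff_deriv.2
      ⟨fun σ => (hΨ σ).differentiableAt, by rwa [show deriv Ψ = ψ from funext fun σ => (hΨ σ).deriv]⟩
    exact this.comp (hφ n).contDiff_one
  have hgr : ∀ y, gradient (fun y => Ψ (φ n y)) y = ψ (φ n y) • gradient (φ n) y := fun y =>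
    gradient_comp (hΨ _) ((hφ n).differentiableAt y)
  have key := integral_hypDiv_mul hY hYc hΨ1
  have i1 : Integrable (fun y => hypDiv Y y * Ψ (φ n y)) (hypVolume d) :=
    hdL.integrable_mul (mΨ (hφ n).memLp)
  have i2 : Integrable (fun y => ψ (φ n y) * ⟪Y y, Du y⟫) (hypVolume d) :=
    (hint.norm.const_mul B).mono' ((hmψ n).mul hint.1) (Eventually.of_forall fun y => by
      rw [norm_mul]; exact mul_le_mul_of_nonneg_right (hB _) (norm_nonneg _))
  have i3 : Integrable (fun y => ψ (φ n y) * ⟪Y y, gradient (φ n) y - Du y⟫) (hypVolume d) :=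
    (hi3 n).mono' (hm3 n) (Eventually.of_forall (hb3 n))
  rw [show (∫ y, (hypDiv Y y * Ψ (φ n y) + ⟪Y y, gradient (fun y => Ψ (φ n y)) y⟫)
      ∂(hypVolume d)) = ∫ y, (hypDiv Y y * Ψ (φ n y) + (ψ (φ n y) * ⟪Y y, Du y⟫ +
        ψ (φ n y) * ⟪Y y, gradient (φ n) y - Du y⟫)) ∂(hypVolume d) from
    integral_congr_ae (Eventually.of_forall fun y => by
      simp only [hgr, inner_smul_right, inner_sub_right]; ring),
    integral_add i1 (i2.fun_add i3), integral_add i2 i3] at key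
  linarith

end HOne

/-! ### Lorentz boosts -/

section Boost
variable {d : ℕ}

/-- The boost by `s` in the direction of the unit vector `e`, in the chart. -/
noncomputable def boost (e : HypChart d) (s : ℝ) (y : HypChart d) : HypChart d :=
  y + ((Real.cosh s - 1) * ⟪e, y⟫ + Real.sinh s * height y) • e

variable {e : HypChart d}

/-- The boost is a hyperbolic rotation of the plane spanned by e and the vertical axis, and this is
its vertical component. The inequalities |sinh s| ≤ cosh s and |⟨e,y⟩| ≤ height y keep it on the
upper sheet, which selects the nonnegative square root. -/
theorem height_boost (he : ‖e‖ = 1) (s : ℝ) (y : HypChart d) :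
    height (boost e s y) = Real.cosh s * height y + Real.sinh s * ⟪e, y⟫ := by
  have h1 : 0 ≤ Real.cosh s * height y + Real.sinh s * ⟪e, y⟫ := by
    have hp : |⟪e, y⟫| ≤ height y :=
      (abs_real_inner_le_norm e y).trans (by rw [he, one_mul]; exact norm_le_height y)
    have hs : |Real.sinh s| ≤ Real.cosh s :=
      abs_le_of_sq_le_sq (by rw [Real.sinh_sq]; linarith) (Real.cosh_pos s).le
    have := mul_le_mul hs hp (abs_nonneg _) (Real.cosh_pos s).le
    rw [← abs_mul] at this
    linarith [neg_abs_le (Real.sinh s * ⟪e, y⟫)]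
  rw [height, Real.sqrt_eq_iff_mul_self_eq (by positivity) h1]
  have hz := height_sq y
  have hc := Real.cosh_sq s
  rw [boost, norm_add_sq_real, inner_smul_right, norm_smul, he, mul_one, Real.norm_eq_abs, sq_abs,
    real_inner_comm]
  linear_combination (⟪y, e⟫ ^ 2 - height y ^ 2) * hc - hz

theorem inner_boost (he : ‖e‖ = 1) (s : ℝ) (y : HypChart d) :
    ⟪e, boost e s y⟫ = Real.cosh s * ⟪e, y⟫ + Real.sinh s * height y := by
  rw [boost, inner_add_right, inner_smul_right, real_inner_self_eq_norm_sq, he]; ring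

theorem boost_zero (y : HypChart d) : boost e 0 y = y := by simp [boost]

theorem boost_boost (he : ‖e‖ = 1) (s t : ℝ) (y : HypChart d) :
    boost e s (boost e t y) = boost e (s + t) y := by
  rw [boost, inner_boost he, height_boost he, boost, boost, add_assoc, ← add_smul, Real.cosh_add,
    Real.sinh_add]
  congr 2; ring

theorem boost_neg_boost (he : ‖e‖ = 1) (s : ℝ) (y : HypChart d) :
    boost e (-s) (boost e s y) = y := by
  rw [boost_boost he, neg_add_cancel, boost_zero]

theorem boost_boost_neg (he : ‖e‖ = 1) (s : ℝ) (y : HypChart d) :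
    boost e s (boost e (-s) y) = y := by
  rw [boost_boost he, add_neg_cancel, boost_zero]

theorem contDiff_boost (s : ℝ) {n : WithTop ℕ∞} : ContDiff ℝ n (boost e s) := by
  unfold boost
  exact contDiff_id.add ((((contDiff_const.mul (contDiff_const.inner ℝ contDiff_id)).add
    (contDiff_const.mul contDiff_height))).smul contDiff_const)

/-- The boost as a homeomorphism. -/
noncomputable def boostHomeo (he : ‖e‖ = 1) (s : ℝ) : HypChart d ≃ₜ HypChart d where
  toFun := boost e s
  invFun := boost e (-s)
  left_inv := boost_neg_boost he s
  right_inv := boost_boost_neg he s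
  continuous_toFun := (contDiff_boost s (n := 0)).continuous
  continuous_invFun := (contDiff_boost (-s) (n := 0)).continuous

/-- The linear form whose rank-one perturbation of the identity is the derivative of the boost. -/
noncomputable def boostForm (e : HypChart d) (s : ℝ) (y : HypChart d) : HypChart d →L[ℝ] ℝ :=
  (Real.cosh s - 1) • innerSL ℝ e + (Real.sinh s / height y) • innerSL ℝ y

theorem hasFDerivAt_boost (s : ℝ) (y : HypChart d) :
    HasFDerivAt (boost e s)
      (ContinuousLinearMap.id ℝ (HypChart d) + (boostForm e s y).smulRight e) y := by
  have h1 : HasFDerivAt (fun y : HypChart d => ⟪e, y⟫) (innerSL ℝ e) y :=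
    (innerSL ℝ e).hasFDerivAt
  have h2 := ((h1.const_mul (Real.cosh s - 1)).add
    ((hasFDerivAt_height y).const_mul (Real.sinh s))).smul_const e
  have h3 := (hasFDerivAt_id y).add h2
  convert! h3 using 4
  rw [boostForm, smul_smul, mul_one_div]

/-- The identity plus a rank-one map has determinant 1 plus the value of the linear form at e. -/
theorem det_boost (he : ‖e‖ = 1) (s : ℝ) (y : HypChart d) :
    (ContinuousLinearMap.id ℝ (HypChart d) + (boostForm e s y).smulRight e).det =
      height (boost e s y) / height y := by
  have : ((ContinuousLinearMap.id ℝ (HypChart d) + (boostForm e s y).smulRight e :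
      HypChart d →L[ℝ] HypChart d) : HypChart d →ₗ[ℝ] HypChart d) =
      LinearMap.transvection ((boostForm e s y : HypChart d →L[ℝ] ℝ) : Module.Dual ℝ _) e := rfl
  rw [ContinuousLinearMap.det, this, LinearMap.transvection.det, height_boost he]
  have h0 := (height_pos y).ne'
  simp [boostForm, he, real_inner_comm]
  field_simp
  ring

/-- In the change of variables the Jacobian height(boost y)/height(y) cancels against the density
1/height. -/
theorem measurePreserving_boost (he : ‖e‖ = 1) (s : ℝ) :
    MeasurePreserving (boost e s) (hypVolume d) (hypVolume d) := by
  have hm : Measurable (boost e s) := (contDiff_boost s (n := 0)).continuous.measurable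
  refine ⟨hm, Measure.ext fun A hA => ?_⟩
  rw [Measure.map_apply hm hA, hypVolume, withDensity_apply _ (hm hA), withDensity_apply _ hA]
  have := lintegral_image_eq_lintegral_abs_det_fderiv_mul (volume : Measure (HypChart d)) (hm hA)
    (fun y _ => (hasFDerivAt_boost (e := e) s y).hasFDerivWithinAt)
    ((boostHomeo he s).injective.injOn) (fun y => ENNReal.ofReal (1 / √(1 + ‖y‖ ^ 2)))
  have himg : boost e s '' (boost e s ⁻¹' A) = A :=
    image_preimage_eq A (boostHomeo he s).surjective
  rw [himg] at this
  rw [this]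
  refine lintegral_congr fun y => ?_
  have h0 := height_pos y
  have h1 := height_pos (boost e s y)
  rw [det_boost he, ← ENNReal.ofReal_mul (abs_nonneg _), abs_of_pos (by positivity)]
  congr 1
  change 1 / height y = _ * (1 / height (boost e s y))
  field_simp

/-- The transpose of the derivative of the boost, acting on covectors. -/
noncomputable def boostAdj (e : HypChart d) (s : ℝ) (y ξ : HypChart d) : HypChart d :=
  ξ + ⟪e, ξ⟫ • ((Real.cosh s - 1) • e + (Real.sinh s / height y) • y)

theorem gradient_comp_boost {φ : HypChart d → ℝ} (s : ℝ) (y : HypChart d)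
    (hφ : DifferentiableAt ℝ φ (boost e s y)) :
    gradient (fun y => φ (boost e s y)) y = boostAdj e s y (gradient φ (boost e s y)) := by
  have h : HasFDerivAt (fun y => φ (boost e s y)) _ y :=
    hφ.hasFDerivAt.comp y (hasFDerivAt_boost s y)
  refine ext_inner_right ℝ fun v => ?_
  rw [inner_gradient_left, h.fderiv, ContinuousLinearMap.comp_apply, ← inner_gradient_left]
  simp only [boostAdj, boostForm, inner_add_left, inner_smul_left, add_apply, smul_apply,
    inner_add_right, inner_smul_right, RCLike.conj_to_real, ContinuousLinearMap.smulRight_apply,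
    ContinuousLinearMap.id_apply, innerSL_apply_apply, smul_eq_mul,
    real_inner_comm e (gradient φ (boost e s y))]
  ring

/-- Boosts are isometries. After expansion this only uses |e| = 1, |y|² = height² - 1 and sinh² =
cosh² - 1. -/
theorem hypCoMetric_boostAdj (he : ‖e‖ = 1) (s : ℝ) (y ξ η : HypChart d) :
    hypCoMetric y (boostAdj e s y ξ) (boostAdj e s y η) = hypCoMetric (boost e s y) ξ η := by
  have h0 := (height_pos y).ne'
  have hz : ‖y‖ ^ 2 = height y ^ 2 - 1 := by linarith [height_sq y]
  have hc : Real.sinh s ^ 2 = Real.cosh s ^ 2 - 1 := by linarith [Real.cosh_sq s]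
  simp only [hypCoMetric, boostAdj, boost, inner_add_left, inner_add_right, inner_smul_left,
    inner_smul_right, RCLike.conj_to_real, real_inner_self_eq_norm_sq, he, hz, real_inner_comm e y,
    real_inner_comm e ξ, real_inner_comm y ξ]
  field_simp
  ring_nf
  simp only [hc]
  ring

theorem norm_coframe_boostAdj (he : ‖e‖ = 1) (s : ℝ) (y ξ : HypChart d) :
    ‖coframe y (boostAdj e s y ξ)‖ = ‖coframe (boost e s y) ξ‖ := by
  rw [norm_coframe, norm_coframe, hypCoMetric_boostAdj he]

theorem boostAdj_sub (s : ℝ) (y ξ η : HypChart d) :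
    boostAdj e s y (ξ - η) = boostAdj e s y ξ - boostAdj e s y η := by
  simp only [boostAdj, inner_sub_right, sub_smul]; abel

theorem continuous_boostAdj (s : ℝ) :
    Continuous fun p : HypChart d × HypChart d => boostAdj e s p.1 p.2 := by
  unfold boostAdj
  have : Continuous (height (d := d)) := contDiff_height (n := 0) |>.continuous
  have h1 : Continuous fun p : HypChart d × HypChart d => Real.sinh s / height p.1 :=
    continuous_const.div (by fun_prop) fun p => (height_pos p.1).ne'
  fun_prop

/-- For |s| ≤ 1 one has cosh s + |sinh s| = e^{|s|} ≤ e < 3. Hence boosts with |s| ≤ 1 move a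
bounded set inside a fixed ball. -/
theorem height_boost_le (he : ‖e‖ = 1) {s : ℝ} (hs : |s| ≤ 1) (y : HypChart d) :
    height (boost e s y) ≤ 3 * height y := by
  have hp : |⟪e, y⟫| ≤ height y :=
    (abs_real_inner_le_norm e y).trans (by rw [he, one_mul]; exact norm_le_height y)
  have h1 : Real.sinh s * ⟪e, y⟫ ≤ |Real.sinh s| * height y :=
    (le_abs_self _).trans (by rw [abs_mul]; exact mul_le_mul_of_nonneg_left hp (abs_nonneg _))
  have h2 : Real.cosh s + |Real.sinh s| ≤ 3 := by
    rw [← Real.cosh_abs, Real.abs_sinh, Real.cosh_add_sinh]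
    exact (Real.exp_le_exp.2 hs).trans (Real.exp_one_lt_d9.le.trans (by norm_num))
  rw [height_boost he]
  nlinarith [height_pos y]

/-- The boosts form a flow, generated by the Killing field `height • e`. -/
theorem hasDerivAt_boost (he : ‖e‖ = 1) (s : ℝ) (y : HypChart d) :
    HasDerivAt (fun s => boost e s y) (height (boost e s y) • e) s := by
  rw [height_boost he]
  have h := ((((Real.hasDerivAt_cosh s).sub_const 1).mul_const ⟪e, y⟫).add
    ((Real.hasDerivAt_sinh s).mul_const (height y))).smul_const e
  have h2 := h.const_add y
  convert! h2 using 2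
  ring

end Boost

/-! ### Boosts acting on H¹ and weak differentiability along them -/

section BoostHOne
variable {d : ℕ} {e : HypChart d} {u v : HypChart d → ℝ} {Du Dv : HypChart d → HypChart d}

theorem MeasureTheory.MemLp.comp_boost {G : Type*} [NormedAddCommGroup G] (he : ‖e‖ = 1) (s : ℝ)
    {f : HypChart d → G} (hf : MemLp f 2 (hypVolume d)) :
    MemLp (fun y => f (boost e s y)) 2 (hypVolume d) :=
  hf.comp_measurePreserving (measurePreserving_boost he s)

theorem lTwo_comp_boost {G : Type*} [NormedAddCommGroup G] (he : ‖e‖ = 1) (s : ℝ)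
    {f : HypChart d → G} (hf : AEStronglyMeasurable f (hypVolume d)) :
    lTwo (hypVolume d) (fun y => f (boost e s y)) = lTwo (hypVolume d) f := by
  unfold lTwo
  rw [← eLpNorm_comp_measurePreserving hf (measurePreserving_boost he s)]; rfl

theorem integral_comp_boost (he : ‖e‖ = 1) (s : ℝ) (f : HypChart d → ℝ) :
    ∫ y, f (boost e s y) ∂(hypVolume d) = ∫ y, f y ∂(hypVolume d) :=
  (measurePreserving_boost he s).integral_comp (boostHomeo he s).measurableEmbedding f

theorem IsTestFn.comp_boost {φ : HypChart d → ℝ} (he : ‖e‖ = 1) (s : ℝ) (h : IsTestFn φ) :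
    IsTestFn fun y => φ (boost e s y) :=
  ⟨h.1.comp (contDiff_boost s), h.2.comp_homeomorph (boostHomeo he s)⟩

theorem memLp_coframe_boostAdj (he : ‖e‖ = 1) (s : ℝ) {ξ : HypChart d → HypChart d}
    (hm : AEStronglyMeasurable ξ (hypVolume d))
    (h : MemLp (fun y => coframe y (ξ y)) 2 (hypVolume d)) :
    MemLp (fun y => coframe y (boostAdj e s y (ξ (boost e s y)))) 2 (hypVolume d) :=
  (h.comp_boost he s).of_norm_le_mul (c := 1) (aestronglyMeasurable_coframe
    ((continuous_boostAdj s).comp_aestronglyMeasurable (aestronglyMeasurable_id.prodMk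
      (hm.comp_measurePreserving (measurePreserving_boost he s))))) fun y => by
    rw [norm_coframe_boostAdj he, one_mul]

theorem IsH1.comp_boost (he : ‖e‖ = 1) (s : ℝ) (hu : IsH1 u Du) :
    IsH1 (fun y => u (boost e s y)) (fun y => boostAdj e s y (Du (boost e s y))) := by
  obtain ⟨φ, hφ, h1, h2, -⟩ := hu.exists_approx
  refine IsH1.of_approx (φ := fun n y => φ n (boost e s y)) (hu.memLp.comp_boost he s)
    (memLp_coframe_boostAdj he s hu.meas hu.memLp_coframe)
    ((continuous_boostAdj s).comp_aestronglyMeasurable (aestronglyMeasurable_id.prodMk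
      (hu.meas.comp_measurePreserving (measurePreserving_boost he s))))
    (fun n => (hφ n).comp_boost he s) (h1.congr fun n => ?_) ?_
  · exact (lTwo_comp_boost he s ((hφ n).memLp.1.sub hu.memLp.1)).symm
  · refine squeeze_zero (fun _ => lTwo_nonneg _) (fun n => ?_) h2
    have a1 := (hφ n).memLp_coframe.sub hu.memLp_coframe
    have := lTwo_comp_boost he s a1.1
    refine le_trans ?_ this.le
    refine le_trans (lTwo_le_of_norm_le zero_le_one (a1.comp_boost he s) fun y => ?_)
      (one_mul _).le
    rw [gradient_comp_boost s y ((hφ n).differentiableAt _), one_mul, Pi.sub_apply,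
      ← coframe_sub, ← coframe_sub, ← boostAdj_sub, norm_coframe_boostAdj he]

/-- The Dirichlet form. -/
noncomputable def dirichlet (Du Dv : HypChart d → HypChart d) : ℝ :=
  ∫ y, hypCoMetric y (Du y) (Dv y) ∂(hypVolume d)

theorem integrable_hypCoMetric {ξ η : HypChart d → HypChart d}
    (hξ : MemLp (fun y => coframe y (ξ y)) 2 (hypVolume d))
    (hη : MemLp (fun y => coframe y (η y)) 2 (hypVolume d)) :
    Integrable (fun y => hypCoMetric y (ξ y) (η y)) (hypVolume d) := by
  simpa only [inner_coframe] using integrable_inner_of_memLp hξ hη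

theorem abs_dirichlet_le {ξ η : HypChart d → HypChart d}
    (hξ : MemLp (fun y => coframe y (ξ y)) 2 (hypVolume d))
    (hη : MemLp (fun y => coframe y (η y)) 2 (hypVolume d)) :
    |dirichlet ξ η| ≤ lTwo (hypVolume d) (fun y => coframe y (ξ y)) *
      lTwo (hypVolume d) (fun y => coframe y (η y)) := by
  simpa only [dirichlet, inner_coframe] using abs_integral_inner_le hξ hη

theorem dirichlet_boost (he : ‖e‖ = 1) (s : ℝ) (ξ η : HypChart d → HypChart d) :
    dirichlet (fun y => boostAdj e s y (ξ (boost e s y)))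
      (fun y => boostAdj e s y (η (boost e s y))) = dirichlet ξ η := by
  simp only [dirichlet, hypCoMetric_boostAdj he]
  exact integral_comp_boost he s fun y => hypCoMetric y (ξ y) (η y)

/-- The Killing field grows like the height, so weights paired with it need bounded support. -/
theorem memLp_height_inner_of_support {R : ℝ} {w : HypChart d → ℝ} (hw : MemLp w 2 (hypVolume d))
    (hR : ∀ y, R < ‖y‖ → w y = 0) : MemLp (fun y => w y * height y) 2 (hypVolume d) := by
  refine hw.of_norm_le_mul (c := 1 + R) (hw.1.mul
    (contDiff_height (n := 0)).continuous.aestronglyMeasurable) fun y => ?_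
  by_cases h : R < ‖y‖
  · simp [hR y h]
  · rw [norm_mul, mul_comm, Real.norm_of_nonneg (height_pos y).le]
    exact mul_le_mul_of_nonneg_right ((height_le y).trans (by linarith)) (norm_nonneg _)

theorem integrable_of_support {R : ℝ} {w : HypChart d → ℝ} (hw : MemLp w 2 (hypVolume d))
    (hR : ∀ y, R < ‖y‖ → w y = 0) : Integrable w (hypVolume d) := by
  have h1 : MemLp ((Metric.closedBall (0 : HypChart d) R).indicator fun _ => (1 : ℝ)) 2
      (hypVolume d) := memLp_indicator_const 2 measurableSet_closedBall 1
      (Or.inr (isCompact_closedBall 0 R).measure_lt_top.ne)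
  refine (hw.integrable_mul h1).congr (Eventually.of_forall fun y => ?_)
  by_cases h : R < ‖y‖
  · simp [hR y h]
  · have : y ∈ Metric.closedBall (0 : HypChart d) R := by simpa using h
    simp [this]

theorem IsTestFn.hasDerivAt_boost {φ : HypChart d → ℝ} (he : ‖e‖ = 1) (hφ : IsTestFn φ)
    {w : HypChart d → ℝ} (hw : Integrable w (hypVolume d)) (s : ℝ) :
    HasDerivAt (fun s => ∫ y, w y * φ (boost e s y) ∂(hypVolume d))
      (∫ y, w y * (height (boost e s y) * ⟪e, gradient φ (boost e s y)⟫) ∂(hypVolume d)) s := by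
  have hc : Continuous fun y : HypChart d => height y * ⟪e, gradient φ y⟫ :=
    (contDiff_height (n := 0)).continuous.mul (continuous_const.inner hφ.continuous_gradient)
  obtain ⟨B, -, hB⟩ := exists_bound_of_hasCompactSupport hc
    ((hasCompactSupport_gradient hφ.2).comp_left (g := fun v => ⟪e, v⟫) (by simp)).mul_left
  obtain ⟨B', -, hB'⟩ := exists_bound_of_hasCompactSupport hφ.1.continuous hφ.2
  have hbc : ∀ s, Continuous (boost e s) := fun s => (contDiff_boost s (n := 0)).continuous
  refine (hasDerivAt_integral_of_dominated_loc_of_deriv_le (bound := fun y => ‖w y‖ * B)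
    (s := univ) univ_mem (Eventually.of_forall fun s =>
      hw.1.mul (hφ.1.continuous.comp (hbc s)).aestronglyMeasurable) ?_
    (F' := fun s y => w y * (height (boost e s y) * ⟪e, gradient φ (boost e s y)⟫))
    (hw.1.mul (hc.comp (hbc s)).aestronglyMeasurable) ?_ (hw.norm.mul_const B) ?_).2
  · exact (hw.norm.mul_const B').mono'
      (hw.1.mul (hφ.1.continuous.comp (hbc s)).aestronglyMeasurable)
      (Eventually.of_forall fun y => (norm_mul _ _).trans_le
        (mul_le_mul_of_nonneg_left (hB' _) (norm_nonneg _)))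
  · refine Eventually.of_forall fun y s _ => ?_
    rw [norm_mul]; exact mul_le_mul_of_nonneg_left (hB _) (norm_nonneg _)
  · refine Eventually.of_forall fun y s _ => ?_
    have := ((hφ.differentiableAt (boost e s y)).hasFDerivAt.comp_hasDerivAt s
      (_root_.hasDerivAt_boost he s y)).const_mul (w y)
    convert! this using 2
    rw [← inner_gradient_left, inner_smul_right, real_inner_comm]

theorem norm_height_inner_le (he : ‖e‖ = 1) (y ξ : HypChart d) :
    ‖height y * ⟪e, ξ⟫‖ ≤ height y * ‖coframe y ξ‖ := by
  rw [norm_mul, Real.norm_of_nonneg (height_pos y).le]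
  refine mul_le_mul_of_nonneg_left ((norm_inner_le_norm e ξ).trans ?_) (height_pos y).le
  rw [he, one_mul]; exact norm_le_norm_coframe y ξ

/-- Mean value inequality in s. The factor 3(1+R) bounds the height at boosted points of the support
of w, and invariance of the volume removes the boost from the gradient norm. Only the gradient norm
of φ enters, so the bound survives the passage to H¹. -/
theorem IsTestFn.abs_boost_sub_le {φ : HypChart d → ℝ} (he : ‖e‖ = 1) (hφ : IsTestFn φ)
    {R : ℝ} (hR0 : 0 ≤ R) {w : HypChart d → ℝ} (hw : MemLp w 2 (hypVolume d))
    (hR : ∀ y, R < ‖y‖ → w y = 0) {s : ℝ} (hs : |s| ≤ 1) :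
    |∫ y, w y * φ (boost e s y) ∂(hypVolume d) - ∫ y, w y * φ y ∂(hypVolume d)| ≤
      3 * (1 + R) * lTwo (hypVolume d) w *
        lTwo (hypVolume d) (fun y => coframe y (gradient φ y)) * |s| := by
  have hwi := integrable_of_support hw hR
  have := Convex.norm_image_sub_le_of_norm_hasDerivWithin_le (s := Icc (-1 : ℝ) 1) (x := 0) (y := s)
    (C := 3 * (1 + R) * (lTwo (hypVolume d) w *
        lTwo (hypVolume d) (fun y => coframe y (gradient φ y))))
    (fun t _ => (hφ.hasDerivAt_boost he hwi t).hasDerivWithinAt) (fun t ht => ?_)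
    (convex_Icc _ _) (by simp) (abs_le.1 hs)
  · simpa [boost_zero, mul_assoc] using this
  · have ht1 : |t| ≤ 1 := abs_le.2 ht
    have hcb := hφ.memLp_coframe.comp_boost he t
    refine (norm_integral_le_of_norm_le ((hw.norm.integrable_mul hcb.norm).const_mul (3 * (1 + R)))
      (Eventually.of_forall fun y => ?_)).trans ?_
    · by_cases h : R < ‖y‖
      · simp [hR y h]
      · rw [norm_mul]
        have h2 : height (boost e t y) ≤ 3 * (1 + R) :=
          (height_boost_le he ht1 y).trans (by linarith [height_le y])
        have h3 := norm_height_inner_le he (boost e t y) (gradient φ (boost e t y))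
        have h4 := h3.trans (mul_le_mul_of_nonneg_right h2 (norm_nonneg _))
        calc _ ≤ ‖w y‖ * _ := mul_le_mul_of_nonneg_left h4 (norm_nonneg _)
          _ = _ := by simp only [Pi.mul_apply]; ring
    · simp only [Pi.mul_apply]
      rw [integral_const_mul]
      refine mul_le_mul_of_nonneg_left ?_ (by positivity)
      rw [← lTwo_comp_boost he t hφ.memLp_coframe.1]
      exact integral_norm_mul_norm_le hw hcb

theorem IsH1.abs_boost_sub_le (he : ‖e‖ = 1) (hu : IsH1 u Du)
    {R : ℝ} (hR0 : 0 ≤ R) {w : HypChart d → ℝ} (hw : MemLp w 2 (hypVolume d))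
    (hR : ∀ y, R < ‖y‖ → w y = 0) {s : ℝ} (hs : |s| ≤ 1) :
    |∫ y, w y * u (boost e s y) ∂(hypVolume d) - ∫ y, w y * u y ∂(hypVolume d)| ≤
      3 * (1 + R) * lTwo (hypVolume d) w *
        lTwo (hypVolume d) (fun y => coframe y (Du y)) * |s| := by
  obtain ⟨φ, hφ, h1, h2, -⟩ := hu.exists_approx
  have t0 := tendsto_integral_mul (fun _ : ℕ => hw) (fun n => (hφ n).memLp) hw hu.memLp
    (by simp [lTwo]) h1
  have t1 := tendsto_integral_mul (fun _ : ℕ => hw) (fun n => ((hφ n).comp_boost he s).memLp) hw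
    (hu.memLp.comp_boost he s) (by simp [lTwo])
    (h1.congr fun n => (lTwo_comp_boost he s ((hφ n).memLp.1.sub hu.memLp.1)).symm)
  have hb : ∀ n, lTwo (hypVolume d) (fun y => coframe y (gradient (φ n) y)) ≤
      lTwo (hypVolume d) (fun y => coframe y (gradient (φ n) y) - coframe y (Du y)) +
        lTwo (hypVolume d) (fun y => coframe y (Du y)) := fun n => by
    have := lTwo_add_le ((hφ n).memLp_coframe.sub hu.memLp_coframe) hu.memLp_coframe
    simp only [Pi.sub_apply, sub_add_cancel] at this
    exact this
  have t2 : Tendsto (fun n => 3 * (1 + R) * lTwo (hypVolume d) w *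
      (lTwo (hypVolume d) (fun y => coframe y (gradient (φ n) y) - coframe y (Du y)) +
        lTwo (hypVolume d) (fun y => coframe y (Du y))) * |s|) atTop
      (𝓝 (3 * (1 + R) * lTwo (hypVolume d) w *
        (0 + lTwo (hypVolume d) (fun y => coframe y (Du y))) * |s|)) :=
    ((h2.add_const _).const_mul _).mul_const _
  rw [zero_add] at t2
  refine le_of_tendsto_of_tendsto' (t1.sub t0).abs t2 fun n => ?_
  refine ((hφ n).abs_boost_sub_le he hR0 hw hR hs).trans ?_
  have := lTwo_nonneg (μ := hypVolume d) w
  gcongr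
  exact hb n

/-- Weak differentiability of `H¹` functions along the boosts. -/
theorem IsH1.tendsto_boost (he : ‖e‖ = 1) (hu : IsH1 u Du)
    {R : ℝ} (hR0 : 0 ≤ R) {w : HypChart d → ℝ} (hw : MemLp w 2 (hypVolume d))
    (hR : ∀ y, R < ‖y‖ → w y = 0) :
    Tendsto (fun s => (∫ y, w y * u (boost e s y) ∂(hypVolume d) -
        ∫ y, w y * u y ∂(hypVolume d)) / s) (𝓝[≠] 0)
      (𝓝 (∫ y, w y * (height y * ⟪e, Du y⟫) ∂(hypVolume d))) := by
  obtain ⟨φ, hφ, h1, h2, -⟩ := hu.exists_approx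
  have hwi := integrable_of_support hw hR
  have hwh := memLp_height_inner_of_support hw hR
  have mi : ∀ {ξ : HypChart d → HypChart d}, AEStronglyMeasurable ξ (hypVolume d) →
      MemLp (fun y => coframe y (ξ y)) 2 (hypVolume d) →
      MemLp (fun y => ⟪e, ξ y⟫) 2 (hypVolume d) := fun hm h =>
    h.of_norm_le_mul (c := 1) (aestronglyMeasurable_const.inner hm) fun y =>
      (norm_inner_le_norm _ _).trans (by
        rw [he]; exact mul_le_mul_of_nonneg_left (norm_le_norm_coframe y _) zero_le_one)
  have t3 := tendsto_integral_mul (fun _ : ℕ => hwh)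
    (fun n => mi (hφ n).continuous_gradient.aestronglyMeasurable (hφ n).memLp_coframe) hwh
    (mi hu.meas hu.memLp_coframe) (l := atTop) (by simp [lTwo]) (by
      refine squeeze_zero (fun _ => lTwo_nonneg _) (fun n => ?_) (by simpa using h2)
      refine (?_ : _ ≤ _).trans (one_mul _).le
      refine lTwo_le_of_norm_le zero_le_one ((hφ n).memLp_coframe.sub hu.memLp_coframe) fun y => ?_
      rw [← inner_sub_right, ← coframe_sub]
      exact (norm_inner_le_norm _ _).trans (by
        rw [he]; exact mul_le_mul_of_nonneg_left (norm_le_norm_coframe y _) zero_le_one))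
  simp only [mul_assoc] at t3
  -- Interchange of the limits n → ∞ and s → 0: the Lipschitz bound applied to u - φ_n makes the
  -- difference quotients converge uniformly in 0 < |s| ≤ 1.
  refine TendstoUniformlyOnFilter.tendsto_of_eventually_tendsto (p := atTop)
    (F := fun n s => (∫ y, w y * φ n (boost e s y) ∂(hypVolume d) -
        ∫ y, w y * φ n y ∂(hypVolume d)) / s) ?_ (Eventually.of_forall fun n => ?_) t3
  · rw [Metric.tendstoUniformlyOnFilter_iff]
    intro ε hε
    have hev := (h2.const_mul (3 * (1 + R) * lTwo (hypVolume d) w)).eventually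
      (gt_mem_nhds (by simpa using hε))
    have hs : ∀ᶠ s : ℝ in 𝓝[≠] 0, |s| ≤ 1 ∧ s ≠ 0 := by
      refine Eventually.and ?_ eventually_mem_nhdsWithin
      refine nhdsWithin_le_nhds ?_
      filter_upwards [Metric.closedBall_mem_nhds (0 : ℝ) one_pos] with s hs
      simpa using hs
    refine (hev.prod_mk hs).mono ?_
    rintro ⟨n, s⟩ ⟨hn, hs1, hs0⟩
    simp only at hn hs1 hs0 ⊢
    have hD := hu.sub (hφ n).isH1
    have key := hD.abs_boost_sub_le he hR0 hw hR hs1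
    have i1 : Integrable (fun y => w y * u (boost e s y)) (hypVolume d) :=
      hw.integrable_mul (hu.memLp.comp_boost he s)
    have i2 : Integrable (fun y => w y * φ n (boost e s y)) (hypVolume d) :=
      hw.integrable_mul ((hφ n).comp_boost he s).memLp
    have i3 : Integrable (fun y => w y * u y) (hypVolume d) := hw.integrable_mul hu.memLp
    have i4 : Integrable (fun y => w y * φ n y) (hypVolume d) := hw.integrable_mul (hφ n).memLp
    simp only [mul_sub] at key
    rw [integral_sub i1 i2, integral_sub i3 i4] at key
    rw [Real.dist_eq, ← sub_div, abs_div, div_lt_iff₀ (abs_pos.2 hs0)]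
    simp only [coframe_sub] at key
    rw [lTwo_sub_comm (fun y => coframe y (Du y))] at key
    calc _ = |_| := by congr 1; ring
      _ ≤ _ := key
      _ < _ := mul_lt_mul_of_pos_right hn (abs_pos.2 hs0)
  · have := ((hφ n).hasDerivAt_boost he hwi 0).tendsto_slope_zero
    simpa [boost_zero, div_eq_inv_mul] using this

end BoostHOne

/-! ### Radial profiles -/

section RadInt

/-- The parametric integral `∫₀¹ τ^m (1 + τ² x)^p dτ`. -/
noncomputable def radInt (m : ℕ) (p x : ℝ) : ℝ := ∫ τ in (0 : ℝ)..1, τ ^ m * (1 + τ ^ 2 * x) ^ p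

theorem one_add_sq_mul_pos {τ x : ℝ} (hτ : τ ∈ Icc (0 : ℝ) 1) (hx : -1 < x) :
    0 < 1 + τ ^ 2 * x := by
  have h1 : τ ^ 2 ≤ 1 := pow_le_one₀ hτ.1 hτ.2
  rcases hτ.1.eq_or_lt with rfl | h0
  · simp
  · have := mul_pos (pow_pos h0 2) (show 0 < 1 + x by linarith)
    linarith

theorem continuousOn_radInt_integrand (m : ℕ) (p : ℝ) :
    ContinuousOn (fun q : ℝ × ℝ => q.1 ^ m * (1 + q.1 ^ 2 * q.2) ^ p)
      (Icc (0 : ℝ) 1 ×ˢ Ioi (-1 : ℝ)) := by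
  refine ContinuousOn.mul (by fun_prop) (ContinuousOn.rpow_const (by fun_prop) fun q hq => ?_)
  exact Or.inl (one_add_sq_mul_pos hq.1 hq.2).ne'

theorem continuousOn_radInt_slice (m : ℕ) (p : ℝ) {x : ℝ} (hx : -1 < x) :
    ContinuousOn (fun τ : ℝ => τ ^ m * (1 + τ ^ 2 * x) ^ p) (Icc (0 : ℝ) 1) :=
  (continuousOn_radInt_integrand m p).comp (f := fun τ : ℝ => (τ, x)) (by fun_prop)
    fun _ hτ => ⟨hτ, hx⟩

theorem intervalIntegrable_radInt (m : ℕ) (p : ℝ) {x : ℝ} (hx : -1 < x) :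
    IntervalIntegrable (fun τ : ℝ => τ ^ m * (1 + τ ^ 2 * x) ^ p) volume 0 1 := by
  refine ContinuousOn.intervalIntegrable ?_
  rw [uIcc_of_le zero_le_one]
  exact continuousOn_radInt_slice m p hx

theorem hasDerivAt_radInt (m : ℕ) (p : ℝ) {x : ℝ} (hx : -1 < x) :
    HasDerivAt (radInt m p) (p * radInt (m + 2) (p - 1) x) x := by
  obtain ⟨δ, hδ, hδx⟩ : ∃ δ > 0, -1 < x - δ := ⟨(1 + x) / 2, by linarith, by linarith⟩
  have hK : IsCompact (Icc (0 : ℝ) 1 ×ˢ Icc (x - δ) (x + δ)) := isCompact_Icc.prod isCompact_Icc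
  obtain ⟨C, hC⟩ := hK.exists_bound_of_continuousOn
    ((continuousOn_radInt_integrand (m + 2) (p - 1)).mono
      (prod_mono_right fun z hz => hδx.trans_le hz.1))
  have hsub : ∀ τ ∈ uIoc (0 : ℝ) 1, τ ∈ Icc (0 : ℝ) 1 := fun τ hτ => by
    rw [uIoc_of_le zero_le_one] at hτ; exact ⟨hτ.1.le, hτ.2⟩
  have := (intervalIntegral.hasDerivAt_integral_of_dominated_loc_of_deriv_le (μ := volume)
    (F := fun x τ => τ ^ m * (1 + τ ^ 2 * x) ^ p)
    (F' := fun x τ => p * (τ ^ (m + 2) * (1 + τ ^ 2 * x) ^ (p - 1))) (a := 0) (b := 1)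
    (s := Icc (x - δ) (x + δ)) (bound := fun _ => |p| * C) (x₀ := x)
    (Icc_mem_nhds (by linarith) (by linarith)) ?_ (intervalIntegrable_radInt m p hx) ?_ ?_ ?_ ?_).2
  · unfold radInt
    rwa [intervalIntegral.integral_const_mul] at this
  · filter_upwards [Ioi_mem_nhds hx] with z hz
    exact (intervalIntegrable_radInt m p hz).def'.aestronglyMeasurable
  · exact ((intervalIntegrable_radInt (m + 2) (p - 1) hx).const_mul p).def'.aestronglyMeasurable
  · refine Eventually.of_forall fun τ hτ z hz => ?_
    rw [norm_mul]
    exact mul_le_mul_of_nonneg_left (hC (τ, z) ⟨hsub τ hτ, hz⟩) (norm_nonneg _)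
  · exact intervalIntegrable_const
  · refine Eventually.of_forall fun τ hτ z hz => ?_
    have hpos := one_add_sq_mul_pos (hsub τ hτ) (hδx.trans_le hz.1)
    have h1 : HasDerivAt (fun z => 1 + τ ^ 2 * z) (τ ^ 2) z := by
      simpa using ((hasDerivAt_id z).const_mul (τ ^ 2)).const_add 1
    have h2 := (h1.rpow_const (p := p) (Or.inl hpos.ne')).const_mul (τ ^ m)
    convert! h2 using 1
    ring

/-- The derivative of a member of the family is a multiple of another member, so smoothness follows
by induction, for all m and p at once. The domain (-1, ∞) contains a neighbourhood of 0, which makes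
κ(|y|²) smooth at the origin. -/
theorem contDiffOn_radInt (n : ℕ) : ∀ (m : ℕ) (p : ℝ), ContDiffOn ℝ n (radInt m p) (Ioi (-1)) := by
  induction n with
  | zero =>
    intro m p
    exact contDiffOn_zero.2 fun x hx => (hasDerivAt_radInt m p hx).continuousAt.continuousWithinAt
  | succ n ih =>
    intro m p
    push_cast
    rw [contDiffOn_succ_iff_deriv_of_isOpen isOpen_Ioi]
    refine ⟨fun x hx => (hasDerivAt_radInt m p hx).differentiableAt.differentiableWithinAt,
      by simp, ?_⟩
    exact (contDiffOn_const.mul (ih (m + 2) (p - 1))).congr fun x hx =>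
      (hasDerivAt_radInt m p hx).deriv

/-- Integrate over [0,1] the τ-derivative of τ^{m+1} (1 + τ² x)^p. -/
theorem radInt_ode (m : ℕ) (p : ℝ) {x : ℝ} (hx : -1 < x) :
    2 * p * x * radInt (m + 2) (p - 1) x + (m + 1) * radInt m p x = (1 + x) ^ p := by
  have h := intervalIntegral.integral_eq_sub_of_hasDerivAt (a := 0) (b := 1)
    (f := fun τ : ℝ => τ ^ (m + 1) * (1 + τ ^ 2 * x) ^ p)
    (f' := fun τ => 2 * p * x * (τ ^ (m + 2) * (1 + τ ^ 2 * x) ^ (p - 1)) +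
      (m + 1) * (τ ^ m * (1 + τ ^ 2 * x) ^ p)) (fun τ hτ => ?_)
    (((intervalIntegrable_radInt _ _ hx).const_mul _).add
      ((intervalIntegrable_radInt _ _ hx).const_mul _))
  · rw [intervalIntegral.integral_add ((intervalIntegrable_radInt _ _ hx).const_mul _)
      ((intervalIntegrable_radInt _ _ hx).const_mul _), intervalIntegral.integral_const_mul,
      intervalIntegral.integral_const_mul] at h
    unfold radInt
    rw [h]; simp
  · rw [uIcc_of_le zero_le_one] at hτ
    have hpos := one_add_sq_mul_pos hτ hx
    have h1 : HasDerivAt (fun τ => 1 + τ ^ 2 * x) (2 * τ * x) τ := by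
      simpa using ((hasDerivAt_pow 2 τ).mul_const x).const_add 1
    have h2 := (hasDerivAt_pow (m + 1) τ).mul (h1.rpow_const (p := p) (Or.inl hpos.ne'))
    convert! h2 using 1
    push_cast
    ring

theorem radInt_nonneg (m : ℕ) (p : ℝ) {x : ℝ} (hx : 0 ≤ x) : 0 ≤ radInt m p x :=
  intervalIntegral.integral_nonneg zero_le_one fun τ hτ =>
    mul_nonneg (pow_nonneg hτ.1 _) (Real.rpow_nonneg (by positivity) _)

end RadInt

/-! ### The profile κ and its differential equations -/

section Profile
variable {d : ℕ}

/-- `κ`, the radial coefficient of the multiplier, as a function of `x = |y|²`: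
the multiplier field is `√(1 + |y|²) κ(|y|²) y`. -/
noncomputable def kap (d : ℕ) : ℝ → ℝ := radInt (d - 1) (-1 / 2)

/-- The first derivative of `kap`. -/
noncomputable def kap₁ (d : ℕ) (x : ℝ) : ℝ := -1 / 2 * radInt (d - 1 + 2) (-1 / 2 - 1) x

/-- The second derivative of `kap`. -/
noncomputable def kap₂ (d : ℕ) (x : ℝ) : ℝ :=
  -1 / 2 * ((-1 / 2 - 1) * radInt (d - 1 + 2 + 2) (-1 / 2 - 1 - 1) x)

theorem hasDerivAt_kap {x : ℝ} (hx : -1 < x) : HasDerivAt (kap d) (kap₁ d x) x :=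
  hasDerivAt_radInt _ _ hx

theorem hasDerivAt_kap₁ {x : ℝ} (hx : -1 < x) : HasDerivAt (kap₁ d) (kap₂ d x) x :=
  (hasDerivAt_radInt _ _ hx).const_mul _

theorem rpow_neg_half {x : ℝ} (hx : 0 ≤ x) : (1 + x) ^ (-1 / 2 : ℝ) = 1 / √(1 + x) := by
  rw [show (-1 / 2 : ℝ) = -(1 / 2) by norm_num, Real.rpow_neg (by positivity),
    ← Real.sqrt_eq_rpow, one_div]

/-- This is div X = 1 for X = √(1+|y|²) κ(|y|²) y. Equivalently, sinh^d r κ(sinh² r) has derivative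
sinh^{d-1} r. -/
theorem kap_ode (hd : 2 ≤ d) {x : ℝ} (hx : 0 ≤ x) :
    2 * x * kap₁ d x + d * kap d x = 1 / √(1 + x) := by
  have h := radInt_ode (d - 1) (-1 / 2) (x := x) (by linarith)
  have e : ((d - 1 : ℕ) : ℝ) + 1 = d := by
    rw [Nat.cast_sub (by omega)]; simp
  rw [e, rpow_neg_half hx] at h
  rw [← h, kap, kap₁]; ring

/-- The same identity one step further in the family, at m = d+1 and p = -3/2. It eliminates κ''
from the Laplacian of κ(|y|²)⟨e,y⟩. -/
theorem kap₁_ode (hd : 2 ≤ d) {x : ℝ} (hx : 0 ≤ x) :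
    (1 + x) * (2 * x * kap₂ d x + (d + 2) * kap₁ d x) = -1 / 2 * (1 / √(1 + x)) := by
  have h := radInt_ode (d - 1 + 2) (-1 / 2 - 1) (x := x) (by linarith)
  have e : ((d - 1 + 2 : ℕ) : ℝ) + 1 = d + 2 := by
    rw [Nat.cast_add, Nat.cast_sub (by omega)]; push_cast; ring
  rw [e] at h
  have h2 : (1 + x) * (1 + x) ^ (-1 / 2 - 1 : ℝ) = 1 / √(1 + x) := by
    rw [← rpow_neg_half hx, Real.rpow_sub_one (by positivity)]
    field_simp
  rw [← h2, ← h, kap₁, kap₂]; ring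

theorem kap_nonneg {x : ℝ} (hx : 0 ≤ x) : 0 ≤ kap d x := radInt_nonneg _ _ hx

theorem kap₁_nonpos {x : ℝ} (hx : 0 ≤ x) : kap₁ d x ≤ 0 := by
  have := radInt_nonneg (d - 1 + 2) (-1 / 2 - 1) hx
  unfold kap₁; linarith

/-- Drop the term with κ' ≤ 0 from `kap_ode`. In polar coordinates this is f coth r ≥ 1/d, used both
to compare the eigenvalues of ∇X and to get the coefficient 1/(2d) of the potential term. -/
theorem one_le_mul_sqrt_mul_kap (hd : 2 ≤ d) {x : ℝ} (hx : 0 ≤ x) :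
    1 ≤ d * (√(1 + x) * kap d x) := by
  have h := kap_ode hd hx
  have h1 := kap₁_nonpos (d := d) hx
  have hs : 0 < √(1 + x) := by positivity
  have h2 : 1 / √(1 + x) ≤ d * kap d x := by nlinarith
  rw [div_le_iff₀ hs] at h2
  linarith

/-- Since √(1+x) τ ≤ √(1+τ²x) for τ ≤ 1, the integrand is at most τ^{d-2}, of integral 1/(d-1). This
makes the radial eigenvalue 1 - (d-1) f coth r nonnegative. -/
theorem sqrt_mul_kap_le (hd : 2 ≤ d) {x : ℝ} (hx : 0 ≤ x) :
    (d - 1) * (√(1 + x) * kap d x) ≤ 1 := by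
  have hx1 : -1 < x := by linarith
  have h1 : √(1 + x) * kap d x ≤ ∫ τ in (0 : ℝ)..1, τ ^ (d - 2) := by
    unfold kap radInt
    rw [← intervalIntegral.integral_const_mul]
    refine intervalIntegral.integral_mono_on zero_le_one
      ((intervalIntegrable_radInt _ _ hx1).const_mul _) ((continuous_pow _).intervalIntegrable _ _) fun τ hτ => ?_
    have e : d - 1 = d - 2 + 1 := by omega
    have hy : 0 ≤ τ ^ 2 * x := by positivity
    rw [rpow_neg_half hy, e, pow_succ]
    have hs : 0 < √(1 + τ ^ 2 * x) := by positivity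
    have hτx : √(1 + x) * τ ≤ √(1 + τ ^ 2 * x) := by
      refine Real.le_sqrt_of_sq_le ?_
      rw [mul_pow, Real.sq_sqrt (by positivity)]
      nlinarith [pow_le_one₀ (n := 2) hτ.1 hτ.2]
    calc _ = τ ^ (d - 2) * (√(1 + x) * τ / √(1 + τ ^ 2 * x)) := by ring
      _ ≤ τ ^ (d - 2) * 1 := mul_le_mul_of_nonneg_left ((div_le_one hs).2 hτx)
        (pow_nonneg hτ.1 _)
      _ = _ := mul_one _
  have h2 : ((d - 2 : ℕ) : ℝ) + 1 = d - 1 := by rw [Nat.cast_sub hd]; push_cast; ring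
  have h3 : (0 : ℝ) < d - 1 := by
    have : (2 : ℝ) ≤ d := by exact_mod_cast hd
    linarith
  rw [integral_pow, h2] at h1
  simp only [one_pow, ne_eq, Nat.add_eq_zero_iff, one_ne_zero, and_false, not_false_eq_true,
    zero_pow, sub_zero] at h1
  rwa [le_div_iff₀ h3, mul_comm] at h1

theorem sqrt_mul_kap_le_one (hd : 2 ≤ d) {x : ℝ} (hx : 0 ≤ x) : √(1 + x) * kap d x ≤ 1 := by
  have h := sqrt_mul_kap_le hd hx
  have h2 : (2 : ℝ) ≤ d := by exact_mod_cast hd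
  have h3 : 0 ≤ √(1 + x) * kap d x := mul_nonneg (Real.sqrt_nonneg _) (kap_nonneg hx)
  nlinarith

theorem sqrt_mul_kap_nonneg {x : ℝ} (hx : 0 ≤ x) : 0 ≤ √(1 + x) * kap d x :=
  mul_nonneg (Real.sqrt_nonneg _) (kap_nonneg hx)

/-! ### The cutoff -/

/-- A smooth cutoff on `ℝ`, equal to `1` on `(-∞, 1]` and to `0` on `[2, ∞)`. -/
noncomputable def cutBase (x : ℝ) : ℝ := Real.smoothTransition (2 - x)

theorem contDiff_cutBase {n : WithTop ℕ∞} (hn : n ≤ ((⊤ : ℕ∞) : WithTop ℕ∞)) : ContDiff ℝ n cutBase :=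
  (Real.smoothTransition.contDiff (n := ⊤)).of_le hn |>.comp (contDiff_const.sub contDiff_id)

theorem cutBase_of_le {x : ℝ} (h : x ≤ 1) : cutBase x = 1 :=
  Real.smoothTransition.one_of_one_le (by linarith)

theorem cutBase_of_ge {x : ℝ} (h : 2 ≤ x) : cutBase x = 0 :=
  Real.smoothTransition.zero_of_nonpos (by linarith)

theorem cutBase_nonneg (x : ℝ) : 0 ≤ cutBase x := Real.smoothTransition.nonneg _
theorem cutBase_le_one (x : ℝ) : cutBase x ≤ 1 := Real.smoothTransition.le_one _

theorem deriv_cutBase_of_lt {x : ℝ} (h : x < 1) : deriv cutBase x = 0 := by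
  have : cutBase =ᶠ[𝓝 x] fun _ => 1 := by
    filter_upwards [Iio_mem_nhds h] with z hz using cutBase_of_le (le_of_lt hz)
  rw [this.deriv_eq]; simp

theorem deriv_cutBase_of_gt {x : ℝ} (h : 2 < x) : deriv cutBase x = 0 := by
  have : cutBase =ᶠ[𝓝 x] fun _ => 0 := by
    filter_upwards [Ioi_mem_nhds h] with z hz using cutBase_of_ge (le_of_lt hz)
  rw [this.deriv_eq]; simp

theorem deriv_deriv_cutBase_of_lt {x : ℝ} (h : x < 1) : deriv (deriv cutBase) x = 0 := by
  have : deriv cutBase =ᶠ[𝓝 x] fun _ => 0 := by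
    filter_upwards [Iio_mem_nhds h] with z hz using deriv_cutBase_of_lt hz
  rw [this.deriv_eq]; simp

theorem deriv_deriv_cutBase_of_gt {x : ℝ} (h : 2 < x) : deriv (deriv cutBase) x = 0 := by
  have : deriv cutBase =ᶠ[𝓝 x] fun _ => 0 := by
    filter_upwards [Ioi_mem_nhds h] with z hz using deriv_cutBase_of_gt hz
  rw [this.deriv_eq]; simp

theorem contDiff_deriv_cutBase : ContDiff ℝ 1 (deriv cutBase) :=
  ((contDiff_succ_iff_deriv (n := 1)).1 (contDiff_cutBase (n := 1 + 1)
    (by rw [one_add_one_eq_two]; exact WithTop.coe_le_coe.2 (le_top : (2 : ℕ∞) ≤ ⊤)))).2.2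

/-- Both derivatives vanish beyond 2, so compactness of [0,2] suffices. The powers of 1 + x are
those that survive rescaling in `cut_bounds`. -/
theorem exists_cutBase_bound : ∃ C : ℝ, 0 ≤ C ∧ ∀ x, 0 ≤ x → |deriv cutBase x| * (1 + x) ≤ C ∧
    |deriv (deriv cutBase) x| * (1 + x) ^ 2 ≤ C := by
  have c1 : Continuous (deriv cutBase) := contDiff_deriv_cutBase.continuous
  have c2 : Continuous (deriv (deriv cutBase)) :=
    contDiff_deriv_cutBase.continuous_deriv (by norm_num)
  obtain ⟨A, hA⟩ := (isCompact_Icc (a := (0 : ℝ)) (b := 2)).exists_bound_of_continuousOn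
    (f := fun x => deriv cutBase x * (1 + x)) (by fun_prop)
  obtain ⟨B, hB⟩ := (isCompact_Icc (a := (0 : ℝ)) (b := 2)).exists_bound_of_continuousOn
    (f := fun x => deriv (deriv cutBase) x * (1 + x) ^ 2) (by fun_prop)
  have hA0 : 0 ≤ A := (norm_nonneg _).trans (hA 0 (by simp))
  have hB0 : 0 ≤ B := (norm_nonneg _).trans (hB 0 (by simp))
  refine ⟨A + B, by positivity, fun x hx => ?_⟩
  by_cases h : 2 < x
  · simp [deriv_cutBase_of_gt h, deriv_deriv_cutBase_of_gt h]; positivity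
  · have ha := hA x ⟨hx, not_lt.1 h⟩
    have hb := hB x ⟨hx, not_lt.1 h⟩
    rw [norm_mul, Real.norm_eq_abs, Real.norm_of_nonneg (by positivity)] at ha hb
    exact ⟨by linarith, by linarith⟩

/-- The cutoff at `|y| ~ R`, as a function of `x = |y|²`, and its first two derivatives. -/
noncomputable def cut (R x : ℝ) : ℝ := cutBase (x / R ^ 2)
/-- The first derivative of `cut`. -/
noncomputable def cut₁ (R x : ℝ) : ℝ := deriv cutBase (x / R ^ 2) / R ^ 2
/-- The second derivative of `cut`. -/
noncomputable def cut₂ (R x : ℝ) : ℝ := deriv (deriv cutBase) (x / R ^ 2) / R ^ 2 / R ^ 2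

theorem hasDerivAt_cut (R x : ℝ) : HasDerivAt (cut R) (cut₁ R x) x := by
  have h : HasDerivAt cutBase (deriv cutBase (x / R ^ 2)) (x / R ^ 2) :=
    ((contDiff_cutBase (n := 1) (by exact_mod_cast le_top)).differentiable (by norm_num) _).hasDerivAt
  have h2 := h.comp x ((hasDerivAt_id x).div_const (R ^ 2))
  convert! h2 using 1
  rw [cut₁]; ring

theorem hasDerivAt_cut₁ (R x : ℝ) : HasDerivAt (cut₁ R) (cut₂ R x) x := by
  have h : HasDerivAt (deriv cutBase) (deriv (deriv cutBase) (x / R ^ 2)) (x / R ^ 2) :=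
    (contDiff_deriv_cutBase.differentiable (by norm_num) _).hasDerivAt
  have h2 := (h.comp x ((hasDerivAt_id x).div_const (R ^ 2))).div_const (R ^ 2)
  convert! h2 using 1
  rw [cut₂]; ring

/-- Scale invariance: (1+x)/R² ≤ 1 + x/R² for R ≥ 1, so the constant does not depend on R. -/
theorem cut_bounds {C : ℝ} (hC : ∀ x, 0 ≤ x → |deriv cutBase x| * (1 + x) ≤ C ∧
    |deriv (deriv cutBase) x| * (1 + x) ^ 2 ≤ C) {R x : ℝ} (hR : 1 ≤ R) (hx : 0 ≤ x) :
    |cut₁ R x| * (1 + x) ≤ C ∧ |cut₂ R x| * (1 + x) ^ 2 ≤ C := by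
  have hR2 : 1 ≤ R ^ 2 := one_le_pow₀ hR
  have hR0 : 0 < R ^ 2 := by linarith
  obtain ⟨h1, h2⟩ := hC (x / R ^ 2) (by positivity)
  have hle : (1 + x) / R ^ 2 ≤ 1 + x / R ^ 2 := by
    rw [add_div]; gcongr; exact (div_le_one hR0).2 hR2
  refine ⟨le_trans (le_of_eq ?_) ((mul_le_mul_of_nonneg_left hle (abs_nonneg _)).trans h1),
    le_trans (le_of_eq ?_) ((mul_le_mul_of_nonneg_left
      (pow_le_pow_left₀ (by positivity) hle 2) (abs_nonneg _)).trans h2)⟩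
  · rw [cut₁, abs_div, abs_of_pos hR0]; ring
  · rw [cut₂, abs_div, abs_div, abs_of_pos hR0]; ring

/-- At a fixed point the cutoff of radius n+1 is eventually inactive, so truncated coefficients do
not merely converge: they are eventually equal to their limits. -/
theorem eventually_cut (x : ℝ) :
    ∀ᶠ n : ℕ in atTop, cut (n + 1) x = 1 ∧ cut₁ (n + 1) x = 0 ∧ cut₂ (n + 1) x = 0 := by
  obtain ⟨N, hN⟩ := exists_nat_gt |x|
  filter_upwards [eventually_ge_atTop N] with n hn
  have hn' : (N : ℝ) ≤ n := by exact_mod_cast hn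
  have h0 : (0 : ℝ) ≤ n := Nat.cast_nonneg n
  have h1 : x / ((n : ℝ) + 1) ^ 2 < 1 := by
    rw [div_lt_one (by positivity)]
    nlinarith [le_abs_self x]
  simp [cut, cut₁, cut₂, cutBase_of_le h1.le, deriv_cutBase_of_lt h1, deriv_deriv_cutBase_of_lt h1]

/-- The truncated profile and its derivatives. -/
noncomputable def prof (d : ℕ) (R x : ℝ) : ℝ := cut R x * kap d x
/-- The first derivative of `prof`. -/
noncomputable def prof₁ (d : ℕ) (R x : ℝ) : ℝ := cut₁ R x * kap d x + cut R x * kap₁ d x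
/-- The second derivative of `prof`. -/
noncomputable def prof₂ (d : ℕ) (R x : ℝ) : ℝ :=
  cut₂ R x * kap d x + 2 * (cut₁ R x * kap₁ d x) + cut R x * kap₂ d x

theorem hasDerivAt_prof (R : ℝ) {x : ℝ} (hx : -1 < x) :
    HasDerivAt (prof d R) (prof₁ d R x) x := (hasDerivAt_cut R x).mul (hasDerivAt_kap hx)

theorem hasDerivAt_prof₁ (R : ℝ) {x : ℝ} (hx : -1 < x) :
    HasDerivAt (prof₁ d R) (prof₂ d R x) x := by
  have := ((hasDerivAt_cut₁ R x).mul (hasDerivAt_kap (d := d) hx)).add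
    ((hasDerivAt_cut R x).mul (hasDerivAt_kap₁ (d := d) hx))
  convert! this using 1
  rw [prof₂]; ring

theorem contDiffOn_prof (d : ℕ) (R : ℝ) :
    ContDiffOn ℝ ((⊤ : ℕ∞) : WithTop ℕ∞) (prof d R) (Ioi (-1)) := by
  refine ContDiffOn.mul ?_ (contDiffOn_infty.2 fun n => contDiffOn_radInt n _ _)
  exact ((contDiff_cutBase le_rfl).comp (contDiff_id.div_const (R ^ 2))).contDiffOn

theorem prof_eq_zero {R x : ℝ} (hR : 0 < R) (h : 2 * R ^ 2 ≤ x) : prof d R x = 0 := by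
  rw [prof, cut, cutBase_of_ge ((le_div_iff₀ (by positivity)).2 h), zero_mul]

end Profile

/-! ### The radial multiplier field -/

section Radial
variable {d : ℕ}

theorem neg_one_lt_normSq (y : HypChart d) : -1 < ‖y‖ ^ 2 := by linarith [sq_nonneg ‖y‖]

theorem gradient_normSq (y : HypChart d) : gradient (fun y : HypChart d => ‖y‖ ^ 2) y = (2 : ℝ) • y := by
  refine ext_inner_right ℝ fun v => ?_
  rw [inner_gradient_left, (hasStrictFDerivAt_norm_sq y).hasFDerivAt.fderiv]
  simp [inner_smul_left]

theorem differentiableAt_normSq (y : HypChart d) :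
    DifferentiableAt ℝ (fun y : HypChart d => ‖y‖ ^ 2) y :=
  (hasStrictFDerivAt_norm_sq y).hasFDerivAt.differentiableAt

theorem gradient_radial {f : ℝ → ℝ} {c : ℝ} {y : HypChart d} (h : HasDerivAt f c (‖y‖ ^ 2)) :
    gradient (fun y : HypChart d => f (‖y‖ ^ 2)) y = (2 * c) • y := by
  rw [gradient_comp (φ := fun y : HypChart d => ‖y‖ ^ 2) h (differentiableAt_normSq y),
    gradient_normSq, smul_smul, mul_comm]

theorem differentiableAt_radial {f : ℝ → ℝ} {c : ℝ} {y : HypChart d}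
    (h : HasDerivAt f c (‖y‖ ^ 2)) : DifferentiableAt ℝ (fun y : HypChart d => f (‖y‖ ^ 2)) y :=
  h.differentiableAt.comp y (differentiableAt_normSq y)

theorem gradient_inner_left (e y : HypChart d) : gradient (fun y => ⟪e, y⟫) y = e := by
  have h1 : HasFDerivAt (fun y : HypChart d => ⟪e, y⟫) (innerSL ℝ e) y := (innerSL ℝ e).hasFDerivAt
  refine ext_inner_right ℝ fun v => ?_
  rw [inner_gradient_left, h1.fderiv]; simp

theorem differentiableAt_inner_left (e y : HypChart d) :
    DifferentiableAt ℝ (fun y => ⟪e, y⟫) y := (innerSL ℝ e).differentiableAt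

theorem euclDiv_id (y : HypChart d) : euclDiv (fun y : HypChart d => y) y = d := by
  simp [euclDiv]

theorem euclDiv_const (e y : HypChart d) : euclDiv (fun _ : HypChart d => e) y = 0 := by
  simp [euclDiv]

theorem euclDiv_add {Y Z : HypChart d → HypChart d} {y : HypChart d}
    (hY : DifferentiableAt ℝ Y y) (hZ : DifferentiableAt ℝ Z y) :
    euclDiv (fun y => Y y + Z y) y = euclDiv Y y + euclDiv Z y := by
  unfold euclDiv
  rw [fderiv_fun_add hY hZ]
  simp [inner_add_right, Finset.sum_add_distrib]

theorem hypDiv_smul {f : HypChart d → ℝ} {Y : HypChart d → HypChart d} {y : HypChart d}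
    (hf : DifferentiableAt ℝ f y) (hY : DifferentiableAt ℝ Y y) :
    hypDiv (fun y => f y • Y y) y = f y * hypDiv Y y + ⟪gradient f y, Y y⟫ := by
  rw [hypDiv, hypDiv, euclDiv_smul hf hY, inner_smul_right]; ring

/-- The Riemannian gradient, in chart components. -/
noncomputable def hypGrad (b : HypChart d → ℝ) (y : HypChart d) : HypChart d :=
  gradient b y + ⟪y, gradient b y⟫ • y

theorem inner_hypGrad (b : HypChart d → ℝ) (y ξ : HypChart d) :
    ⟪hypGrad b y, ξ⟫ = hypCoMetric y (gradient b y) ξ := by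
  rw [hypGrad, hypCoMetric, inner_add_left, inner_smul_left]; rfl

theorem IsTestFn.contDiff_hypGrad {b : HypChart d → ℝ} (hb : IsTestFn b) :
    ContDiff ℝ 1 (hypGrad b) := by
  have h : ContDiff ℝ 1 (gradient b) := contDiff_gradient (n := ((⊤ : ℕ∞) : WithTop ℕ∞)) hb.1
    (by rw [one_add_one_eq_two]; exact WithTop.coe_le_coe.2 (le_top : (2 : ℕ∞) ≤ ⊤))
  exact h.add ((contDiff_id.inner ℝ h).smul contDiff_id)

theorem IsTestFn.hasCompactSupport_hypGrad {b : HypChart d → ℝ} (hb : IsTestFn b) :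
    HasCompactSupport (hypGrad b) :=
  (hasCompactSupport_gradient hb.2).mono' fun y hy => subset_tsupport _ fun h0 => hy (by
    simp [hypGrad, h0])

/-- The component functions of the truncated multiplier. -/
noncomputable def radialTest (d : ℕ) (R : ℝ) (e y : HypChart d) : ℝ :=
  prof d R (‖y‖ ^ 2) * ⟪e, y⟫

/-- The truncated multiplier field. -/
noncomputable def multField (d : ℕ) (R : ℝ) (y : HypChart d) : HypChart d :=
  (height y * prof d R (‖y‖ ^ 2)) • y

theorem contDiff_prof_normSq (R : ℝ) {n : WithTop ℕ∞} (hn : n ≤ ((⊤ : ℕ∞) : WithTop ℕ∞)) :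
    ContDiff ℝ n fun y : HypChart d => prof d R (‖y‖ ^ 2) :=
  (((contDiffOn_prof d R).comp_contDiff (contDiff_norm_sq ℝ) neg_one_lt_normSq)).of_le hn

theorem prof_normSq_eq_zero {R : ℝ} (hR : 0 < R) {y : HypChart d} (hy : 2 * R < ‖y‖) :
    prof d R (‖y‖ ^ 2) = 0 :=
  prof_eq_zero hR (by nlinarith)

theorem hasCompactSupport_of_norm {G : Type*} [Zero G] {f : HypChart d → G} {R : ℝ}
    (h : ∀ y, R < ‖y‖ → f y = 0) : HasCompactSupport f :=
  HasCompactSupport.intro (isCompact_closedBall (0 : HypChart d) R) fun y hy => h y (by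
    simpa using hy)

theorem isTestFn_radialTest {R : ℝ} (hR : 0 < R) (e : HypChart d) : IsTestFn (radialTest d R e) :=
  ⟨(contDiff_prof_normSq R le_rfl).mul (contDiff_const.inner ℝ contDiff_id),
    hasCompactSupport_of_norm (R := 2 * R) fun y hy => by
      rw [radialTest, prof_normSq_eq_zero hR hy, zero_mul]⟩

theorem contDiff_multField (R : ℝ) : ContDiff ℝ 1 (multField d R) :=
  (contDiff_height.mul (contDiff_prof_normSq R (by exact_mod_cast le_top))).smul contDiff_id

theorem hasCompactSupport_multField {R : ℝ} (hR : 0 < R) : HasCompactSupport (multField d R) :=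
  hasCompactSupport_of_norm (R := 2 * R) fun y hy => by
    rw [multField, prof_normSq_eq_zero hR hy, mul_zero, zero_smul]

/-- The divergence of the truncated multiplier, as a function of `|y|²`. -/
noncomputable def divCoef (d : ℕ) (R x : ℝ) : ℝ := √(1 + x) * (d * prof d R x + 2 * x * prof₁ d R x)

/-- The coefficient of `⟪y, ξ⟫²` in the quadratic form of the truncated multiplier. -/
noncomputable def quadCoef (d : ℕ) (R x : ℝ) : ℝ := 2 * prof₁ d R x * (1 + x) + prof d R x

/-- The Laplacian of `radialTest` divided by `⟪e, y⟫`. -/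
noncomputable def lapCoef (d : ℕ) (R x : ℝ) : ℝ :=
  4 * x * (1 + x) * prof₂ d R x + ((2 * d + 4) + (2 * d + 6) * x) * prof₁ d R x + d * prof d R x

theorem hypDiv_multField (R : ℝ) (y : HypChart d) :
    hypDiv (multField d R) y = divCoef d R (‖y‖ ^ 2) := by
  have h0 := (height_pos y).ne'
  have hp := hasDerivAt_prof (d := d) R (neg_one_lt_normSq y)
  have hpd := differentiableAt_radial hp
  have hh : DifferentiableAt ℝ (height (d := d)) y := (hasFDerivAt_height y).differentiableAt
  have hz := height_sq y
  unfold multField divCoef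
  rw [hypDiv_smul (Y := fun y => y) (hh.fun_mul hpd) differentiableAt_fun_id, hypDiv, euclDiv_id,
    gradient_fun_mul hh hpd, gradient_radial hp, gradient_height]
  simp only [inner_add_left, inner_smul_left, RCLike.conj_to_real, real_inner_self_eq_norm_sq]
  change _ = height y * _
  rw [← hz]
  field_simp
  ring

theorem gradient_radialTest (R : ℝ) (e y : HypChart d) :
    gradient (radialTest d R e) y =
      prof d R (‖y‖ ^ 2) • e + (⟪e, y⟫ * (2 * prof₁ d R (‖y‖ ^ 2))) • y := by
  have hp := hasDerivAt_prof (d := d) R (neg_one_lt_normSq y)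
  unfold radialTest
  rw [gradient_fun_mul (differentiableAt_radial hp) (differentiableAt_inner_left e y),
    gradient_radial hp, gradient_inner_left, smul_smul]

theorem hypGrad_radialTest (R : ℝ) (e : HypChart d) :
    hypGrad (radialTest d R e) = fun y =>
      prof d R (‖y‖ ^ 2) • e + (quadCoef d R (‖y‖ ^ 2) * ⟪e, y⟫) • y := by
  ext1 y
  rw [hypGrad, gradient_radialTest, add_assoc, ← add_smul]
  congr 2
  simp only [inner_add_right, inner_smul_right, real_inner_self_eq_norm_sq, real_inner_comm e y,
    quadCoef]
  ring

theorem hasDerivAt_quadCoef (R : ℝ) {x : ℝ} (hx : -1 < x) : HasDerivAt (quadCoef d R)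
    (2 * prof₂ d R x * (1 + x) + 3 * prof₁ d R x) x := by
  have := (((hasDerivAt_prof₁ (d := d) R hx).const_mul 2).mul
    ((hasDerivAt_id x).const_add 1)).add (hasDerivAt_prof (d := d) R hx)
  convert! this using 1
  simp only [id]; ring

/-- The Laplacian preserves the spherical harmonic ⟨e,y⟩, so only a radial coefficient has to be
tracked. -/
theorem hypDiv_hypGrad_radialTest (R : ℝ) (e y : HypChart d) :
    hypDiv (hypGrad (radialTest d R e)) y = lapCoef d R (‖y‖ ^ 2) * ⟪e, y⟫ := by
  have h0 := (height_pos y).ne'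
  have hz := height_sq y
  have hp := hasDerivAt_prof (d := d) R (neg_one_lt_normSq y)
  have hpd := differentiableAt_radial hp
  have hq := hasDerivAt_quadCoef (d := d) R (neg_one_lt_normSq y)
  have hqd := differentiableAt_radial hq
  have hi := differentiableAt_inner_left e y
  rw [hypGrad_radialTest, hypDiv, euclDiv_add (hpd.fun_smul (differentiableAt_const e))
    ((hqd.fun_mul hi).fun_smul differentiableAt_fun_id),
    euclDiv_smul (Y := fun _ => e) hpd (differentiableAt_const e),
    euclDiv_smul (Y := fun y => y) (hqd.fun_mul hi) differentiableAt_fun_id, euclDiv_id,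
    euclDiv_const, gradient_radial hp, gradient_fun_mul hqd hi, gradient_radial hq,
    gradient_inner_left]
  simp only [inner_add_left, inner_add_right, inner_smul_left, inner_smul_right,
    RCLike.conj_to_real, real_inner_self_eq_norm_sq, real_inner_comm e y, lapCoef, quadCoef]
  have h1 : 1 + ‖y‖ ^ 2 ≠ 0 := by positivity
  field_simp
  ring

/-! ### Pointwise bounds -/

variable {C : ℝ}

theorem abs_sqrt_mul_prof_le (hd : 2 ≤ d) (R : ℝ) {x : ℝ} (hx : 0 ≤ x) :
    |√(1 + x) * prof d R x| ≤ 1 := by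
  have h1 := sqrt_mul_kap_le_one hd hx
  have h2 := sqrt_mul_kap_nonneg (d := d) hx
  have h3 : √(1 + x) * prof d R x = cut R x * (√(1 + x) * kap d x) := by rw [prof]; ring
  have h4 : 0 ≤ cut R x := cutBase_nonneg _
  have h5 : cut R x ≤ 1 := cutBase_le_one _
  rw [h3, abs_of_nonneg (by positivity)]
  exact mul_le_one₀ h5 h2 h1

theorem sqrt_mul_prof_nonneg (R : ℝ) {x : ℝ} (hx : 0 ≤ x) : 0 ≤ √(1 + x) * prof d R x :=
  mul_nonneg (Real.sqrt_nonneg _) (mul_nonneg (cutBase_nonneg _) (kap_nonneg hx))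

/-- By `kap_ode` the divergence is the cutoff itself plus a term living where the cutoff varies. -/
theorem divCoef_eq (hd : 2 ≤ d) (R : ℝ) {x : ℝ} (hx : 0 ≤ x) :
    divCoef d R x = cut R x + 2 * (x * cut₁ R x) * (√(1 + x) * kap d x) := by
  have h := kap_ode hd hx
  have hs : 0 < √(1 + x) := by positivity
  rw [eq_div_iff hs.ne'] at h
  rw [divCoef, prof, prof₁]
  linear_combination cut R x * h

theorem abs_divCoef_le (hC : ∀ x, 0 ≤ x → |deriv cutBase x| * (1 + x) ≤ C ∧
    |deriv (deriv cutBase) x| * (1 + x) ^ 2 ≤ C) (hd : 2 ≤ d) {R x : ℝ} (hR : 1 ≤ R) (hx : 0 ≤ x) :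
    |divCoef d R x| ≤ 1 + 2 * C := by
  have h1 := sqrt_mul_kap_le_one hd hx
  have h2 := sqrt_mul_kap_nonneg (d := d) hx
  obtain ⟨h3, -⟩ := cut_bounds hC hR hx
  have h4 : 0 ≤ cut R x := cutBase_nonneg _
  have h5 : cut R x ≤ 1 := cutBase_le_one _
  rw [divCoef_eq hd R hx]
  refine (abs_add_le _ _).trans (add_le_add (by rwa [abs_of_nonneg h4]) ?_)
  rw [abs_mul, abs_mul, abs_mul, abs_of_nonneg h2, abs_of_nonneg hx, abs_two]
  have : x * |cut₁ R x| ≤ C := by nlinarith [abs_nonneg (cut₁ R x)]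
  nlinarith [mul_nonneg hx (abs_nonneg (cut₁ R x))]

/-- The function κ(|y|²)⟨e,y⟩ is harmonic: the equations for κ and κ' cancel every term in which the
cutoff is not differentiated. Therefore the zero-order term of the virial identity disappears as R →
∞. -/
theorem lapCoef_eq (hd : 2 ≤ d) (R : ℝ) {x : ℝ} (hx : 0 ≤ x) :
    √(1 + x) * lapCoef d R x = (4 * (x * (1 + x)) * cut₂ R x +
      ((2 * d + 4) + (2 * d + 6) * x) * cut₁ R x) * (√(1 + x) * kap d x) +
      4 * ((1 + x) * cut₁ R x) * (1 - d * (√(1 + x) * kap d x)) := by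
  have h := kap_ode hd hx
  have h' := kap₁_ode hd hx
  have hs : 0 < √(1 + x) := by positivity
  have h1 : √(1 + x) * (1 / √(1 + x)) = 1 := mul_one_div_cancel hs.ne'
  rw [lapCoef, prof, prof₁, prof₂]
  generalize 1 / √(1 + x) = w at *
  generalize √(1 + x) = z at *
  linear_combination (2 * z * cut R x) * h' + (z * cut R x + 4 * z * (1 + x) * cut₁ R x) * h +
    4 * (1 + x) * cut₁ R x * h1

theorem abs_lapCoef_le (hC : ∀ x, 0 ≤ x → |deriv cutBase x| * (1 + x) ≤ C ∧
    |deriv (deriv cutBase) x| * (1 + x) ^ 2 ≤ C) (hd : 2 ≤ d) {R x : ℝ} (hR : 1 ≤ R) (hx : 0 ≤ x) :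
    |√(1 + x) * lapCoef d R x| ≤ (6 * d + 10) * C := by
  have h1 := sqrt_mul_kap_le_one hd hx
  have h2 := sqrt_mul_kap_nonneg (d := d) hx
  have h2' := sqrt_mul_kap_le hd hx
  have hl := one_le_mul_sqrt_mul_kap hd hx
  obtain ⟨h3, h4⟩ := cut_bounds hC hR hx
  have hd0 : (0 : ℝ) ≤ d := Nat.cast_nonneg d
  have hC0 : 0 ≤ C := (by positivity : (0 : ℝ) ≤ |cut₁ R x| * (1 + x)).trans h3
  rw [lapCoef_eq hd R hx]
  generalize √(1 + x) * kap d x = h at *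
  have a1 := abs_nonneg (cut₁ R x)
  have a2 := abs_nonneg (cut₂ R x)
  have b1 : |4 * (x * (1 + x)) * cut₂ R x| ≤ 4 * C := by
    rw [abs_mul, abs_of_nonneg (by positivity)]
    nlinarith
  have b2 : |((2 * d + 4) + (2 * d + 6) * x) * cut₁ R x| ≤ (2 * d + 6) * C := by
    rw [abs_mul, abs_of_nonneg (by positivity)]
    nlinarith
  have b3 : |4 * ((1 + x) * cut₁ R x)| ≤ 4 * C := by
    rw [abs_mul, abs_mul, abs_of_nonneg (show (0 : ℝ) ≤ 1 + x by linarith)]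
    norm_num; linarith
  have b4 : |1 - d * h| ≤ d := by rw [abs_le]; constructor <;> nlinarith
  calc _ ≤ |(4 * (x * (1 + x)) * cut₂ R x + ((2 * d + 4) + (2 * d + 6) * x) * cut₁ R x) * h| +
        |4 * ((1 + x) * cut₁ R x) * (1 - d * h)| := abs_add_le _ _
    _ ≤ (4 * C + (2 * d + 6) * C) * 1 + 4 * C * d := by
      rw [abs_mul, abs_mul, abs_of_nonneg h2]
      refine add_le_add (mul_le_mul ((abs_add_le _ _).trans (add_le_add b1 b2)) h1 h2
        (by positivity)) (mul_le_mul b3 b4 (abs_nonneg _) (by positivity))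
    _ = _ := by ring

/-- The quadratic form of the truncated multiplier. -/
noncomputable def quadForm (d : ℕ) (R : ℝ) (y ξ : HypChart d) : ℝ :=
  height y * (prof d R (‖y‖ ^ 2) * ‖ξ‖ ^ 2 + quadCoef d R (‖y‖ ^ 2) * ⟪y, ξ⟫ ^ 2)

/-- The quadratic form of the multiplier. -/
noncomputable def quadLim (y ξ : HypChart d) : ℝ :=
  height y * (kap d (‖y‖ ^ 2) * ‖ξ‖ ^ 2 +
    (2 * kap₁ d (‖y‖ ^ 2) * (1 + ‖y‖ ^ 2) + kap d (‖y‖ ^ 2)) * ⟪y, ξ⟫ ^ 2)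

theorem quadLim_le (hd : 2 ≤ d) (y ξ : HypChart d) : quadLim y ξ ≤ ‖coframe y ξ‖ ^ 2 := by
  have hx := sq_nonneg ‖y‖
  have h1 := sqrt_mul_kap_le_one hd hx
  have h2 := kap₁_nonpos (d := d) hx
  have hz := height_pos y
  change height y * _ ≤ 1 at h1
  have h3 : height y * (kap₁ d (‖y‖ ^ 2) * (1 + ‖y‖ ^ 2)) * ⟪y, ξ⟫ ^ 2 ≤ 0 :=
    mul_nonpos_of_nonpos_of_nonneg (mul_nonpos_of_nonneg_of_nonpos hz.le
      (mul_nonpos_of_nonpos_of_nonneg h2 (by positivity))) (sq_nonneg _)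
  have h4 := mul_le_mul_of_nonneg_right h1 (show 0 ≤ ‖ξ‖ ^ 2 + ⟪y, ξ⟫ ^ 2 by positivity)
  rw [norm_coframe_sq, quadLim]
  nlinarith

/-- With z = height y, the form has two eigenvalues relative to the metric: z κ on covectors
orthogonal to y, and 1 - (d-1) z κ along y, by `kap_ode`. Their difference d z κ - 1 is nonnegative,
so the radial one is the smaller. -/
theorem le_quadLim (hd : 2 ≤ d) (y ξ : HypChart d) :
    (1 - (d - 1) * (height y * kap d (‖y‖ ^ 2))) * ‖coframe y ξ‖ ^ 2 ≤ quadLim y ξ := by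
  have hx := sq_nonneg ‖y‖
  have hode := kap_ode hd hx
  have hl := one_le_mul_sqrt_mul_kap hd hx
  have hz := height_pos y
  have hz2 := height_sq y
  change _ = 1 / height y at hode
  change 1 ≤ d * (height y * _) at hl
  rw [eq_div_iff hz.ne'] at hode
  have hcs : ⟪y, ξ⟫ ^ 2 ≤ ‖y‖ ^ 2 * ‖ξ‖ ^ 2 := by
    rw [← mul_pow, ← sq_abs]
    exact pow_le_pow_left₀ (abs_nonneg _) (abs_real_inner_le_norm y ξ) 2
  rw [norm_coframe_sq, quadLim]
  by_cases hy : ‖y‖ ^ 2 = 0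
  · have hP : ⟪y, ξ⟫ ^ 2 = 0 := le_antisymm (by rw [hy, zero_mul] at hcs; exact hcs) (sq_nonneg _)
    rw [hP]
    nlinarith [sq_nonneg ‖ξ‖]
  · have hy0 : 0 < ‖y‖ ^ 2 := lt_of_le_of_ne hx (Ne.symm hy)
    -- Here q is the squared length of the component of ξ along y, so ‖ξ‖² - q is the tangential
    -- part, weighted in `key` by the difference of the eigenvalues.
    obtain ⟨q, hq⟩ : ∃ q, ⟪y, ξ⟫ ^ 2 = ‖y‖ ^ 2 * q := ⟨⟪y, ξ⟫ ^ 2 / ‖y‖ ^ 2, by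
      rw [mul_div_assoc', mul_div_cancel_left₀ _ hy]⟩
    have hqle : q ≤ ‖ξ‖ ^ 2 := by
      rw [hq] at hcs; exact le_of_mul_le_mul_left hcs hy0
    have key := mul_nonneg (sub_nonneg.2 hl) (sub_nonneg.2 hqle)
    rw [hq]
    generalize ‖y‖ ^ 2 = x at *
    generalize height y = z at *
    nlinarith [key, mul_comm z z]

theorem quadLim_nonneg (hd : 2 ≤ d) (y ξ : HypChart d) : 0 ≤ quadLim y ξ := by
  refine le_trans (mul_nonneg ?_ (sq_nonneg _)) (le_quadLim hd y ξ)
  exact sub_nonneg.2 (sqrt_mul_kap_le hd (sq_nonneg ‖y‖))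

theorem quadForm_eq (R : ℝ) (y ξ : HypChart d) : quadForm d R y ξ =
    cut R (‖y‖ ^ 2) * quadLim y ξ +
      2 * (cut₁ R (‖y‖ ^ 2) * (1 + ‖y‖ ^ 2)) * (height y * kap d (‖y‖ ^ 2)) * ⟪y, ξ⟫ ^ 2 := by
  rw [quadForm, quadLim, quadCoef, prof, prof₁]; ring

theorem abs_quadForm_le (hC : ∀ x, 0 ≤ x → |deriv cutBase x| * (1 + x) ≤ C ∧
    |deriv (deriv cutBase) x| * (1 + x) ^ 2 ≤ C) (hd : 2 ≤ d) {R : ℝ} (hR : 1 ≤ R)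
    (y ξ : HypChart d) : |quadForm d R y ξ| ≤ (1 + 2 * C) * ‖coframe y ξ‖ ^ 2 := by
  have hx := sq_nonneg ‖y‖
  obtain ⟨h3, -⟩ := cut_bounds hC hR hx
  have h1 := sqrt_mul_kap_le_one hd hx
  have h2 := sqrt_mul_kap_nonneg (d := d) hx
  have hP : ⟪y, ξ⟫ ^ 2 ≤ ‖coframe y ξ‖ ^ 2 := by
    rw [norm_coframe_sq]; linarith [sq_nonneg ‖ξ‖]
  have h4 : 0 ≤ cut R (‖y‖ ^ 2) := cutBase_nonneg _
  have h5 : cut R (‖y‖ ^ 2) ≤ 1 := cutBase_le_one _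
  have hC0 : 0 ≤ C := (by positivity : (0 : ℝ) ≤ |cut₁ R (‖y‖ ^ 2)| * (1 + ‖y‖ ^ 2)).trans h3
  change height y * _ ≤ 1 at h1
  change 0 ≤ height y * _ at h2
  rw [quadForm_eq, add_mul, one_mul]
  refine (abs_add_le _ _).trans (add_le_add ?_ ?_)
  · rw [abs_mul, abs_of_nonneg h4, abs_of_nonneg (quadLim_nonneg hd y ξ)]
    exact (mul_le_of_le_one_left (quadLim_nonneg hd y ξ) h5).trans (quadLim_le hd y ξ)
  · rw [abs_mul, abs_mul, abs_mul, abs_of_nonneg h2, abs_of_nonneg (sq_nonneg ⟪y, ξ⟫), abs_two,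
      abs_mul, abs_of_nonneg (show 0 ≤ 1 + ‖y‖ ^ 2 by positivity)]
    refine mul_le_mul ?_ hP (sq_nonneg _) (by positivity)
    calc _ ≤ 2 * C * 1 := mul_le_mul (by linarith) h1 h2 (by positivity)
      _ = _ := mul_one _

theorem eventually_coef (hd : 2 ≤ d) {x : ℝ} (hx : 0 ≤ x) : ∀ᶠ n : ℕ in atTop,
    prof d (n + 1) x = kap d x ∧ divCoef d (n + 1) x = 1 ∧ √(1 + x) * lapCoef d (n + 1) x = 0 := by
  filter_upwards [eventually_cut x] with n hn
  obtain ⟨h1, h2, h3⟩ := hn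
  refine ⟨by rw [prof, h1, one_mul], ?_, ?_⟩
  · rw [divCoef_eq hd _ hx, h1, h2]; ring
  · rw [lapCoef_eq hd _ hx, h2, h3]; ring

theorem eventually_quadForm (y ξ : HypChart d) : ∀ᶠ n : ℕ in atTop,
    quadForm d (n + 1) y ξ = quadLim y ξ := by
  filter_upwards [eventually_cut (‖y‖ ^ 2)] with n hn
  rw [quadForm_eq, hn.1, hn.2.1]; ring

/-! ### The weight -/

theorem weightSq_integrand_continuous (d : ℕ) :
    Continuous fun s : ℝ => Real.sinh s ^ (d - 1) / Real.cosh s ^ 2 :=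
  (Real.continuous_sinh.pow _).div (Real.continuous_cosh.pow 2) fun s =>
    (pow_pos (Real.cosh_pos s) 2).ne'

theorem weightSq_pos (d : ℕ) {r : ℝ} (hr : 0 < r) : 0 < weightSq d r := by
  refine mul_pos (div_pos (Real.cosh_pos r) (pow_pos (Real.sinh_pos_iff.2 hr) d)) ?_
  refine intervalIntegral.intervalIntegral_pos_of_pos_on
    ((weightSq_integrand_continuous d).intervalIntegrable _ _) (fun s hs => ?_) hr
  exact div_pos (pow_pos (Real.sinh_pos_iff.2 hs.1) _) (pow_pos (Real.cosh_pos s) 2)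

/-- Identifies c² with the radial eigenvalue of the multiplier. By `kap_ode`, sinh^d s κ(sinh² s)
has derivative sinh^{d-1} s, so sinh^d s / cosh s - (d-1) sinh^d s κ(sinh² s) is a primitive of the
integrand of the weight. -/
theorem weightSq_eq (hd : 2 ≤ d) {r : ℝ} (hr : 0 < r) :
    weightSq d r = 1 - (d - 1) * (Real.cosh r * kap d (Real.sinh r ^ 2)) := by
  have hderiv : ∀ s ∈ uIcc 0 r, HasDerivAt (fun s : ℝ => Real.sinh s ^ d / Real.cosh s -
      (d - 1) * (Real.sinh s ^ d * kap d (Real.sinh s ^ 2)))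
      (Real.sinh s ^ (d - 1) / Real.cosh s ^ 2) s := by
    intro s _
    have hc := (Real.cosh_pos s).ne'
    have hx : 0 ≤ Real.sinh s ^ 2 := sq_nonneg _
    have h1 := (Real.hasDerivAt_sinh s).pow d
    have h2 := (Real.hasDerivAt_sinh s).pow 2
    have h3 := (hasDerivAt_kap (d := d) (x := Real.sinh s ^ 2) (by linarith)).comp s h2
    have h4 := (h1.div (Real.hasDerivAt_cosh s) hc).sub ((h1.mul h3).const_mul ((d : ℝ) - 1))
    convert! h4 using 1
    have hode := kap_ode hd hx
    have hcs := Real.cosh_sq s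
    rw [show 1 + Real.sinh s ^ 2 = Real.cosh s ^ 2 by linarith, Real.sqrt_sq (Real.cosh_pos s).le,
      eq_div_iff hc] at hode
    obtain ⟨k, rfl⟩ : ∃ k, d = k + 1 := ⟨d - 1, by omega⟩
    simp only [Function.comp_apply, Nat.add_sub_cancel, Pi.pow_apply] at *
    have e1 : (↑(k + 1) * Real.sinh s ^ k * Real.cosh s * kap (k + 1) (Real.sinh s ^ 2) +
        Real.sinh s ^ (k + 1) * (kap₁ (k + 1) (Real.sinh s ^ 2) *
          (((2 : ℕ) : ℝ) * Real.sinh s ^ (2 - 1) * Real.cosh s))) = Real.sinh s ^ k := by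
      push_cast at hode ⊢
      linear_combination Real.sinh s ^ k * hode
    have e2 : (↑(k + 1) * Real.sinh s ^ k * Real.cosh s * Real.cosh s -
        Real.sinh s ^ (k + 1) * Real.sinh s) =
        Real.sinh s ^ k + k * Real.sinh s ^ k * Real.cosh s ^ 2 := by
      push_cast
      linear_combination Real.sinh s ^ k * hcs
    rw [e1, e2]
    push_cast
    field_simp
    ring
  have h := intervalIntegral.integral_eq_sub_of_hasDerivAt hderiv
    ((weightSq_integrand_continuous d).intervalIntegrable _ _)
  have hs := (Real.sinh_pos_iff.2 hr).ne'
  have hd0 : d ≠ 0 := by omega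
  rw [weightSq, h, Real.sinh_zero, zero_pow hd0]
  have hc := (Real.cosh_pos r).ne'
  field_simp
  ring

theorem cosh_hypRadius (y : HypChart d) : Real.cosh (hypRadius y) = height y := by
  rw [hypRadius, Real.cosh_arsinh]; rfl

theorem sinh_hypRadius (y : HypChart d) : Real.sinh (hypRadius y) = ‖y‖ := Real.sinh_arsinh _

theorem weightSq_nonneg (y : HypChart d) (hd : 2 ≤ d) : 0 ≤ weightSq d (hypRadius y) := by
  rcases (norm_nonneg y).eq_or_lt with h | h
  · have : d ≠ 0 := by omega
    simp [weightSq, hypRadius, ← h]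
  · exact (weightSq_pos d (Real.arsinh_pos_iff.2 h)).le

/-- Away from the origin this is the equality `weightSq_eq`. At the origin `weightSq` has the
default value 0, hence only an inequality. -/
theorem weightSq_hypRadius_le (hd : 2 ≤ d) (y : HypChart d) :
    weightSq d (hypRadius y) ≤ 1 - (d - 1) * (height y * kap d (‖y‖ ^ 2)) := by
  rcases (norm_nonneg y).eq_or_lt with h | h
  · have : weightSq d (hypRadius y) = 0 := by simp [weightSq, hypRadius, ← h]
    rw [this]
    exact sub_nonneg.2 (sqrt_mul_kap_le hd (sq_nonneg ‖y‖))
  · rw [weightSq_eq hd (show 0 < hypRadius y from Real.arsinh_pos_iff.2 h), ← cosh_hypRadius, ← sinh_hypRadius]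

theorem weightSq_mul_le_quadLim (hd : 2 ≤ d) (y ξ : HypChart d) :
    weightSq d (hypRadius y) * hypCoMetric y ξ ξ ≤ quadLim y ξ := by
  refine le_trans ?_ (le_quadLim hd y ξ)
  rw [← inner_coframe, real_inner_self_eq_norm_sq]
  exact mul_le_mul_of_nonneg_right (weightSq_hypRadius_le hd y) (sq_nonneg _)

theorem measurable_weightSq (d : ℕ) : Measurable (weightSq d) := by
  unfold weightSq
  have h : Continuous fun r : ℝ => ∫ s in (0 : ℝ)..r, Real.sinh s ^ (d - 1) / Real.cosh s ^ 2 :=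
    intervalIntegral.continuous_primitive (fun a b =>
      (weightSq_integrand_continuous d).intervalIntegrable a b) 0
  exact (Real.continuous_cosh.measurable.div (Real.continuous_sinh.pow d).measurable).mul
    h.measurable

end Radial

/-! ### Poincaré inequalities -/

section Poincare
variable {d : ℕ} {u : HypChart d → ℝ} {Du : HypChart d → HypChart d}

theorem inner_multField (R : ℝ) (y ξ : HypChart d) :
    ⟪multField d R y, ξ⟫ = height y * prof d R (‖y‖ ^ 2) * ⟪y, ξ⟫ := by
  rw [multField, inner_smul_left]; rfl

theorem abs_inner_multField_le (hd : 2 ≤ d) (R : ℝ) (y ξ : HypChart d) :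
    |⟪multField d R y, ξ⟫| ≤ ‖coframe y ξ‖ := by
  rw [inner_multField, abs_mul]
  have h1 : |height y * prof d R (‖y‖ ^ 2)| ≤ 1 := abs_sqrt_mul_prof_le hd R (sq_nonneg ‖y‖)
  have h2 := abs_inner_le_norm_coframe y ξ
  have := mul_le_mul h1 h2 (abs_nonneg _) zero_le_one
  linarith

theorem cut_index_pos (n : ℕ) : (0 : ℝ) < n + 1 := by positivity
theorem one_le_cut_index (n : ℕ) : (1 : ℝ) ≤ n + 1 := by
  have : (0 : ℝ) ≤ n := Nat.cast_nonneg n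
  linarith

theorem exists_bound_hypDiv (hd : 2 ≤ d) : ∃ C : ℝ, 0 ≤ C ∧ ∀ (n : ℕ) (y : HypChart d),
    |hypDiv (multField d (n + 1)) y| ≤ C := by
  obtain ⟨C, hC0, hC⟩ := exists_cutBase_bound
  refine ⟨1 + 2 * C, by positivity, fun n y => ?_⟩
  rw [hypDiv_multField]
  exact abs_divCoef_le hC hd (one_le_cut_index n) (sq_nonneg _)

/-- The divergences of the truncated fields are uniformly bounded and at each point eventually equal
to 1. Both Poincaré inequalities come from this. -/
theorem tendsto_integral_hypDiv_mul (hd : 2 ≤ d) {g : ℕ → HypChart d → ℝ} {g₀ b : HypChart d → ℝ}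
    (hb : Integrable b (hypVolume d)) (hg : ∀ n, AEStronglyMeasurable (g n) (hypVolume d))
    (hgb : ∀ n y, |g n y| ≤ b y) (hlim : ∀ y, Tendsto (fun n => g n y) atTop (𝓝 (g₀ y))) :
    Tendsto (fun n : ℕ => ∫ y, hypDiv (multField d (n + 1)) y * g n y ∂(hypVolume d)) atTop
      (𝓝 (∫ y, g₀ y ∂(hypVolume d))) := by
  obtain ⟨C, hC0, hC⟩ := exists_bound_hypDiv hd
  refine tendsto_integral_of_dominated_convergence (fun y => C * b y)
    (fun n => (continuous_hypDiv (contDiff_multField _)).aestronglyMeasurable.mul (hg n))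
    (hb.const_mul C) (fun n => Eventually.of_forall fun y => ?_) (Eventually.of_forall fun y => ?_)
  · rw [norm_mul]
    exact mul_le_mul (hC n y) (hgb n y) (norm_nonneg _) hC0
  · refine (hlim y).congr' ?_
    filter_upwards [eventually_coef hd (sq_nonneg ‖y‖)] with n hn
    rw [hypDiv_multField, hn.2.1, one_mul]

/-- The Poincaré inequality. -/
theorem IsH1.lTwo_le (hd : 2 ≤ d) (hu : IsH1 u Du) :
    lTwo (hypVolume d) u ≤ 2 * lTwo (hypVolume d) (fun y => coframe y (Du y)) := by
  have hsq : Integrable (fun y => u y ^ 2) (hypVolume d) := hu.memLp.integrable_sq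
  have t := tendsto_integral_hypDiv_mul hd (g := fun _ y => u y ^ 2) (g₀ := fun y => u y ^ 2) hsq
    (fun _ => hsq.1) (fun _ y => (abs_of_nonneg (sq_nonneg _)).le) (fun y => tendsto_const_nhds)
  -- The divergence theorem turns ∫ (div X_n) u² into -2 ∫ u X_n u, and |X_n u| ≤ |∇u|.
  have hb : ∀ n : ℕ, ∫ y, hypDiv (multField d (n + 1)) y * u y ^ 2 ∂(hypVolume d) ≤
      2 * lTwo (hypVolume d) (fun y => coframe y (Du y)) * lTwo (hypVolume d) u := by
    intro n
    have hc := hasCompactSupport_multField (d := d) (cut_index_pos n)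
    have hY := contDiff_multField (d := d) ((n : ℝ) + 1)
    have key := hu.integral_mul_hypDiv hu hY hc
    have hm := memLp_inner_field hY.continuous hc hu.meas hu.memLp_coframe
    have h1 := abs_integral_mul_le hm hu.memLp
    have h2 : lTwo (hypVolume d) (fun y => ⟪multField d (n + 1) y, Du y⟫) ≤
        1 * lTwo (hypVolume d) (fun y => coframe y (Du y)) :=
      lTwo_le_of_norm_le zero_le_one hu.memLp_coframe fun y => by
        rw [one_mul]; exact abs_inner_multField_le hd _ _ _
    have h3 := mul_le_mul_of_nonneg_right h2 (lTwo_nonneg (μ := hypVolume d) u)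
    have e : ∫ y, u y * ⟪multField d (n + 1) y, Du y⟫ ∂(hypVolume d) =
        ∫ y, ⟪multField d (n + 1) y, Du y⟫ * u y ∂(hypVolume d) := by
      simp only [mul_comm]
    rw [e] at key
    simp only [pow_two, ← mul_assoc]
    rw [key]
    linarith [neg_abs_le (∫ y, ⟪multField d (n + 1) y, Du y⟫ * u y ∂(hypVolume d))]
  have hle := le_of_tendsto' t hb
  have hs := lTwo_sq hu.memLp.1
  simp only [Real.norm_eq_abs, sq_abs] at hs
  rw [← hs] at hle
  have h0 := lTwo_nonneg (μ := hypVolume d) u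
  have h1 := lTwo_nonneg (μ := hypVolume d) (fun y => coframe y (Du y))
  by_contra! hlt
  nlinarith

/-- The `L¹` Poincaré inequality for `Ψ(u)`. -/
theorem IsH1.integral_abs_comp_le (hd : 2 ≤ d) (hu : IsH1 u Du) {Ψ ψ : ℝ → ℝ} {B δ : ℝ}
    (hΨ : ∀ σ, HasDerivAt Ψ (ψ σ) σ) (hψ : Continuous ψ) (hB : ∀ σ, |ψ σ| ≤ B) (h0 : Ψ 0 = 0)
    (hδ : 0 < δ) (hψδ : ∀ σ, |σ| ≤ δ → ψ σ = 0) :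
    Integrable (fun y => Ψ (u y)) (hypVolume d) ∧
      ∫ y, |Ψ (u y)| ∂(hypVolume d) ≤ ∫ y, |ψ (u y)| * ‖coframe y (Du y)‖ ∂(hypVolume d) := by
  have hB0 : 0 ≤ B := (abs_nonneg _).trans (hB 0)
  have hΨc : Continuous Ψ := continuous_iff_continuousAt.2 fun σ => (hΨ σ).continuousAt
  have hψu : ∀ σ, |ψ σ| ≤ B / δ * |σ| := fun σ => by
    by_cases h : |σ| ≤ δ
    · rw [hψδ σ h, abs_zero]; positivity
    · refine (hB σ).trans ?_
      rw [div_mul_eq_mul_div, le_div_iff₀ hδ]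
      exact mul_le_mul_of_nonneg_left (not_le.1 h).le hB0
  have hΨu : ∀ σ, |Ψ σ| ≤ B / δ * |σ| ^ 2 := fun σ => by
    have := Convex.norm_image_sub_le_of_norm_hasDerivWithin_le (f := Ψ) (f' := ψ)
      (s := Metric.closedBall (0 : ℝ) |σ|) (x := 0) (y := σ) (C := B / δ * |σ|)
      (fun x _ => (hΨ x).hasDerivWithinAt) (fun x hx => (hψu x).trans
        (mul_le_mul_of_nonneg_left (by simpa using hx) (by positivity)))
      (convex_closedBall _ _) (by simp) (by simp)
    simpa [h0, pow_two, mul_assoc] using this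
  have hsq : Integrable (fun y => u y ^ 2) (hypVolume d) := hu.memLp.integrable_sq
  have hΨi : Integrable (fun y => Ψ (u y)) (hypVolume d) :=
    (hsq.const_mul (B / δ)).mono' (hΨc.comp_aestronglyMeasurable hu.memLp.1)
      (Eventually.of_forall fun y => by simpa using hΨu (u y))
  have hψL : MemLp (fun y => ψ (u y)) 2 (hypVolume d) :=
    hu.memLp.of_norm_le_mul (hψ.comp_aestronglyMeasurable hu.memLp.1) fun y => hψu _
  have hbi : Integrable (fun y => |ψ (u y)| * ‖coframe y (Du y)‖) (hypVolume d) :=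
    hψL.norm.integrable_mul hu.memLp_coframe.norm
  refine ⟨hΨi, ?_⟩
  -- A C¹ regularisation of |Ψ|; subtracting ε makes it vanish at 0, as the divergence theorem for
  -- Φ(u) requires.
  let Φ : ℝ → ℝ → ℝ := fun ε σ => √(Ψ σ ^ 2 + ε ^ 2) - ε
  have hΦ : ∀ {ε : ℝ}, 0 < ε → ∀ σ, HasDerivAt (Φ ε) (Ψ σ / √(Ψ σ ^ 2 + ε ^ 2) * ψ σ) σ := by
    intro ε hε σ
    have hp : Ψ σ ^ 2 + ε ^ 2 ≠ 0 := by positivity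
    have := ((((hΨ σ).pow 2).add_const (ε ^ 2)).sqrt hp).sub_const ε
    convert! this using 1
    push_cast
    have hs : √(Ψ σ ^ 2 + ε ^ 2) ≠ 0 := by positivity
    simp only [Pi.pow_apply]
    field_simp
  have hle1 : ∀ {ε : ℝ}, 0 < ε → ∀ σ, |Ψ σ / √(Ψ σ ^ 2 + ε ^ 2)| ≤ 1 := by
    intro ε hε σ
    have hs : 0 < √(Ψ σ ^ 2 + ε ^ 2) := by positivity
    rw [abs_div, abs_of_pos hs, div_le_one hs]
    exact Real.abs_le_sqrt (by nlinarith)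
  have hΦle : ∀ {ε : ℝ}, 0 < ε → ∀ σ, |Φ ε σ| ≤ |Ψ σ| := by
    intro ε hε σ
    have h1 : ε ≤ √(Ψ σ ^ 2 + ε ^ 2) := Real.le_sqrt_of_sq_le (by nlinarith [sq_nonneg (Ψ σ)])
    have h2 : √(Ψ σ ^ 2 + ε ^ 2) ≤ |Ψ σ| + ε := by
      rw [Real.sqrt_le_left (by positivity)]
      nlinarith [sq_abs (Ψ σ), abs_nonneg (Ψ σ)]
    change |√(Ψ σ ^ 2 + ε ^ 2) - ε| ≤ _
    rw [abs_of_nonneg (by linarith)]; linarith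
  have hεn : ∀ n : ℕ, (0 : ℝ) < 1 / ((n : ℝ) + 1) := fun n => by positivity
  have t := tendsto_integral_hypDiv_mul hd (g := fun n y => Φ (1 / ((n : ℝ) + 1)) (u y))
    (g₀ := fun y => |Ψ (u y)|) hΨi.abs (fun n => by
      have : Continuous (Φ (1 / ((n : ℝ) + 1))) := by
        change Continuous fun σ => √(Ψ σ ^ 2 + (1 / ((n : ℝ) + 1)) ^ 2) - 1 / ((n : ℝ) + 1)
        fun_prop
      exact this.comp_aestronglyMeasurable hu.memLp.1) (fun n y => hΦle (hεn n) _) (fun y => by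
      have hc : Continuous fun ε : ℝ => √(Ψ (u y) ^ 2 + ε ^ 2) - ε := by fun_prop
      have h1 := (hc.tendsto 0).comp (tendsto_one_div_add_atTop_nhds_zero_nat (𝕜 := ℝ))
      have e : √(Ψ (u y) ^ 2 + 0 ^ 2) - 0 = |Ψ (u y)| := by simp [Real.sqrt_sq_eq_abs]
      rw [e] at h1
      exact h1)
  refine le_of_tendsto' t fun n => ?_
  have hε := hεn n
  set ε : ℝ := 1 / ((n : ℝ) + 1)
  have hc := hasCompactSupport_multField (d := d) (cut_index_pos n)
  have hY := contDiff_multField (d := d) ((n : ℝ) + 1)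
  have hbd : ∀ σ, |Ψ σ / √(Ψ σ ^ 2 + ε ^ 2) * ψ σ| ≤ |ψ σ| := fun σ => by
    rw [abs_mul]; exact mul_le_of_le_one_left (abs_nonneg _) (hle1 hε σ)
  rw [hu.integral_comp_hypDiv (hΦ hε) ((hΨc.div (by fun_prop) fun σ => by positivity).mul hψ)
    (fun σ => (hbd σ).trans (hB σ)) (by
      change √(Ψ 0 ^ 2 + ε ^ 2) - ε = 0
      rw [h0]; simp [Real.sqrt_sq hε.le]) hY hc]
  refine (neg_le_abs _).trans ?_
  rw [← Real.norm_eq_abs]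
  refine norm_integral_le_of_norm_le hbi (Eventually.of_forall fun y => ?_)
  rw [norm_mul]
  exact mul_le_mul (hbd _) (abs_inner_multField_le hd _ _ _) (norm_nonneg _) (abs_nonneg _)

end Poincare

/-! ### Functions of an `H¹` function -/

section Nonlinear
variable {d : ℕ} {u : HypChart d → ℝ} {Du : HypChart d → HypChart d} {F : ℝ → ℝ}

/-- The density is at least 1/(1+n) on the ball of radius n, whose Euclidean volume is proportional
to n^d. For d ≥ 2 the quotient n^d/(1+n) is at least n - 1. -/
theorem hypVolume_univ (hd : 2 ≤ d) : hypVolume d univ = ⊤ := by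
  have hd0 : d ≠ 0 := by omega
  have : Nonempty (Fin d) := ⟨⟨0, by omega⟩⟩
  set v := volume (Metric.ball (0 : HypChart d) 1)
  have hv : 0 < v := Metric.measure_ball_pos _ _ one_pos
  have hvt : v ≠ ⊤ := measure_ball_lt_top.ne
  have key : ∀ n : ℕ, ENNReal.ofReal ((n : ℝ) - 1) * v ≤ hypVolume d univ := by
    intro n
    have h1 : volume (Metric.ball (0 : HypChart d) n) = ENNReal.ofReal ((n : ℝ) ^ d) * v := by
      rcases Nat.eq_zero_or_pos n with rfl | hn
      · simp [hd0]
      · have := Measure.addHaar_ball_of_pos (volume : Measure (HypChart d)) 0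
          (r := n) (by exact_mod_cast hn)
        simpa using this
    calc _ ≤ ENNReal.ofReal (1 / (1 + n)) * volume (Metric.ball (0 : HypChart d) n) := by
          rw [h1, ← mul_assoc, ← ENNReal.ofReal_mul (by positivity)]
          gcongr
          rw [div_mul_eq_mul_div, one_mul, le_div_iff₀ (by positivity)]
          have hn : (0 : ℝ) ≤ n := Nat.cast_nonneg n
          rcases Nat.eq_zero_or_pos n with rfl | hn
          · simp [hd0]
          · have h2 : (n : ℝ) ^ 2 ≤ (n : ℝ) ^ d :=
              pow_le_pow_right₀ (by exact_mod_cast hn) hd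
            nlinarith
      _ = ∫⁻ _ in Metric.ball (0 : HypChart d) n, ENNReal.ofReal (1 / (1 + n)) := by
          rw [setLIntegral_const]
      _ ≤ ∫⁻ y in Metric.ball (0 : HypChart d) n, ENNReal.ofReal (1 / √(1 + ‖y‖ ^ 2)) := by
          refine setLIntegral_mono measurable_hypDensity fun y hy => ENNReal.ofReal_le_ofReal ?_
          have hy' : ‖y‖ < n := by simpa using hy
          exact one_div_le_one_div_of_le (height_pos y) ((height_le y).trans (by linarith))
      _ = hypVolume d (Metric.ball (0 : HypChart d) n) :=
          (withDensity_apply _ measurableSet_ball).symm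
      _ ≤ _ := measure_mono (subset_univ _)
  by_contra h
  have hlim : Tendsto (fun n : ℕ => ENNReal.ofReal ((n : ℝ) - 1) * v) atTop (𝓝 (⊤ * v)) := by
    refine ENNReal.Tendsto.mul_const (ENNReal.tendsto_ofReal_atTop.comp
      (tendsto_atTop_add_const_right _ _ tendsto_natCast_atTop_atTop)) (Or.inl ENNReal.top_ne_zero)
  rw [ENNReal.top_mul hv.ne'] at hlim
  exact h (top_le_iff.1 (le_of_tendsto' hlim key))

/-- If F(0) ≠ 0, at each point either |u| ≥ δ or |F(u)| ≥ |F(0)|/2, so the constant 1 would be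
dominated by an integrable function, against the infinite volume. -/
theorem map_zero_of_memLp (hd : 2 ≤ d) (hF : Continuous F) (hu : MemLp u 2 (hypVolume d))
    (hFu : MemLp (fun y => F (u y)) 2 (hypVolume d)) : F 0 = 0 := by
  by_contra h0
  obtain ⟨δ, hδ, hδF⟩ := Metric.continuousAt_iff.1 (hF.continuousAt (x := 0)) (|F 0| / 2)
    (by positivity)
  have h1 : Integrable (fun y => (1 / δ ^ 2) * u y ^ 2 + (2 / |F 0|) ^ 2 * F (u y) ^ 2)
      (hypVolume d) := (hu.integrable_sq.const_mul _).add (hFu.integrable_sq.const_mul _)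
  have h2 : Integrable (fun _ => (1 : ℝ)) (hypVolume d) := by
    refine h1.mono' aestronglyMeasurable_const (Eventually.of_forall fun y => ?_)
    have hF0 : 0 < |F 0| := abs_pos.2 h0
    rw [norm_one]
    by_cases h : |u y| < δ
    · have := hδF (x := u y) (by simpa using h)
      rw [Real.dist_eq] at this
      have h3 : |F 0| / 2 ≤ |F (u y)| := by
        have := abs_sub_abs_le_abs_sub (F 0) (F (u y))
        rw [abs_sub_comm] at this
        linarith
      have h4 : 1 ≤ 2 / |F 0| * |F (u y)| := by
        rw [div_mul_eq_mul_div, le_div_iff₀ hF0]; linarith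
      have h5 : 1 ≤ (2 / |F 0|) ^ 2 * F (u y) ^ 2 := by
        rw [← sq_abs (F (u y)), ← mul_pow]; exact one_le_pow₀ h4
      have : 0 ≤ (1 / δ ^ 2) * u y ^ 2 := by positivity
      linarith
    · have h3 : δ ^ 2 ≤ u y ^ 2 := by
        rw [← sq_abs (u y)]; exact pow_le_pow_left₀ hδ.le (not_lt.1 h) 2
      have h4 : 1 ≤ (1 / δ ^ 2) * u y ^ 2 := by
        rw [div_mul_eq_mul_div, one_mul, le_div_iff₀ (by positivity)]; linarith
      have : 0 ≤ (2 / |F 0|) ^ 2 * F (u y) ^ 2 := by positivity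
      linarith
  have h3 := (integrable_const_iff_isFiniteMeasure (μ := hypVolume d) (one_ne_zero (α := ℝ))).1 h2
  exact (h3.measure_univ_lt_top).ne (hypVolume_univ hd)

/-- A continuous cutoff on the line away from `0` and `∞`. -/
noncomputable def lineCut (k : ℕ) (σ : ℝ) : ℝ :=
  max 0 (min 1 (k * |σ| - 1)) * max 0 (min 1 (k + 1 - |σ|))

theorem continuous_lineCut (k : ℕ) : Continuous (lineCut k) := by unfold lineCut; fun_prop

theorem lineCut_nonneg (k : ℕ) (σ : ℝ) : 0 ≤ lineCut k σ :=
  mul_nonneg (le_max_left _ _) (le_max_left _ _)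

theorem lineCut_le_one (k : ℕ) (σ : ℝ) : lineCut k σ ≤ 1 :=
  mul_le_one₀ (max_le zero_le_one (min_le_left _ _)) (le_max_left _ _)
    (max_le zero_le_one (min_le_left _ _))

theorem lineCut_of_small {k : ℕ} {σ : ℝ} (h : k * |σ| ≤ 1) : lineCut k σ = 0 := by
  rw [lineCut, max_eq_left ((min_le_right _ _).trans (by linarith)), zero_mul]

theorem lineCut_of_large {k : ℕ} {σ : ℝ} (h : k + 1 ≤ |σ|) : lineCut k σ = 0 := by
  rw [lineCut, max_eq_left (a := (0 : ℝ)) (b := min 1 (k + 1 - |σ|))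
    ((min_le_right _ _).trans (by linarith)), mul_zero]

theorem eventually_lineCut {σ : ℝ} (h : σ ≠ 0) : ∀ᶠ k : ℕ in atTop, lineCut k σ = 1 := by
  have hσ : 0 < |σ| := abs_pos.2 h
  have h1 : ∀ᶠ k : ℕ in atTop, 2 / |σ| ≤ (k : ℝ) :=
    tendsto_natCast_atTop_atTop.eventually_ge_atTop _
  have h2 : ∀ᶠ k : ℕ in atTop, |σ| ≤ (k : ℝ) := tendsto_natCast_atTop_atTop.eventually_ge_atTop _
  filter_upwards [h1, h2] with k hk1 hk2
  rw [div_le_iff₀ hσ] at hk1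
  rw [lineCut, min_eq_left (by linarith), min_eq_left (by linarith)]; norm_num

/-- The truncated nonlinearity. -/
noncomputable def truncF (F : ℝ → ℝ) (k : ℕ) (σ : ℝ) : ℝ := F σ * lineCut k σ

theorem continuous_truncF (hF : Continuous F) (k : ℕ) : Continuous (truncF F k) :=
  hF.mul (continuous_lineCut k)

theorem abs_truncF_le (F : ℝ → ℝ) (k : ℕ) (σ : ℝ) : |truncF F k σ| ≤ |F σ| := by
  rw [truncF, abs_mul, abs_of_nonneg (lineCut_nonneg k σ)]
  exact mul_le_of_le_one_right (abs_nonneg _) (lineCut_le_one k σ)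

theorem exists_truncF_bound (hF : Continuous F) (k : ℕ) : ∃ B, ∀ σ, |truncF F k σ| ≤ B := by
  obtain ⟨B, hB⟩ := (isCompact_Icc (a := -((k : ℝ) + 1)) (b := k + 1)).exists_bound_of_continuousOn
    (continuous_truncF hF k).continuousOn
  refine ⟨max B 0, fun σ => ?_⟩
  by_cases h : (k : ℝ) + 1 ≤ |σ|
  · rw [truncF, lineCut_of_large h]; simp
  · exact (hB σ (abs_le.1 (not_le.1 h).le)).trans (le_max_left _ _)

/-- F(0) = 0 is needed because all truncations vanish at 0. -/
theorem tendsto_truncF (h0 : F 0 = 0) (σ : ℝ) :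
    Tendsto (fun k => truncF F k σ) atTop (𝓝 (F σ)) := by
  by_cases h : σ = 0
  · simp [truncF, h, h0]
  · refine tendsto_const_nhds.congr' ?_
    filter_upwards [eventually_lineCut h] with k hk
    rw [truncF, hk, mul_one]

theorem hasDerivAt_primitiveOf {f : ℝ → ℝ} (hf : Continuous f) (σ : ℝ) :
    HasDerivAt (primitiveOf f) (f σ) σ :=
  intervalIntegral.integral_hasDerivAt_right (hf.intervalIntegrable _ _)
    (hf.stronglyMeasurableAtFilter _ _) hf.continuousAt

theorem continuous_primitiveOf {f : ℝ → ℝ} (hf : Continuous f) : Continuous (primitiveOf f) :=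
  continuous_iff_continuousAt.2 fun σ => (hasDerivAt_primitiveOf hf σ).continuousAt

theorem tendsto_primitiveOf_truncF (hF : Continuous F) (h0 : F 0 = 0) (σ : ℝ) :
    Tendsto (fun k => primitiveOf (truncF F k) σ) atTop (𝓝 (primitiveOf F σ)) := by
  refine intervalIntegral.tendsto_integral_filter_of_dominated_convergence (fun s => |F s|)
    (Eventually.of_forall fun k => (continuous_truncF hF k).aestronglyMeasurable)
    (Eventually.of_forall fun k => Eventually.of_forall fun s _ => abs_truncF_le F k s)
    (hF.abs.intervalIntegrable _ _) (Eventually.of_forall fun s _ => tendsto_truncF h0 s)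

/-- Two truncations are bounded and vanish near 0, so the L¹ Poincaré inequality applies to the
difference of their primitives. Fatou's lemma then replaces the second truncation by F, for which
integrability of G(u) is not yet known; hence the lower integral. -/
theorem IsH1.lintegral_primitiveOf_sub_le (hd : 2 ≤ d) (hu : IsH1 u Du) (hF : Continuous F)
    (hFu : MemLp (fun y => F (u y)) 2 (hypVolume d)) (k : ℕ) :
    ∫⁻ y, ENNReal.ofReal |primitiveOf (truncF F k) (u y) - primitiveOf F (u y)| ∂(hypVolume d) ≤
      ENNReal.ofReal (∫ y, |truncF F k (u y) - F (u y)| * ‖coframe y (Du y)‖ ∂(hypVolume d)) := by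
  have h0 := map_zero_of_memLp hd hF hu.memLp hFu
  have hFm : ∀ l, AEStronglyMeasurable (fun y => truncF F l (u y)) (hypVolume d) := fun l =>
    (continuous_truncF hF l).comp_aestronglyMeasurable hu.memLp.1
  have hstep : ∀ l : ℕ, ∫⁻ y, ENNReal.ofReal
      |primitiveOf (truncF F k) (u y) - primitiveOf (truncF F l) (u y)| ∂(hypVolume d) ≤
      ENNReal.ofReal (∫ y, |truncF F k (u y) - truncF F l (u y)| * ‖coframe y (Du y)‖
        ∂(hypVolume d)) := by
    intro l
    obtain ⟨B, hB⟩ := exists_truncF_bound hF k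
    obtain ⟨B', hB'⟩ := exists_truncF_bound hF l
    -- For |σ| ≤ δ = 1/(k+l+1) both k|σ| ≤ 1 and l|σ| ≤ 1, where the two line cutoffs vanish.
    have := hu.integral_abs_comp_le hd
      (Ψ := fun σ => primitiveOf (truncF F k) σ - primitiveOf (truncF F l) σ)
      (ψ := fun σ => truncF F k σ - truncF F l σ) (B := B + B') (δ := 1 / (k + l + 1))
      (fun σ => (hasDerivAt_primitiveOf (continuous_truncF hF k) σ).sub
        (hasDerivAt_primitiveOf (continuous_truncF hF l) σ))
      ((continuous_truncF hF k).sub (continuous_truncF hF l))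
      (fun σ => (abs_sub _ _).trans (add_le_add (hB σ) (hB' σ))) (by simp [primitiveOf])
      (by positivity) (fun σ hσ => by
        rw [le_div_iff₀ (by positivity)] at hσ
        have hk : (k : ℝ) * |σ| ≤ 1 := by nlinarith [abs_nonneg σ, (Nat.cast_nonneg l : (0:ℝ) ≤ l)]
        have hl : (l : ℝ) * |σ| ≤ 1 := by nlinarith [abs_nonneg σ, (Nat.cast_nonneg k : (0:ℝ) ≤ k)]
        simp [truncF, lineCut_of_small hk, lineCut_of_small hl])
    rw [← ofReal_integral_eq_lintegral_ofReal this.1.abs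
      (Eventually.of_forall fun _ => abs_nonneg _)]
    exact ENNReal.ofReal_le_ofReal this.2
  have hpt : ∀ y, Tendsto (fun l => ENNReal.ofReal
      |primitiveOf (truncF F k) (u y) - primitiveOf (truncF F l) (u y)|) atTop
      (𝓝 (ENNReal.ofReal |primitiveOf (truncF F k) (u y) - primitiveOf F (u y)|)) := fun y =>
    ENNReal.tendsto_ofReal ((tendsto_primitiveOf_truncF hF h0 (u y)).const_sub _).abs
  have hFi : Integrable (fun y => 2 * (|F (u y)| * ‖coframe y (Du y)‖)) (hypVolume d) :=
    (hFu.norm.integrable_mul hu.memLp_coframe.norm).const_mul 2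
  have hR : Tendsto (fun l => ENNReal.ofReal (∫ y, |truncF F k (u y) - truncF F l (u y)| *
      ‖coframe y (Du y)‖ ∂(hypVolume d))) atTop (𝓝 (ENNReal.ofReal
      (∫ y, |truncF F k (u y) - F (u y)| * ‖coframe y (Du y)‖ ∂(hypVolume d)))) := by
    refine ENNReal.tendsto_ofReal (tendsto_integral_of_dominated_convergence _
      (fun l => ((hFm k).sub (hFm l)).norm.mul hu.memLp_coframe.1.norm) hFi
      (fun l => Eventually.of_forall fun y => ?_) (Eventually.of_forall fun y => ?_))
    · rw [norm_mul, Real.norm_eq_abs, abs_abs, norm_norm, ← mul_assoc]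
      refine mul_le_mul_of_nonneg_right ?_ (norm_nonneg _)
      refine (abs_sub _ _).trans ?_
      have h1 := abs_truncF_le F k (u y)
      have h2 := abs_truncF_le F l (u y)
      linarith
    · exact ((tendsto_truncF h0 (u y)).const_sub _).abs.mul_const _
  calc _ = ∫⁻ y, liminf (fun l => ENNReal.ofReal
        |primitiveOf (truncF F k) (u y) - primitiveOf (truncF F l) (u y)|) atTop ∂(hypVolume d) :=
        lintegral_congr fun y => (hpt y).liminf_eq.symm
    _ ≤ liminf (fun l => ∫⁻ y, ENNReal.ofReal
        |primitiveOf (truncF F k) (u y) - primitiveOf (truncF F l) (u y)| ∂(hypVolume d)) atTop :=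
        lintegral_liminf_le' fun l => by
          have h1 : Continuous fun σ : ℝ => ENNReal.ofReal
              |primitiveOf (truncF F k) σ - primitiveOf (truncF F l) σ| :=
            ENNReal.continuous_ofReal.comp ((continuous_primitiveOf (continuous_truncF hF k)).sub
              (continuous_primitiveOf (continuous_truncF hF l))).abs
          exact h1.measurable.comp_aemeasurable hu.memLp.1.aemeasurable
    _ ≤ liminf (fun l => ENNReal.ofReal (∫ y, |truncF F k (u y) - truncF F l (u y)| *
          ‖coframe y (Du y)‖ ∂(hypVolume d))) atTop :=
        liminf_le_liminf (Eventually.of_forall hstep)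
    _ = _ := hR.liminf_eq

theorem IsH1.integrable_primitiveOf (hd : 2 ≤ d) (hu : IsH1 u Du) (hF : Continuous F)
    (hFu : MemLp (fun y => F (u y)) 2 (hypVolume d)) :
    Integrable (fun y => primitiveOf F (u y)) (hypVolume d) ∧
      ∫ y, |primitiveOf F (u y)| ∂(hypVolume d) ≤
        lTwo (hypVolume d) (fun y => F (u y)) *
          lTwo (hypVolume d) (fun y => coframe y (Du y)) := by
  have h := hu.lintegral_primitiveOf_sub_le hd hF hFu 0
  -- The truncation of index 0 is identically zero, so the previous bound with k = 0 is a bound on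
  -- G(u) itself.
  have e : truncF F 0 = 0 := by ext σ; simp [truncF, lineCut]
  simp only [e, primitiveOf, Pi.zero_apply, intervalIntegral.integral_zero, zero_sub,
    abs_neg] at h
  have hm : AEStronglyMeasurable (fun y => primitiveOf F (u y)) (hypVolume d) :=
    (continuous_primitiveOf hF).comp_aestronglyMeasurable hu.memLp.1
  have hi : Integrable (fun y => primitiveOf F (u y)) (hypVolume d) := by
    refine ⟨hm, ?_⟩
    rw [HasFiniteIntegral]
    refine lt_of_le_of_lt (le_of_eq ?_) (h.trans_lt ENNReal.ofReal_lt_top)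
    exact lintegral_congr fun y => (ofReal_norm _).symm
  refine ⟨hi, ?_⟩
  have h2 := ofReal_integral_eq_lintegral_ofReal hi.abs (Eventually.of_forall fun _ => abs_nonneg _)
  change ∫⁻ y, ENNReal.ofReal |primitiveOf F (u y)| ∂(hypVolume d) ≤ _ at h
  rw [← h2] at h
  refine ((ENNReal.ofReal_le_ofReal_iff (integral_nonneg fun y => by positivity)).1 h).trans ?_
  exact integral_norm_mul_norm_le hFu hu.memLp_coframe

/-- The divergence theorem for `G(u)`. -/
theorem IsH1.integral_primitiveOf_hypDiv (hd : 2 ≤ d) (hu : IsH1 u Du) (hF : Continuous F)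
    (hFu : MemLp (fun y => F (u y)) 2 (hypVolume d)) {Y : HypChart d → HypChart d}
    (hY : ContDiff ℝ 1 Y) (hYc : HasCompactSupport Y) :
    ∫ y, hypDiv Y y * primitiveOf F (u y) ∂(hypVolume d) =
      -∫ y, F (u y) * ⟪Y y, Du y⟫ ∂(hypVolume d) := by
  have h0 := map_zero_of_memLp hd hF hu.memLp hFu
  have hFm : ∀ l, AEStronglyMeasurable (fun y => truncF F l (u y)) (hypVolume d) := fun l =>
    (continuous_truncF hF l).comp_aestronglyMeasurable hu.memLp.1
  have hYL := memLp_inner_field hY.continuous hYc hu.meas hu.memLp_coframe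
  have hdc := continuous_hypDiv hY
  obtain ⟨D, hD0, hD⟩ := exists_bound_of_hasCompactSupport hdc (hasCompactSupport_hypDiv hYc)
  have t2 : Tendsto (fun k => -∫ y, truncF F k (u y) * ⟪Y y, Du y⟫ ∂(hypVolume d)) atTop
      (𝓝 (-∫ y, F (u y) * ⟪Y y, Du y⟫ ∂(hypVolume d))) := by
    refine (tendsto_integral_of_dominated_convergence (fun y => ‖F (u y)‖ * ‖⟪Y y, Du y⟫‖)
      (fun k => (hFm k).mul hYL.1) (hFu.norm.integrable_mul hYL.norm)
      (fun k => Eventually.of_forall fun y => ?_) (Eventually.of_forall fun y => ?_)).neg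
    · exact (norm_mul _ _).trans_le
        (mul_le_mul_of_nonneg_right (abs_truncF_le F k _) (norm_nonneg _))
    · exact (tendsto_truncF h0 _).mul_const _
  -- By `IsH1.lintegral_primitiveOf_sub_le` this integral bounds the L¹ distance between the
  -- truncated primitives and G(u).
  have hzero : Tendsto (fun k => ∫ y, |truncF F k (u y) - F (u y)| * ‖coframe y (Du y)‖
      ∂(hypVolume d)) atTop (𝓝 0) := by
    have := tendsto_integral_of_dominated_convergence (μ := hypVolume d)
      (F := fun k y => |truncF F k (u y) - F (u y)| * ‖coframe y (Du y)‖) (f := fun _ => 0)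
      (fun y => 2 * (|F (u y)| * ‖coframe y (Du y)‖))
      (fun l => ((hFm l).sub hFu.1).norm.mul hu.memLp_coframe.1.norm)
      ((hFu.norm.integrable_mul hu.memLp_coframe.norm).const_mul 2)
      (fun l => Eventually.of_forall fun y => ?_) (Eventually.of_forall fun y => ?_)
    · simpa using this
    · rw [norm_mul, Real.norm_eq_abs, abs_abs, norm_norm, ← mul_assoc]
      refine mul_le_mul_of_nonneg_right ?_ (norm_nonneg _)
      refine (abs_sub _ _).trans ?_
      have h2 := abs_truncF_le F l (u y)
      linarith
    · have := ((tendsto_truncF h0 (u y)).sub_const (F (u y))).abs.mul_const ‖coframe y (Du y)‖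
      simpa using this
  have hzero' := ENNReal.tendsto_ofReal hzero
  rw [ENNReal.ofReal_zero] at hzero'
  have hGi := (hu.integrable_primitiveOf hd hF hFu).1
  have hGk : ∀ k, Integrable (fun y => primitiveOf (truncF F k) (u y)) (hypVolume d) := fun k =>
    (hu.integrable_primitiveOf hd (continuous_truncF hF k) (hFu.of_norm_le_mul (c := 1) (hFm k)
      fun y => by rw [one_mul]; exact abs_truncF_le F k _)).1
  have t1 : Tendsto (fun k => ∫ y, hypDiv Y y * primitiveOf (truncF F k) (u y) ∂(hypVolume d))
      atTop (𝓝 (∫ y, hypDiv Y y * primitiveOf F (u y) ∂(hypVolume d))) := by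
    refine tendsto_integral_of_L1 _ (hGi.bdd_mul hdc.aestronglyMeasurable
      (Eventually.of_forall hD)).1 (Eventually.of_forall fun k => (hGk k).bdd_mul
        hdc.aestronglyMeasurable (Eventually.of_forall hD)) ?_
    have hup : Tendsto (fun k => ENNReal.ofReal D * ENNReal.ofReal (∫ y,
        |truncF F k (u y) - F (u y)| * ‖coframe y (Du y)‖ ∂(hypVolume d))) atTop (𝓝 0) := by
      simpa using ENNReal.Tendsto.const_mul hzero' (Or.inr ENNReal.ofReal_ne_top)
    refine tendsto_of_tendsto_of_tendsto_of_le_of_le tendsto_const_nhds hup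
      (fun _ => zero_le) fun k => ?_
    refine le_trans ?_ (mul_le_mul_right (hu.lintegral_primitiveOf_sub_le hd hF hFu k)
      (ENNReal.ofReal D))
    rw [← lintegral_const_mul' _ _ ENNReal.ofReal_ne_top]
    refine lintegral_mono fun y => ?_
    rw [← ENNReal.ofReal_mul hD0, ← mul_sub, ← ofReal_norm]
    refine ENNReal.ofReal_le_ofReal ?_
    exact (norm_mul _ _).trans_le (mul_le_mul_of_nonneg_right (hD y) (norm_nonneg _))
  refine tendsto_nhds_unique t1 (t2.congr fun k => ?_)
  obtain ⟨B, hB⟩ := exists_truncF_bound hF k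
  exact (hu.integral_comp_hypDiv (hasDerivAt_primitiveOf (continuous_truncF hF k))
    (continuous_truncF hF k) hB (by simp [primitiveOf]) hY hYc).symm

/-- The contribution of the potential. -/
theorem IsH1.integral_potential (hu : IsH1 u Du) {V : HypChart d → ℝ} (hV : ContDiff ℝ 1 V)
    {Y : HypChart d → HypChart d} (hY : ContDiff ℝ 1 Y) (hYc : HasCompactSupport Y) :
    ∫ y, V y * u y * (⟪Y y, Du y⟫ + 1 / 2 * hypDiv Y y * u y) ∂(hypVolume d) =
      -(1 / 2 * ∫ y, ⟪gradient V y, Y y⟫ * u y ^ 2 ∂(hypVolume d)) := by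
  -- The divergence theorem is applied to V Y, whose divergence is V div Y + ⟨∇V, Y⟩.
  have hVY : ContDiff ℝ 1 fun y => V y • Y y := hV.smul hY
  have hVYc : HasCompactSupport fun y => V y • Y y :=
    hYc.mono' fun y hy => subset_tsupport _ fun h0 => hy (by simp [h0])
  have key := hu.integral_mul_hypDiv hu hVY hVYc
  have hsq := hu.memLp.integrable_sq
  have hgc : Continuous fun y => ⟪gradient V y, Y y⟫ :=
    (contDiff_gradient (m := 0) hV (by norm_num)).continuous.inner hY.continuous
  have hgcs : HasCompactSupport fun y => ⟪gradient V y, Y y⟫ :=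
    hYc.mono' fun y hy => subset_tsupport _ fun h0 => hy (by simp [h0])
  have hdc : Continuous fun y => V y * hypDiv Y y := hV.continuous.mul (continuous_hypDiv hY)
  have hdcs : HasCompactSupport fun y => V y * hypDiv Y y := (hasCompactSupport_hypDiv hYc).mul_left
  obtain ⟨A, -, hA⟩ := exists_bound_of_hasCompactSupport hgc hgcs
  obtain ⟨B, -, hB⟩ := exists_bound_of_hasCompactSupport hdc hdcs
  have i1 : Integrable (fun y => ⟪gradient V y, Y y⟫ * u y ^ 2) (hypVolume d) :=
    hsq.bdd_mul hgc.aestronglyMeasurable (Eventually.of_forall hA)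
  have i2 : Integrable (fun y => V y * hypDiv Y y * u y ^ 2) (hypVolume d) :=
    hsq.bdd_mul hdc.aestronglyMeasurable (Eventually.of_forall hB)
  have i3 : Integrable (fun y => ⟪V y • Y y, Du y⟫ * u y) (hypVolume d) :=
    (memLp_inner_field hVY.continuous hVYc hu.meas hu.memLp_coframe).integrable_mul hu.memLp
  have e1 : ∫ y, hypDiv (fun y => V y • Y y) y * u y * u y ∂(hypVolume d) =
      ∫ y, V y * hypDiv Y y * u y ^ 2 ∂(hypVolume d) +
        ∫ y, ⟪gradient V y, Y y⟫ * u y ^ 2 ∂(hypVolume d) := by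
    rw [← integral_add i2 i1]
    refine integral_congr_ae (Eventually.of_forall fun y => ?_)
    simp only
    rw [hypDiv_smul (hV.differentiable (by norm_num) y) (hY.differentiable (by norm_num) y)]
    ring
  have e2 : ∫ y, u y * ⟪V y • Y y, Du y⟫ ∂(hypVolume d) =
      ∫ y, ⟪V y • Y y, Du y⟫ * u y ∂(hypVolume d) := by simp only [mul_comm]
  have e3 : ∫ y, V y * u y * (⟪Y y, Du y⟫ + 1 / 2 * hypDiv Y y * u y) ∂(hypVolume d) =
      ∫ y, ⟪V y • Y y, Du y⟫ * u y ∂(hypVolume d) +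
        1 / 2 * ∫ y, V y * hypDiv Y y * u y ^ 2 ∂(hypVolume d) := by
    rw [← integral_const_mul, ← integral_add i3 (i2.const_mul _)]
    refine integral_congr_ae (Eventually.of_forall fun y => ?_)
    simp only [inner_smul_left, RCLike.conj_to_real]
    ring
  rw [e1, e2] at key
  rw [e3]
  linarith

/-- The contribution of the nonlinearity. -/
theorem IsH1.integral_nonlinear (hd : 2 ≤ d) (hu : IsH1 u Du) (hF : Continuous F)
    (hFu : MemLp (fun y => F (u y)) 2 (hypVolume d)) {Y : HypChart d → HypChart d}
    (hY : ContDiff ℝ 1 Y) (hYc : HasCompactSupport Y) :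
    ∫ y, F (u y) * (⟪Y y, Du y⟫ + 1 / 2 * hypDiv Y y * u y) ∂(hypVolume d) =
      ∫ y, hypDiv Y y * (1 / 2 * u y * F (u y) - primitiveOf F (u y)) ∂(hypVolume d) := by
  have key := hu.integral_primitiveOf_hypDiv hd hF hFu hY hYc
  have hdc := continuous_hypDiv hY
  obtain ⟨B, -, hB⟩ := exists_bound_of_hasCompactSupport hdc (hasCompactSupport_hypDiv hYc)
  have i1 : Integrable (fun y => F (u y) * ⟪Y y, Du y⟫) (hypVolume d) :=
    hFu.integrable_mul (memLp_inner_field hY.continuous hYc hu.meas hu.memLp_coframe)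
  have i2 : Integrable (fun y => hypDiv Y y * (u y * F (u y))) (hypVolume d) :=
    (hu.memLp.integrable_mul hFu).bdd_mul hdc.aestronglyMeasurable (Eventually.of_forall hB)
  have i3 : Integrable (fun y => hypDiv Y y * primitiveOf F (u y)) (hypVolume d) :=
    (hu.integrable_primitiveOf hd hF hFu).1.bdd_mul hdc.aestronglyMeasurable
      (Eventually.of_forall hB)
  have e1 : ∫ y, F (u y) * (⟪Y y, Du y⟫ + 1 / 2 * hypDiv Y y * u y) ∂(hypVolume d) =
      ∫ y, F (u y) * ⟪Y y, Du y⟫ ∂(hypVolume d) +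
        1 / 2 * ∫ y, hypDiv Y y * (u y * F (u y)) ∂(hypVolume d) := by
    rw [← integral_const_mul, ← integral_add i1 (i2.const_mul _)]
    refine integral_congr_ae (Eventually.of_forall fun y => ?_)
    simp only
    ring
  have e2 : ∫ y, hypDiv Y y * (1 / 2 * u y * F (u y) - primitiveOf F (u y)) ∂(hypVolume d) =
      1 / 2 * ∫ y, hypDiv Y y * (u y * F (u y)) ∂(hypVolume d) -
        ∫ y, hypDiv Y y * primitiveOf F (u y) ∂(hypVolume d) := by
    rw [← integral_const_mul, ← integral_sub (i2.const_mul _) i3]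
    refine integral_congr_ae (Eventually.of_forall fun y => ?_)
    simp only
    ring
  rw [e1, e2, key]; ring

end Nonlinear

/-! ### The difference multiplier -/

/-- A substitute for "zero derivative implies constant": over a fine uniform partition the
increments of D add up to at most ε (P b - P a), with ε arbitrary. It carries the product rule in
time for a pairing whose two factors have only weak derivatives. -/
theorem eq_of_abs_sub_le {D P : ℝ → ℝ} {a b : ℝ} (hab : a ≤ b)
    (h : ∀ ε > 0, ∃ δ > 0, ∀ s ∈ Icc a b, ∀ t ∈ Icc a b, s ≤ t → t - s < δ →
      |D t - D s| ≤ ε * (P t - P s)) : D b = D a := by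
  have key : ∀ ε > 0, |D b - D a| ≤ ε * (P b - P a) := by
    intro ε hε
    obtain ⟨δ, hδ, H⟩ := h ε hε
    obtain ⟨n, hn⟩ := exists_nat_gt ((b - a) / δ)
    have hn0 : (0 : ℝ) < n := lt_of_le_of_lt (by have := sub_nonneg.2 hab; positivity) hn
    let x : ℕ → ℝ := fun k => a + (b - a) * (k / n)
    have hx : ∀ k ≤ n, x k ∈ Icc a b := fun k hk => by
      have h1 : (k : ℝ) / n ≤ 1 := (div_le_one hn0).2 (by exact_mod_cast hk)
      have h2 : (0 : ℝ) ≤ k / n := by positivity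
      constructor <;> simp only [x] <;> nlinarith
    have hs : ∀ k, x (k + 1) - x k = (b - a) / n := fun k => by
      simp only [x]; push_cast; field_simp; ring
    have hk : ∀ k ≤ n, |D (x k) - D (x 0)| ≤ ε * (P (x k) - P (x 0)) := by
      intro k
      induction k with
      | zero => intro _; simp
      | succ k ih =>
        intro hk
        have h1 := ih (by omega)
        have h0 : 0 ≤ (b - a) / n := by have := sub_nonneg.2 hab; positivity
        have h2 := H (x k) (hx k (by omega)) (x (k + 1)) (hx _ hk) (by linarith [hs k]) (by
          rw [hs, div_lt_iff₀ hn0]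
          rw [div_lt_iff₀ hδ] at hn
          linarith)
        have h3 := abs_sub_le (D (x (k + 1))) (D (x k)) (D (x 0))
        linarith
    have h1 := hk n le_rfl
    have e0 : x 0 = a := by simp [x]
    have e1 : x n = b := by simp only [x]; field_simp; ring
    rwa [e0, e1] at h1
  by_contra hne
  have hp : 0 < |D b - D a| := abs_pos.2 (sub_ne_zero.2 hne)
  have h1 := key (|D b - D a| / (2 * (|P b - P a| + 1))) (by positivity)
  have h2 := le_abs_self (P b - P a)
  rw [div_mul_eq_mul_div, le_div_iff₀ (by positivity)] at h1
  nlinarith [abs_nonneg (P b - P a)]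

/-- A continuous map from a compact interval to L² is uniformly continuous and bounded. -/
theorem exists_modulus_lTwo {α G : Type*} [MeasurableSpace α] {μ : Measure α}
    [NormedAddCommGroup G] {f : ℝ → α → G} {a b : ℝ}
    (hf : ∀ t ∈ Icc a b, MemLp (f t) 2 μ) (hc : ∀ t ∈ Icc a b,
      Tendsto (fun s => lTwo μ (fun x => f s x - f t x)) (𝓝[Icc a b] t) (𝓝 0)) :
    (∀ ε > 0, ∃ δ > 0, ∀ s ∈ Icc a b, ∀ t ∈ Icc a b, |s - t| < δ →
      lTwo μ (fun x => f s x - f t x) < ε) ∧ ∃ M, 0 ≤ M ∧ ∀ t ∈ Icc a b, lTwo μ (f t) ≤ M := by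
  let g : Icc a b → Lp G 2 μ := fun t => (hf t t.2).toLp
  have hdist : ∀ s t, dist (g s) (g t) = lTwo μ (fun x => f s x - f t x) := fun s t => by
    rw [dist_eq_norm, ← MemLp.toLp_sub, Lp.norm_toLp]; rfl
  have hg : Continuous g := continuous_iff_continuousAt.2 fun t => by
    rw [ContinuousAt, tendsto_iff_dist_tendsto_zero]
    simp only [hdist]
    exact (hc t t.2).comp (map_nhds_subtype_val t).le
  constructor
  · intro ε hε
    obtain ⟨δ, hδ, H⟩ := Metric.uniformContinuous_iff.1
      (CompactSpace.uniformContinuous_of_continuous hg) ε hε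
    refine ⟨δ, hδ, fun s hs t ht hst => ?_⟩
    have := H (a := ⟨s, hs⟩) (b := ⟨t, ht⟩) (by simpa [Subtype.dist_eq, Real.dist_eq] using hst)
    rwa [hdist] at this
  · obtain ⟨M, hM⟩ := (isCompact_range hg).exists_bound_of_continuousOn (f := id)
      continuousOn_id
    refine ⟨max M 0, le_max_right _ _, fun t ht => ?_⟩
    have := hM (g ⟨t, ht⟩) (mem_range_self _)
    rw [id, Lp.norm_toLp] at this
    exact this.trans (le_max_left _ _)

section MultOp
variable {d : ℕ} {e : HypChart d} {b u w : HypChart d → ℝ} {Du Dw : HypChart d → HypChart d}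

/-- `boostAdj` is the transposed derivative of the boost, so the chain rule for the linear function
⟨ξ, ·⟩ composed with a boost and its inverse replaces a computation. -/
theorem boostAdj_boostAdj_neg (he : ‖e‖ = 1) (s : ℝ) (y ξ : HypChart d) :
    boostAdj e s y (boostAdj e (-s) (boost e s y) ξ) = ξ := by
  have hg : ∀ z : HypChart d, HasGradientAt (fun y : HypChart d => ⟪ξ, y⟫) ξ z := fun z => by
    rw [hasGradientAt_iff_hasFDerivAt]
    exact (innerSL ℝ ξ).hasFDerivAt
  have h1 : gradient (fun y => ⟪ξ, boost e (-s) y⟫) (boost e s y) =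
      boostAdj e (-s) (boost e s y) ξ := by
    rw [gradient_comp_boost (φ := fun y => ⟪ξ, y⟫) _ _ (hg _).differentiableAt, (hg _).gradient]
  rw [← h1, ← gradient_comp_boost (φ := fun y => ⟪ξ, boost e (-s) y⟫)]
  · simp only [boost_neg_boost he]
    exact (hg y).gradient
  · exact ((innerSL ℝ ξ).differentiableAt).comp _
      ((contDiff_boost (n := 1) (-s)).differentiable (by norm_num) _)

/-- The skew-adjoint difference multiplier `(b U_s - U_{-s} b) / 2s`. -/
noncomputable def multOp (b : HypChart d → ℝ) (e : HypChart d) (s : ℝ) (w : HypChart d → ℝ)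
    (y : HypChart d) : ℝ :=
  1 / (2 * s) * (b y * w (boost e s y) - b (boost e (-s) y) * w (boost e (-s) y))

/-- The differential of `multOp b e s w`. -/
noncomputable def multOpGrad (b : HypChart d → ℝ) (e : HypChart d) (s : ℝ) (w : HypChart d → ℝ)
    (Dw : HypChart d → HypChart d) (y : HypChart d) : HypChart d :=
  (1 / (2 * s)) • ((b y • boostAdj e s y (Dw (boost e s y)) + w (boost e s y) • gradient b y) -
    boostAdj e (-s) y (b (boost e (-s) y) • Dw (boost e (-s) y) +
      w (boost e (-s) y) • gradient b (boost e (-s) y)))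

/-- The reason for finite differences: unlike Xu, the result is in H¹ and may be used to test the
equation. -/
theorem IsH1.isH1_multOp (he : ‖e‖ = 1) (hb : IsTestFn b) (s : ℝ) (hu : IsH1 u Du) :
    IsH1 (multOp b e s u) (multOpGrad b e s u Du) :=
  (((hu.comp_boost he s).mul_test hb).sub ((hu.mul_test hb).comp_boost he (-s))).const_mul _

theorem multOp_sub (b : HypChart d → ℝ) (e : HypChart d) (s : ℝ) (u w : HypChart d → ℝ)
    (y : HypChart d) :
    multOp b e s (fun y => u y - w y) y = multOp b e s u y - multOp b e s w y := by
  simp only [multOp]; ring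

theorem multOpGrad_sub (b : HypChart d → ℝ) (e : HypChart d) (s : ℝ) (u w : HypChart d → ℝ)
    (Du Dw : HypChart d → HypChart d) (y : HypChart d) :
    multOpGrad b e s (fun y => u y - w y) (fun y => Du y - Dw y) y =
      multOpGrad b e s u Du y - multOpGrad b e s w Dw y := by
  have e1 : ∀ (c p q : ℝ) (ξ η ζ : HypChart d), c • (ξ - η) + (p - q) • ζ =
      (c • ξ + p • ζ) - (c • η + q • ζ) := fun c p q ξ η ζ => by module
  simp only [multOpGrad, e1, boostAdj_sub]
  module

theorem memLp_multOp (he : ‖e‖ = 1) (hb : IsTestFn b) (s : ℝ) (hw : MemLp w 2 (hypVolume d)) :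
    MemLp (multOp b e s w) 2 (hypVolume d) := by
  have h1 := memLp_bdd_mul hb.1.continuous hb.2 (hw.comp_boost he s)
  have h2 := (memLp_bdd_mul hb.1.continuous hb.2 hw).comp_boost he (-s)
  exact (h1.sub h2).const_mul _

theorem exists_lTwo_multOp_le (he : ‖e‖ = 1) (hb : IsTestFn b) (s : ℝ) :
    ∃ C : ℝ, 0 ≤ C ∧ ∀ w, MemLp w 2 (hypVolume d) →
      lTwo (hypVolume d) (multOp b e s w) ≤ C * lTwo (hypVolume d) w := by
  obtain ⟨B, hB0, hB⟩ := exists_bound_of_hasCompactSupport hb.1.continuous hb.2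
  refine ⟨|1 / (2 * s)| * (B + B), by positivity, fun w hw => ?_⟩
  have h1 := memLp_bdd_mul hb.1.continuous hb.2 (hw.comp_boost he s)
  have h2 := (memLp_bdd_mul hb.1.continuous hb.2 hw).comp_boost he (-s)
  have e1 : lTwo (hypVolume d) (multOp b e s w) = |1 / (2 * s)| * lTwo (hypVolume d) (fun y =>
      b y * w (boost e s y) - b (boost e (-s) y) * w (boost e (-s) y)) :=
    lTwo_smul (1 / (2 * s)) _
  have k1 : lTwo (hypVolume d) (fun y => b y * w (boost e s y)) ≤ B * lTwo (hypVolume d) w := by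
    rw [← lTwo_comp_boost he s hw.1]
    refine lTwo_le_of_norm_le hB0 (hw.comp_boost he s) fun y => ?_
    rw [norm_mul]; exact mul_le_mul_of_nonneg_right (hB y) (norm_nonneg _)
  have k2 : lTwo (hypVolume d) (fun y => b (boost e (-s) y) * w (boost e (-s) y)) ≤
      B * lTwo (hypVolume d) w := by
    rw [← lTwo_comp_boost he (-s) hw.1]
    refine lTwo_le_of_norm_le hB0 (hw.comp_boost he (-s)) fun y => ?_
    rw [norm_mul]; exact mul_le_mul_of_nonneg_right (hB _) (norm_nonneg _)
  rw [e1, mul_assoc]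
  refine mul_le_mul_of_nonneg_left ?_ (abs_nonneg _)
  have := lTwo_sub_le h1 h2
  linarith

theorem lTwo_coframe_boostAdj (he : ‖e‖ = 1) (s : ℝ) {ξ : HypChart d → HypChart d}
    (hm : AEStronglyMeasurable ξ (hypVolume d)) :
    lTwo (hypVolume d) (fun y => coframe y (boostAdj e s y (ξ (boost e s y)))) =
      lTwo (hypVolume d) (fun y => coframe y (ξ y)) := by
  rw [← lTwo_comp_boost he s (aestronglyMeasurable_coframe hm)]
  unfold lTwo
  congr 1
  exact eLpNorm_congr_norm_ae (Eventually.of_forall fun y => norm_coframe_boostAdj he s y _)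

theorem exists_lTwo_mul_test_le (hd : 2 ≤ d) (hb : IsTestFn b) :
    ∃ C : ℝ, 0 ≤ C ∧ ∀ u Du, IsH1 u Du →
      lTwo (hypVolume d) (fun y => coframe y (b y • Du y + u y • gradient b y)) ≤
        C * lTwo (hypVolume d) (fun y => coframe y (Du y)) := by
  obtain ⟨B, hB0, hB⟩ := exists_bound_of_hasCompactSupport hb.1.continuous hb.2
  obtain ⟨B', hB'0, hB'⟩ := exists_bound_of_hasCompactSupport
    (continuous_coframe_comp hb.continuous_gradient)
    (hasCompactSupport_coframe (hasCompactSupport_gradient hb.2))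
  refine ⟨B + B' * 2, by positivity, fun u Du hu => ?_⟩
  have hm1 : AEStronglyMeasurable (fun y => b y • coframe y (Du y)) (hypVolume d) :=
    hb.1.continuous.aestronglyMeasurable.smul hu.memLp_coframe.1
  have hm2 : AEStronglyMeasurable (fun y => u y • coframe y (gradient b y)) (hypVolume d) :=
    hu.memLp.1.smul hb.memLp_coframe.1
  have n1 : ∀ y, ‖b y • coframe y (Du y)‖ ≤ B * ‖coframe y (Du y)‖ := fun y => by
    rw [norm_smul]; exact mul_le_mul_of_nonneg_right (hB y) (norm_nonneg _)
  have n2 : ∀ y, ‖u y • coframe y (gradient b y)‖ ≤ B' * ‖u y‖ := fun y => by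
    rw [norm_smul, mul_comm]; exact mul_le_mul_of_nonneg_right (hB' y) (norm_nonneg _)
  have h1 := lTwo_le_of_norm_le hB0 hu.memLp_coframe n1
  have h2 := lTwo_le_of_norm_le hB'0 hu.memLp n2
  have h3 := lTwo_add_le (hu.memLp_coframe.of_norm_le_mul hm1 n1) (hu.memLp.of_norm_le_mul hm2 n2)
  simp only [coframe_add, coframe_smul]
  have h4 := mul_le_mul_of_nonneg_left (hu.lTwo_le hd) hB'0
  linarith

/-- The constant is allowed to blow up as s → 0; this bound serves at fixed s only. The Poincaré
inequality absorbs the terms where b is differentiated. -/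
theorem exists_lTwo_multOpGrad_le (hd : 2 ≤ d) (he : ‖e‖ = 1) (hb : IsTestFn b) (s : ℝ) :
    ∃ C : ℝ, 0 ≤ C ∧ ∀ u Du, IsH1 u Du →
      lTwo (hypVolume d) (fun y => coframe y (multOpGrad b e s u Du y)) ≤
        C * lTwo (hypVolume d) (fun y => coframe y (Du y)) := by
  obtain ⟨B, hB0, hB⟩ := exists_lTwo_mul_test_le hd hb
  refine ⟨|1 / (2 * s)| * (B + B), by positivity, fun u Du hu => ?_⟩
  have hU := hu.comp_boost he s
  have h1 := hB _ _ hU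
  rw [lTwo_coframe_boostAdj he s hu.meas] at h1
  have hV := hu.mul_test hb
  have h2 := hB _ _ hu
  rw [← lTwo_coframe_boostAdj he (-s) hV.meas] at h2
  have h3 := lTwo_sub_le (hU.mul_test hb).memLp_coframe (hV.comp_boost he (-s)).memLp_coframe
  have e1 : lTwo (hypVolume d) (fun y => coframe y (multOpGrad b e s u Du y)) =
      |1 / (2 * s)| * lTwo (hypVolume d) (fun y =>
        coframe y (b y • boostAdj e s y (Du (boost e s y)) + u (boost e s y) • gradient b y) -
        coframe y (boostAdj e (-s) y (b (boost e (-s) y) • Du (boost e (-s) y) +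
          u (boost e (-s) y) • gradient b (boost e (-s) y)))) := by
    rw [← lTwo_smul]
    simp only [multOpGrad, coframe_smul, coframe_sub]
  rw [e1, mul_assoc]
  exact mul_le_mul_of_nonneg_left (by linarith) (abs_nonneg _)

theorem integral_mul_comp_boost (he : ‖e‖ = 1) (s : ℝ) (f g : HypChart d → ℝ) :
    ∫ y, f (boost e s y) * g y ∂(hypVolume d) = ∫ y, f y * g (boost e (-s) y) ∂(hypVolume d) := by
  rw [← integral_comp_boost he s (fun y => f y * g (boost e (-s) y))]
  simp only [boost_neg_boost he]

theorem integral_multOp (he : ‖e‖ = 1) (hb : IsTestFn b) (s : ℝ) {f : HypChart d → ℝ}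
    (hf : MemLp f 2 (hypVolume d)) (hw : MemLp w 2 (hypVolume d)) :
    ∫ y, f y * multOp b e s w y ∂(hypVolume d) =
      1 / (2 * s) * (∫ y, f y * b y * w (boost e s y) ∂(hypVolume d) -
        ∫ y, f y * (b (boost e (-s) y) * w (boost e (-s) y)) ∂(hypVolume d)) := by
  have h1 : Integrable (fun y => f y * (b y * w (boost e s y))) (hypVolume d) :=
    hf.integrable_mul (memLp_bdd_mul hb.1.continuous hb.2 (hw.comp_boost he s))
  have h2 : Integrable (fun y => f y * (b (boost e (-s) y) * w (boost e (-s) y)))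
      (hypVolume d) :=
    hf.integrable_mul ((memLp_bdd_mul hb.1.continuous hb.2 hw).comp_boost he (-s))
  have e0 : ∫ y, f y * b y * w (boost e s y) ∂(hypVolume d) =
      ∫ y, f y * (b y * w (boost e s y)) ∂(hypVolume d) := by simp only [mul_assoc]
  rw [e0, ← integral_sub h1 h2, ← integral_const_mul]
  refine integral_congr_ae (Eventually.of_forall fun y => ?_)
  simp only [multOp]; ring

/-- Boosts preserve the volume, so the adjoint of b U_s is U_{-s} b, where U_s is composition with
the boost. -/
theorem integral_multOp_skew (he : ‖e‖ = 1) (hb : IsTestFn b) (s : ℝ) {f : HypChart d → ℝ}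
    (hf : MemLp f 2 (hypVolume d)) (hw : MemLp w 2 (hypVolume d)) :
    ∫ y, f y * multOp b e s w y ∂(hypVolume d) = -∫ y, w y * multOp b e s f y ∂(hypVolume d) := by
  rw [integral_multOp he hb s hf hw, integral_multOp he hb s hw hf]
  have h1 : ∀ p q : HypChart d → ℝ, ∫ y, p y * b y * q (boost e s y) ∂(hypVolume d) =
      ∫ y, q y * (b (boost e (-s) y) * p (boost e (-s) y)) ∂(hypVolume d) := fun p q => by
    have := integral_mul_comp_boost he s q (fun y => b y * p y)
    rw [← this]
    refine integral_congr_ae (Eventually.of_forall fun y => ?_)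
    simp only; ring
  rw [h1 f w, h1 w f]
  ring

/-- The derivative of `u` along the boost commutes with the Dirichlet form, up to derivatives
of `b`. -/
theorem IsH1.dirichlet_multOpGrad (he : ‖e‖ = 1) (hb : IsTestFn b) {s : ℝ} (hs : s ≠ 0)
    (hu : IsH1 u Du) :
    dirichlet Du (multOpGrad b e s u Du) =
      (∫ y, (⟪hypGrad b y, Du y⟫ + 1 / 2 * hypDiv (hypGrad b) y * u y) * u (boost e s y)
          ∂(hypVolume d) -
        ∫ y, (⟪hypGrad b y, Du y⟫ + 1 / 2 * hypDiv (hypGrad b) y * u y) * u y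
          ∂(hypVolume d)) / s := by
  have hU := hu.comp_boost he s
  have hY := hb.contDiff_hypGrad
  have hYc := hb.hasCompactSupport_hypGrad
  have k1 := hu.integral_mul_hypDiv hU hY hYc
  -- With both factors equal to u this says that the subtracted integral in the statement is 0; it
  -- is there only to display a difference quotient.
  have k2 := hu.integral_mul_hypDiv hu hY hYc
  have hP := memLp_inner_field hY.continuous hYc hu.meas hu.memLp_coframe
  have hPU := memLp_inner_field hY.continuous hYc hU.meas hU.memLp_coframe
  have hQ := memLp_bdd_mul (continuous_hypDiv hY) (hasCompactSupport_hypDiv hYc) hu.memLp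
  have hexp : ∀ {v : HypChart d → ℝ}, MemLp v 2 (hypVolume d) →
      ∫ y, (⟪hypGrad b y, Du y⟫ + 1 / 2 * hypDiv (hypGrad b) y * u y) * v y ∂(hypVolume d) =
        ∫ y, ⟪hypGrad b y, Du y⟫ * v y ∂(hypVolume d) +
          1 / 2 * ∫ y, hypDiv (hypGrad b) y * u y * v y ∂(hypVolume d) := fun {v} hv => by
    have i1 : Integrable (fun y => ⟪hypGrad b y, Du y⟫ * v y) (hypVolume d) := hP.integrable_mul hv
    have i2 : Integrable (fun y => hypDiv (hypGrad b) y * u y * v y) (hypVolume d) :=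
      hQ.integrable_mul hv
    rw [← integral_const_mul, ← integral_add i1 (i2.const_mul _)]
    refine integral_congr_ae (Eventually.of_forall fun y => ?_)
    simp only; ring
  rw [hexp hU.memLp, hexp hu.memLp]
  have hA := hU.mul_test hb
  have hB := hu.mul_test hb
  have hB' := hB.comp_boost he (-s)
  have e1 : dirichlet Du (multOpGrad b e s u Du) = 1 / (2 * s) * (
      dirichlet Du (fun y => b y • boostAdj e s y (Du (boost e s y)) +
        u (boost e s y) • gradient b y) -
      dirichlet Du (fun y => boostAdj e (-s) y (b (boost e (-s) y) • Du (boost e (-s) y) +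
        u (boost e (-s) y) • gradient b (boost e (-s) y)))) := by
    unfold dirichlet
    rw [← integral_sub (integrable_hypCoMetric hu.memLp_coframe hA.memLp_coframe)
      (integrable_hypCoMetric hu.memLp_coframe hB'.memLp_coframe), ← integral_const_mul]
    refine integral_congr_ae (Eventually.of_forall fun y => ?_)
    simp only [multOpGrad, hypCoMetric, inner_smul_right, inner_sub_right]
    ring
  -- Invariance of the Dirichlet form moves U_{-s} to the other argument, where it becomes U_s.
  have e2 : dirichlet Du (fun y => boostAdj e (-s) y (b (boost e (-s) y) • Du (boost e (-s) y) +
        u (boost e (-s) y) • gradient b (boost e (-s) y))) =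
      dirichlet (fun y => boostAdj e s y (Du (boost e s y)))
        (fun y => b y • Du y + u y • gradient b y) := by
    rw [← dirichlet_boost he s]
    simp only [boost_neg_boost he, boostAdj_boostAdj_neg he]
  -- The two terms b ⟨∇u, ∇U_s u⟩ cancel. What remains contains ∇b, and `k1` moves the derivative
  -- off U_s u.
  have e3 : dirichlet Du (fun y => b y • boostAdj e s y (Du (boost e s y)) +
        u (boost e s y) • gradient b y) -
      dirichlet (fun y => boostAdj e s y (Du (boost e s y)))
        (fun y => b y • Du y + u y • gradient b y) =
      ∫ y, ⟪hypGrad b y, Du y⟫ * u (boost e s y) ∂(hypVolume d) -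
      ∫ y, u y * ⟪hypGrad b y, boostAdj e s y (Du (boost e s y))⟫ ∂(hypVolume d) := by
    have i1 : Integrable (fun y => ⟪hypGrad b y, Du y⟫ * u (boost e s y)) (hypVolume d) :=
      hP.integrable_mul hU.memLp
    have i2 : Integrable (fun y => u y * ⟪hypGrad b y, boostAdj e s y (Du (boost e s y))⟫)
      (hypVolume d) := hu.memLp.integrable_mul hPU
    unfold dirichlet
    rw [← integral_sub i1 i2, ← integral_sub
      (integrable_hypCoMetric hu.memLp_coframe hA.memLp_coframe)
      (integrable_hypCoMetric hU.memLp_coframe hB.memLp_coframe)]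
    refine integral_congr_ae (Eventually.of_forall fun y => ?_)
    simp only [inner_hypGrad]
    simp only [hypCoMetric, inner_add_right, inner_smul_right,
      real_inner_comm (gradient b y) (Du y),
      real_inner_comm (gradient b y) (boostAdj e s y (Du (boost e s y))),
      real_inner_comm (Du y) (boostAdj e s y (Du (boost e s y)))]
    ring
  have e4 : ∫ y, u y * ⟪hypGrad b y, Du y⟫ ∂(hypVolume d) =
      ∫ y, ⟪hypGrad b y, Du y⟫ * u y ∂(hypVolume d) := by simp only [mul_comm]
  rw [e1, e2, e3]
  rw [e4] at k2
  generalize ∫ y, ⟪hypGrad b y, Du y⟫ * u y ∂(hypVolume d) = T at *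
  generalize ∫ y, ⟪hypGrad b y, Du y⟫ * u (boost e s y) ∂(hypVolume d) = P at *
  generalize ∫ y, u y * ⟪hypGrad b y, boostAdj e s y (Du (boost e s y))⟫ ∂(hypVolume d) = Q at *
  generalize ∫ y, hypDiv (hypGrad b) y * u y * u (boost e s y) ∂(hypVolume d) = S at *
  generalize ∫ y, hypDiv (hypGrad b) y * u y * u y ∂(hypVolume d) = S' at *
  field_simp
  linarith

/-- The limit of `multOp b e s u` as `s → 0`. -/
noncomputable def multLim (b : HypChart d → ℝ) (e : HypChart d) (u : HypChart d → ℝ)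
    (Du : HypChart d → HypChart d) (y : HypChart d) : ℝ :=
  b y * (height y * ⟪e, Du y⟫) + 1 / 2 * (height y * ⟪e, gradient b y⟫) * u y

theorem IsTestFn.exists_support (hb : IsTestFn b) :
    ∃ R : ℝ, 0 ≤ R ∧ ∀ y, R < ‖y‖ → b y = 0 := by
  obtain ⟨R, hR⟩ := hb.2.isCompact.isBounded.subset_closedBall (0 : HypChart d)
  refine ⟨max R 0, le_max_right _ _, fun y hy => ?_⟩
  by_contra h
  have := hR (subset_tsupport _ h)
  rw [mem_closedBall_zero_iff] at this
  exact absurd (this.trans (le_max_left _ _)) (not_le.2 hy)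

theorem boost_support (he : ‖e‖ = 1) {R : ℝ} (hR : ∀ y, R < ‖y‖ → b y = 0) {s : ℝ} (hs : |s| ≤ 1)
    {y : HypChart d} (hy : 3 * (1 + R) < ‖y‖) : b (boost e s y) = 0 := by
  refine hR _ (not_le.1 fun h => ?_)
  have h1 := height_boost_le he (s := -s) (by rwa [abs_neg]) (boost e s y)
  rw [boost_neg_boost he] at h1
  have := height_le (boost e s y)
  linarith [norm_le_height y]

theorem memLp_trunc {f : HypChart d → ℝ} (hf : MemLp f 2 (hypVolume d)) (R : ℝ) :
    MemLp ((Metric.closedBall 0 R).indicator f) 2 (hypVolume d) ∧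
      lTwo (hypVolume d) ((Metric.closedBall 0 R).indicator f) ≤ lTwo (hypVolume d) f ∧
      ∀ y, R < ‖y‖ → (Metric.closedBall 0 R).indicator f y = 0 := by
  refine ⟨hf.indicator Metric.isClosed_closedBall.measurableSet, ?_, fun y hy => ?_⟩
  · have := lTwo_le_of_norm_le (f := (Metric.closedBall 0 R).indicator f) zero_le_one hf
      fun y => by rw [one_mul]; exact norm_indicator_le_norm_self _ _
    linarith
  · exact indicator_of_notMem (by simpa using hy) _

/-- Adding and subtracting f b w produces two difference quotients, at s and at -s. The Lipschitz
bound needs a weight of bounded support, which f lacks; since b composed with the boost by -s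
vanishes beyond radius 3(1+R), f may be truncated there. -/
theorem integral_multOp_eq (he : ‖e‖ = 1) (hb : IsTestFn b) {R : ℝ}
    (hR : ∀ y, R < ‖y‖ → b y = 0) {s : ℝ} (hs0 : s ≠ 0) (hs : |s| ≤ 1) (hR0 : 0 ≤ R)
    {f : HypChart d → ℝ} (hf : MemLp f 2 (hypVolume d)) (hw : MemLp w 2 (hypVolume d)) :
    ∫ y, f y * multOp b e s w y ∂(hypVolume d) = 1 / 2 * (
      (∫ y, f y * b y * w (boost e s y) ∂(hypVolume d) -
        ∫ y, f y * b y * w y ∂(hypVolume d)) / s +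
      (∫ y, (Metric.closedBall 0 (3 * (1 + R))).indicator f y *
          (b (boost e (-s) y) * w (boost e (-s) y)) ∂(hypVolume d) -
        ∫ y, (Metric.closedBall 0 (3 * (1 + R))).indicator f y * (b y * w y)
          ∂(hypVolume d)) / (-s)) := by
  have hi : ∀ (p q : HypChart d → ℝ), (∀ y, 3 * (1 + R) < ‖y‖ → p y = 0) →
      ∫ y, (Metric.closedBall 0 (3 * (1 + R))).indicator f y * (p y * q y) ∂(hypVolume d) =
        ∫ y, f y * (p y * q y) ∂(hypVolume d) := fun p q hp => by
    refine integral_congr_ae (Eventually.of_forall fun y => ?_)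
    by_cases hy : y ∈ Metric.closedBall (0 : HypChart d) (3 * (1 + R))
    · simp only [indicator_of_mem hy]
    · have := hp y (by simpa using hy)
      simp [this]
  rw [integral_multOp he hb s hf hw,
    hi (fun y => b (boost e (-s) y)) (fun y => w (boost e (-s) y))
      fun y hy => boost_support he hR (by rwa [abs_neg]) hy,
    hi b w fun y hy => hR y (by linarith)]
  have e0 : ∫ y, f y * b y * w y ∂(hypVolume d) =
      ∫ y, f y * (b y * w y) ∂(hypVolume d) := by simp only [mul_assoc]
  rw [e0]
  field_simp
  ring

theorem memLp_mul_test (hb : IsTestFn b) {f : HypChart d → ℝ} (hf : MemLp f 2 (hypVolume d)) :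
    MemLp (fun y => f y * b y) 2 (hypVolume d) := by
  simp only [mul_comm _ (b _)]
  exact memLp_bdd_mul hb.1.continuous hb.2 hf

/-- Unlike `exists_lTwo_multOp_le`, uniform in 0 < |s| ≤ 1, at the price of a gradient norm. It
dominates the limit s → 0 under the time integral. -/
theorem exists_integral_multOp_le (hd : 2 ≤ d) (he : ‖e‖ = 1) (hb : IsTestFn b) :
    ∃ C : ℝ, 0 ≤ C ∧ ∀ u Du f s, IsH1 u Du → MemLp f 2 (hypVolume d) → s ≠ 0 → |s| ≤ 1 →
      |∫ y, f y * multOp b e s u y ∂(hypVolume d)| ≤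
        C * lTwo (hypVolume d) f * lTwo (hypVolume d) (fun y => coframe y (Du y)) := by
  obtain ⟨R, hR0, hR⟩ := hb.exists_support
  obtain ⟨B, hB0, hB⟩ := exists_bound_of_hasCompactSupport hb.1.continuous hb.2
  obtain ⟨B', hB'0, hB'⟩ := exists_lTwo_mul_test_le hd hb
  refine ⟨3 * (1 + R) * B + 3 * (1 + 3 * (1 + R)) * B', by positivity,
    fun u Du f s hu hf hs0 hs => ?_⟩
  rw [integral_multOp_eq he hb hR hs0 hs hR0 hf hu.memLp]
  obtain ⟨t1, t2, t3⟩ := memLp_trunc hf (3 * (1 + R))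
  have h1 := hu.abs_boost_sub_le he hR0 (memLp_mul_test hb hf)
    (fun y hy => by rw [hR y hy, mul_zero]) hs
  have h2 := (hu.mul_test hb).abs_boost_sub_le he (by positivity) t1 t3 (s := -s)
    (by rwa [abs_neg])
  have k1 : lTwo (hypVolume d) (fun y => f y * b y) ≤ B * lTwo (hypVolume d) f :=
    lTwo_le_of_norm_le hB0 hf fun y => by
      rw [norm_mul, mul_comm]; exact mul_le_mul_of_nonneg_right (hB y) (norm_nonneg _)
  have k2 := hB' u Du hu
  have hsp : 0 < |s| := abs_pos.2 hs0
  set N := lTwo (hypVolume d) (fun y => coframe y (Du y))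
  set Nf := lTwo (hypVolume d) f
  have hN : 0 ≤ N := lTwo_nonneg _
  have hNf : 0 ≤ Nf := lTwo_nonneg _
  rw [← div_le_iff₀ hsp, ← abs_div] at h1
  rw [← div_le_iff₀ (by rwa [abs_neg]), ← abs_div] at h2
  have q1 : 3 * (1 + R) * lTwo (hypVolume d) (fun y => f y * b y) * N ≤
      3 * (1 + R) * (B * Nf) * N := by gcongr
  have q2 : 3 * (1 + 3 * (1 + R)) * lTwo (hypVolume d)
      ((Metric.closedBall 0 (3 * (1 + R))).indicator f) *
      lTwo (hypVolume d) (fun y => coframe y (b y • Du y + u y • gradient b y)) ≤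
      3 * (1 + 3 * (1 + R)) * Nf * (B' * N) := by
    have := lTwo_nonneg (μ := hypVolume d) (fun y => coframe y (b y • Du y + u y • gradient b y))
    gcongr
  have h3 := (h1.trans q1)
  have h4 := (h2.trans q2)
  rw [abs_mul, abs_of_pos (by norm_num : (0 : ℝ) < 1 / 2)]
  have h5 := abs_add_le ((∫ y, f y * b y * u (boost e s y) ∂(hypVolume d) -
        ∫ y, f y * b y * u y ∂(hypVolume d)) / s)
      ((∫ y, (Metric.closedBall 0 (3 * (1 + R))).indicator f y *
          (b (boost e (-s) y) * u (boost e (-s) y)) ∂(hypVolume d) -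
        ∫ y, (Metric.closedBall 0 (3 * (1 + R))).indicator f y * (b y * u y)
          ∂(hypVolume d)) / (-s))
  have h6 : 0 ≤ 3 * (1 + R) * (B * Nf) * N + 3 * (1 + 3 * (1 + R)) * Nf * (B' * N) := by positivity
  linarith

/-- With K the derivative along the Killing field, the two quotients of `integral_multOp_eq`
converge to b Ku and K(bu), and `multLim` is half their sum. -/
theorem IsH1.tendsto_integral_multOp (he : ‖e‖ = 1) (hb : IsTestFn b) (hu : IsH1 u Du)
    {f : HypChart d → ℝ} (hf : MemLp f 2 (hypVolume d)) :
    Tendsto (fun s => ∫ y, f y * multOp b e s u y ∂(hypVolume d)) (𝓝[≠] 0)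
      (𝓝 (∫ y, f y * multLim b e u Du y ∂(hypVolume d))) := by
  obtain ⟨R, hR0, hR⟩ := hb.exists_support
  obtain ⟨t1, t2, t3⟩ := memLp_trunc hf (3 * (1 + R))
  have hfb := memLp_mul_test hb hf
  have hfbR : ∀ y, R < ‖y‖ → f y * b y = 0 := fun y hy => by rw [hR y hy, mul_zero]
  have h1 := hu.tendsto_boost he hR0 hfb hfbR
  have hneg : Tendsto (fun s : ℝ => -s) (𝓝[≠] 0) (𝓝[≠] 0) := by
    refine tendsto_nhdsWithin_iff.2 ⟨?_, ?_⟩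
    · have : Tendsto (fun s : ℝ => -s) (𝓝 0) (𝓝 (-0)) := tendsto_neg 0
      rw [neg_zero] at this
      exact this.mono_left nhdsWithin_le_nhds
    · filter_upwards [self_mem_nhdsWithin] with s hs
      simpa using hs
  have h2 := ((hu.mul_test hb).tendsto_boost he (by positivity) t1 t3).comp hneg
  have h3 := (h1.add h2).const_mul (1 / 2)
  have hlim : 1 / 2 * (∫ y, f y * b y * (height y * ⟪e, Du y⟫) ∂(hypVolume d) +
      ∫ y, (Metric.closedBall 0 (3 * (1 + R))).indicator f y *
        (height y * ⟪e, b y • Du y + u y • gradient b y⟫) ∂(hypVolume d)) =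
      ∫ y, f y * multLim b e u Du y ∂(hypVolume d) := by
    have i1 : Integrable (fun y => f y * b y * (height y * ⟪e, Du y⟫)) (hypVolume d) := by
      have m1 := memLp_height_inner_of_support hfb hfbR
      have m2 := m1.norm.integrable_mul hu.memLp_coframe.norm
      refine m2.mono' ?_ (Eventually.of_forall fun y => ?_)
      · exact hfb.1.mul ((contDiff_height (n := 0)).continuous.aestronglyMeasurable.mul
          (aestronglyMeasurable_const.inner hu.meas))
      · have := norm_height_inner_le he y (Du y)
        rw [norm_mul]
        calc _ ≤ ‖f y * b y‖ * (height y * ‖coframe y (Du y)‖) :=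
              mul_le_mul_of_nonneg_left this (norm_nonneg _)
          _ = _ := by
              simp only [Pi.mul_apply]
              rw [norm_mul (f y * b y) (height y), Real.norm_of_nonneg (height_pos y).le]; ring
    have hv := hu.mul_test hb
    have i2 : Integrable (fun y => (Metric.closedBall 0 (3 * (1 + R))).indicator f y *
        (height y * ⟪e, b y • Du y + u y • gradient b y⟫)) (hypVolume d) := by
      have m1 := memLp_height_inner_of_support t1 t3
      have m2 := m1.norm.integrable_mul hv.memLp_coframe.norm
      refine m2.mono' ?_ (Eventually.of_forall fun y => ?_)
      · exact t1.1.mul ((contDiff_height (n := 0)).continuous.aestronglyMeasurable.mul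
          (aestronglyMeasurable_const.inner hv.meas))
      · have := norm_height_inner_le he y (b y • Du y + u y • gradient b y)
        rw [norm_mul]
        calc _ ≤ ‖(Metric.closedBall 0 (3 * (1 + R))).indicator f y‖ *
              (height y * ‖coframe y (b y • Du y + u y • gradient b y)‖) :=
              mul_le_mul_of_nonneg_left this (norm_nonneg _)
          _ = _ := by
              simp only [Pi.mul_apply]
              rw [norm_mul _ (height y), Real.norm_of_nonneg (height_pos y).le]; ring
    rw [← integral_add i1 i2, ← integral_const_mul]
    refine integral_congr_ae (Eventually.of_forall fun y => ?_)
    simp only [multLim, inner_add_right, inner_smul_right]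
    by_cases hy : y ∈ Metric.closedBall (0 : HypChart d) (3 * (1 + R))
    · rw [indicator_of_mem hy]; ring
    · have hyR : 3 * (1 + R) < ‖y‖ := by simpa using hy
      have hb0 : b y = 0 := hR y (by linarith)
      have hg0 : gradient b y = 0 := by
        have : b =ᶠ[𝓝 y] fun _ => 0 := by
          have : ∀ᶠ z in 𝓝 y, R < ‖z‖ := continuous_norm.continuousAt.eventually
            (lt_mem_nhds (by linarith))
          filter_upwards [this] with z hz using hR z hz
        rw [this.gradient_eq]; simp
      rw [indicator_of_notMem hy, hb0, hg0]; simp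
  rw [hlim] at h3
  refine h3.congr' ?_
  have hsmall : ∀ᶠ s : ℝ in 𝓝[≠] 0, |s| ≤ 1 := by
    refine nhdsWithin_le_nhds ?_
    have : ∀ᶠ s : ℝ in 𝓝 0, |s| < 1 := by
      have := (continuous_abs (G := ℝ)).continuousAt (x := 0)
      exact this.eventually (gt_mem_nhds (by simp))
    exact this.mono fun _ h => h.le
  filter_upwards [hsmall, self_mem_nhdsWithin] with s hs hs0
  rw [integral_multOp_eq he hb hR hs0 hs hR0 hf hu.memLp]
  rfl

end MultOp

/-! ### Solutions on a compact time interval -/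

section Limits
variable {d : ℕ} {v w : HypChart d → ℝ} {ξ Dv : HypChart d → HypChart d}

theorem tendsto_integral_mul_right {φ : ℕ → HypChart d → ℝ} (hw : MemLp w 2 (hypVolume d))
    (hφ : ∀ n, MemLp (φ n) 2 (hypVolume d)) (hv : MemLp v 2 (hypVolume d))
    (h : Tendsto (fun n => lTwo (hypVolume d) (fun y => φ n y - v y)) atTop (𝓝 0)) :
    Tendsto (fun n => ∫ y, w y * φ n y ∂(hypVolume d)) atTop
      (𝓝 (∫ y, w y * v y ∂(hypVolume d))) :=
  tendsto_integral_mul (fun _ => hw) hφ hw hv (by simp [lTwo]) h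

theorem tendsto_dirichlet {η : ℕ → HypChart d → HypChart d}
    (hξ : MemLp (fun y => coframe y (ξ y)) 2 (hypVolume d))
    (hη : ∀ n, MemLp (fun y => coframe y (η n y)) 2 (hypVolume d))
    (hD : MemLp (fun y => coframe y (Dv y)) 2 (hypVolume d))
    (h : Tendsto (fun n => lTwo (hypVolume d)
      (fun y => coframe y (η n y) - coframe y (Dv y))) atTop (𝓝 0)) :
    Tendsto (fun n => dirichlet ξ (η n)) atTop (𝓝 (dirichlet ξ Dv)) := by
  have := tendsto_integral_inner (fun _ : ℕ => hξ) hη hξ hD (by simp [lTwo]) h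
  simp only [inner_coframe] at this
  exact this

theorem eventually_lTwo_le {α G : Type*} [MeasurableSpace α] {μ : Measure α}
    [NormedAddCommGroup G] {φ : ℕ → α → G} {v : α → G} (hφ : ∀ n, MemLp (φ n) 2 μ)
    (hv : MemLp v 2 μ) (h : Tendsto (fun n => lTwo μ (fun y => φ n y - v y)) atTop (𝓝 0)) :
    ∀ᶠ n in atTop, lTwo μ (φ n) ≤ lTwo μ v + 1 := by
  filter_upwards [h.eventually (gt_mem_nhds one_pos)] with n hn
  have := lTwo_add_le ((hφ n).sub hv) hv
  simp only [Pi.sub_apply, sub_add_cancel] at this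
  have e : lTwo μ (φ n - v) = lTwo μ (fun y => φ n y - v y) := rfl
  linarith

theorem MeasureTheory.MemLp.exists_testFn (hv : MemLp v 2 (hypVolume d)) :
    ∃ φ : ℕ → HypChart d → ℝ, (∀ n, IsTestFn (φ n)) ∧
      Tendsto (fun n => lTwo (hypVolume d) (fun y => φ n y - v y)) atTop (𝓝 0) := by
  have hε : ∀ n : ℕ, (0 : ℝ) < 1 / ((n : ℝ) + 1) := fun n => by positivity
  choose φ h1 h2 h3 using fun n : ℕ =>
    hv.exist_eLpNorm_sub_le (by norm_num) (by norm_num) (hε n)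
  refine ⟨φ, fun n => ⟨h2 n, h1 n⟩, ?_⟩
  refine squeeze_zero (fun _ => lTwo_nonneg _) (fun n => ?_)
    (tendsto_one_div_add_atTop_nhds_zero_nat (𝕜 := ℝ))
  rw [lTwo_sub_comm]
  exact ENNReal.toReal_le_of_le_ofReal (hε n).le (h3 n)

end Limits

/-- The lower-order terms `V u + F(u)` of the equation. -/
def forcing {d : ℕ} (V : HypChart d → ℝ) (F : ℝ → ℝ) (u : ℝ → HypChart d → ℝ) (t : ℝ)
    (y : HypChart d) : ℝ := V y * u t y + F (u t y)

/-! ### Testing the equation with H¹ and L² functions, and the multiplier identities -/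

section Solution
variable {d : ℕ} {V : HypChart d → ℝ} {F : ℝ → ℝ} {u ut : ℝ → HypChart d → ℝ}
  {Du : ℝ → HypChart d → HypChart d} {a c : ℝ}

theorem IsEnergySolution.mono {J I : Set ℝ} (h : IsEnergySolution V F J u Du ut) (hI : I ⊆ J) :
    IsEnergySolution V F I u Du ut := by
  have hμ : (volume.restrict I).prod (hypVolume d) ≤ (volume.restrict J).prod (hypVolume d) :=
    Measure.prod_mono (Measure.restrict_mono hI le_rfl) le_rfl
  exact ⟨h.meas_u.mono_measure hμ, h.meas_Du.mono_measure hμ, h.meas_ut.mono_measure hμ,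
    fun t ht => h.mem_H1 t (hI ht), fun t ht => h.mem_L2 t (hI ht),
    fun t ht => (h.continuous t (hI ht)).mono_left (nhdsWithin_mono t hI),
    fun t ht s hs => h.nonlin t (hI ht) s (hI hs),
    fun ψ hψ t ht s hs => h.eq_dt ψ hψ t (hI ht) s (hI hs),
    fun ψ hψ t ht s hs => h.eq_wave ψ hψ t (hI ht) s (hI hs)⟩

theorem energyNormSq_eq {ξ : HypChart d → HypChart d} {g : HypChart d → ℝ}
    (hξ : MemLp (fun y => coframe y (ξ y)) 2 (hypVolume d)) (hg : MemLp g 2 (hypVolume d)) :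
    energyNormSq ξ g = ENNReal.ofReal (lTwo (hypVolume d) (fun y => coframe y (ξ y)) ^ 2 +
      lTwo (hypVolume d) g ^ 2) := by
  rw [energyNormSq, covecL2_eq, ENNReal.ofReal_add (sq_nonneg _) (sq_nonneg _),
    ENNReal.ofReal_pow (lTwo_nonneg _), ENNReal.ofReal_pow (lTwo_nonneg _), lTwo, lTwo,
    ENNReal.ofReal_toReal hξ.2.ne, ENNReal.ofReal_toReal hg.2.ne]

theorem IsEnergySolution.tendsto_lTwo {J : Set ℝ} (h : IsEnergySolution V F J u Du ut) {t : ℝ}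
    (ht : t ∈ J) :
    Tendsto (fun s => lTwo (hypVolume d) (fun y => coframe y (Du s y) - coframe y (Du t y)))
      (𝓝[J] t) (𝓝 0) ∧
    Tendsto (fun s => lTwo (hypVolume d) (fun y => ut s y - ut t y)) (𝓝[J] t) (𝓝 0) := by
  have h1 := (ENNReal.tendsto_toReal ENNReal.zero_ne_top).comp (h.continuous t ht)
  have h2 := (Real.continuous_sqrt.tendsto 0).comp h1
  rw [Real.sqrt_zero] at h2
  have key : ∀ s ∈ J,
      (energyNormSq (fun y => Du s y - Du t y) (fun y => ut s y - ut t y)).toReal =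
      lTwo (hypVolume d) (fun y => coframe y (Du s y) - coframe y (Du t y)) ^ 2 +
        lTwo (hypVolume d) (fun y => ut s y - ut t y) ^ 2 := fun s hs => by
    rw [energyNormSq_eq (g := fun y => ut s y - ut t y)
      ((h.mem_H1 s hs).sub (h.mem_H1 t ht)).memLp_coframe
      ((h.mem_L2 s hs).sub (h.mem_L2 t ht)), ENNReal.toReal_ofReal (by positivity)]
    simp only [coframe_sub]
  constructor
  · refine squeeze_zero' (Eventually.of_forall fun _ => lTwo_nonneg _) ?_ h2
    filter_upwards [self_mem_nhdsWithin] with s hs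
    refine Real.le_sqrt_of_sq_le ?_
    simp only [Function.comp_apply]
    rw [key s hs]; nlinarith [sq_nonneg (lTwo (hypVolume d) (fun y => ut s y - ut t y))]
  · refine squeeze_zero' (Eventually.of_forall fun _ => lTwo_nonneg _) ?_ h2
    filter_upwards [self_mem_nhdsWithin] with s hs
    refine Real.le_sqrt_of_sq_le ?_
    simp only [Function.comp_apply]
    rw [key s hs]
    nlinarith [sq_nonneg (lTwo (hypVolume d)
      (fun y => coframe y (Du s y) - coframe y (Du t y)))]

theorem IsEnergySolution.meas_coframe {J : Set ℝ} (h : IsEnergySolution V F J u Du ut) :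
    AEStronglyMeasurable (fun p : ℝ × HypChart d => coframe p.2 (Du p.1 p.2))
      ((volume.restrict J).prod (hypVolume d)) :=
  continuous_coframe.comp_aestronglyMeasurable
    (continuous_snd.aestronglyMeasurable.prodMk h.meas_Du)

theorem IsEnergySolution.meas_nonlin {J : Set ℝ} (h : IsEnergySolution V F J u Du ut)
    (hF : Continuous F) : AEStronglyMeasurable (fun p : ℝ × HypChart d => F (u p.1 p.2))
      ((volume.restrict J).prod (hypVolume d)) :=
  hF.comp_aestronglyMeasurable h.meas_u

theorem IsEnergySolution.meas_forcing {J : Set ℝ} (h : IsEnergySolution V F J u Du ut)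
    (hV : Continuous V) (hF : Continuous F) :
    AEStronglyMeasurable (fun p : ℝ × HypChart d => forcing V F u p.1 p.2)
      ((volume.restrict J).prod (hypVolume d)) :=
  ((hV.comp continuous_snd).aestronglyMeasurable.mul h.meas_u).add (h.meas_nonlin hF)

/-- The dominating data for the limits under the time integral: M comes from continuity on a compact
interval and the Poincaré inequality, p from F(u) ∈ L¹_t L². The last group of statements holds for
a.e. t only, as F(u(t)) is in L² for a.e. t only. -/
theorem IsEnergySolution.exists_bound (hd : 2 ≤ d) (hac : a ≤ c)
    (h : IsEnergySolution V F (Icc a c) u Du ut) (hV : Continuous V) {B : ℝ}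
    (hB : ∀ y, |V y| ≤ B) (hF : Continuous F) :
    ∃ (M : ℝ) (p : ℝ → ℝ), 0 ≤ M ∧ Integrable p (volume.restrict (Icc a c)) ∧ (∀ t, 0 ≤ p t) ∧
      (∀ t ∈ Icc a c, lTwo (hypVolume d) (fun y => coframe y (Du t y)) ≤ M ∧
        lTwo (hypVolume d) (ut t) ≤ M ∧ lTwo (hypVolume d) (u t) ≤ M) ∧
      ∀ᵐ t ∂(volume.restrict (Icc a c)), t ∈ Icc a c ∧
        MemLp (fun y => F (u t y)) 2 (hypVolume d) ∧
        MemLp (forcing V F u t) 2 (hypVolume d) ∧ lTwo (hypVolume d) (fun y => F (u t y)) ≤ p t ∧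
        lTwo (hypVolume d) (forcing V F u t) ≤ p t := by
  obtain ⟨-, M₁, hM₁0, hM₁⟩ := exists_modulus_lTwo
    (f := fun t y => coframe y (Du t y)) (fun t ht => (h.mem_H1 t ht).memLp_coframe)
    fun t ht => (h.tendsto_lTwo ht).1
  obtain ⟨-, M₂, hM₂0, hM₂⟩ := exists_modulus_lTwo (f := ut) h.mem_L2
    fun t ht => (h.tendsto_lTwo ht).2
  have hB0 : 0 ≤ B := (abs_nonneg _).trans (hB 0)
  have hM₃ : ∀ t ∈ Icc a c, lTwo (hypVolume d) (u t) ≤ 2 * M₁ := fun t ht =>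
    ((h.mem_H1 t ht).lTwo_le hd).trans (by linarith [hM₁ t ht])
  have hmF : ∀ t ∈ Icc a c, AEStronglyMeasurable (fun y => F (u t y)) (hypVolume d) := fun t ht =>
    hF.comp_aestronglyMeasurable (h.mem_H1 t ht).memLp.1
  have hmeas : AEMeasurable (fun t => eLpNorm (fun y => F (u t y)) 2 (hypVolume d))
      (volume.restrict (Icc a c)) := by
    simp only [eLpNorm_eq_lintegral_rpow_enorm_toReal (two_ne_zero) (ENNReal.ofNat_ne_top)]
    exact (((h.meas_nonlin hF).enorm.pow_const _).lintegral_prod_right').pow_const _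
  have hfin := h.nonlin a (left_mem_Icc.2 hac) c (right_mem_Icc.2 hac)
  have hint : Integrable (fun t => lTwo (hypVolume d) (fun y => F (u t y)))
      (volume.restrict (Icc a c)) := integrable_toReal_of_lintegral_ne_top hmeas hfin.ne
  refine ⟨2 * M₁ + M₂, fun t => B * (2 * M₁) + lTwo (hypVolume d) (fun y => F (u t y)),
    by positivity, (integrable_const _).add hint, fun t => by
      have := lTwo_nonneg (μ := hypVolume d) (fun y => F (u t y)); positivity,
    fun t ht => ⟨by linarith [hM₁ t ht], by linarith [hM₂ t ht], by linarith [hM₃ t ht]⟩, ?_⟩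
  filter_upwards [ae_lt_top' hmeas hfin.ne, ae_restrict_mem measurableSet_Icc] with t ht1 ht
  have hL : MemLp (fun y => F (u t y)) 2 (hypVolume d) := ⟨hmF t ht, ht1⟩
  have hu := (h.mem_H1 t ht).memLp
  have hn : ∀ y, ‖V y * u t y‖ ≤ B * ‖u t y‖ := fun y => by
    rw [norm_mul]; exact mul_le_mul_of_nonneg_right (hB y) (norm_nonneg _)
  have hVu : MemLp (fun y => V y * u t y) 2 (hypVolume d) :=
    hu.of_norm_le_mul (hV.aestronglyMeasurable.mul hu.1) hn
  refine ⟨ht, hL, hVu.add hL, by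
      have : 0 ≤ B * (2 * M₁) := by positivity
      linarith, ?_⟩
  refine (lTwo_add_le hVu hL).trans ?_
  have h1 := lTwo_le_of_norm_le hB0 hu hn
  have h2 := mul_le_mul_of_nonneg_left (hM₃ t ht) hB0
  linarith



theorem intervalIntegrable_of_Icc {f : ℝ → ℝ} (hf : Integrable f (volume.restrict (Icc a c)))
    {s t : ℝ} (hs : s ∈ Icc a c) (ht : t ∈ Icc a c) : IntervalIntegrable f volume s t :=
  (IntegrableOn.mono_set hf (uIcc_subset_Icc hs ht)).intervalIntegrable

theorem ae_uIoc_of_ae_Icc {P : ℝ → Prop} (hP : ∀ᵐ t ∂(volume.restrict (Icc a c)), P t)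
    {s t : ℝ} (hs : s ∈ Icc a c) (ht : t ∈ Icc a c) : ∀ᵐ σ, σ ∈ uIoc s t → P σ := by
  rw [ae_restrict_iff' measurableSet_Icc] at hP
  filter_upwards [hP] with σ hσ h
  exact hσ (uIcc_subset_Icc hs ht (uIoc_subset_uIcc h))

theorem IsEnergySolution.meas_dirichlet (h : IsEnergySolution V F (Icc a c) u Du ut)
    {Dv : HypChart d → HypChart d}
    (hD : AEStronglyMeasurable Dv (hypVolume d)) :
    AEStronglyMeasurable (fun t => dirichlet (Du t) Dv) (volume.restrict (Icc a c)) := by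
  have := (h.meas_coframe.inner (𝕜 := ℝ)
    (aestronglyMeasurable_coframe hD).comp_snd).integral_prod_right'
  simp only [inner_coframe] at this
  exact this

theorem aestronglyMeasurable_integral_mul {ν : Measure ℝ} [SFinite ν] {f : ℝ → HypChart d → ℝ}
    (hf : AEStronglyMeasurable (fun p : ℝ × HypChart d => f p.1 p.2) (ν.prod (hypVolume d)))
    {v : HypChart d → ℝ} (hv : AEStronglyMeasurable v (hypVolume d)) :
    AEStronglyMeasurable (fun t => ∫ y, f t y * v y ∂(hypVolume d)) ν :=
  (hf.mul hv.comp_snd).integral_prod_right'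

/-- The equation tested with an `H¹` function. -/
theorem IsEnergySolution.eq_wave_of_isH1 (h : IsEnergySolution V F (Icc a c) u Du ut)
    (hd : 2 ≤ d) (hac : a ≤ c) (hV : Continuous V) {B : ℝ}
    (hB : ∀ y, |V y| ≤ B) (hF : Continuous F) {v : HypChart d → ℝ} {Dv : HypChart d → HypChart d}
    (hv : IsH1 v Dv) {s t : ℝ} (hs : s ∈ Icc a c) (ht : t ∈ Icc a c) :
    ∫ y, ut t y * v y ∂(hypVolume d) - ∫ y, ut s y * v y ∂(hypVolume d) =
      -∫ σ in s..t, (dirichlet (Du σ) Dv + ∫ y, forcing V F u σ y * v y ∂(hypVolume d)) := by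
  obtain ⟨M, p, hM0, hp, hp0, hM, hae⟩ := h.exists_bound hd hac hV hB hF
  obtain ⟨φ, hφ, h1, h2, -⟩ := hv.exists_approx
  have hφL := fun n => (hφ n).memLp
  have hφD := fun n => (hφ n).memLp_coframe
  have t1 := (tendsto_integral_mul_right (h.mem_L2 t ht) hφL hv.memLp h1).sub
    (tendsto_integral_mul_right (h.mem_L2 s hs) hφL hv.memLp h1)
  set Kv := lTwo (hypVolume d) v + 1
  set Kd := lTwo (hypVolume d) (fun y => coframe y (Dv y)) + 1
  have t2 : Tendsto (fun n => -∫ σ in s..t, (dirichlet (Du σ) (gradient (φ n)) +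
      ∫ y, forcing V F u σ y * φ n y ∂(hypVolume d))) atTop
      (𝓝 (-∫ σ in s..t, (dirichlet (Du σ) Dv +
        ∫ y, forcing V F u σ y * v y ∂(hypVolume d)))) := by
    refine (intervalIntegral.tendsto_integral_filter_of_dominated_convergence
      (fun σ => M * Kd + p σ * Kv) (Eventually.of_forall fun n => ?_) ?_ ?_ ?_).neg
    · refine AEStronglyMeasurable.mono_set
        (uIoc_subset_uIcc.trans (uIcc_subset_Icc hs ht)) ?_
      exact (h.meas_dirichlet (hφ n).continuous_gradient.aestronglyMeasurable).add
        (aestronglyMeasurable_integral_mul (h.meas_forcing hV hF) (hφL n).1)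
    · filter_upwards [eventually_lTwo_le hφL hv.memLp h1,
        eventually_lTwo_le hφD hv.memLp_coframe h2] with n hn1 hn2
      filter_upwards [ae_uIoc_of_ae_Icc hae hs ht] with σ hσ hσ'
      obtain ⟨hσ1, -, hf, -, hfp⟩ := hσ hσ'
      refine (norm_add_le _ _).trans (add_le_add ?_ ?_)
      · refine (abs_dirichlet_le (h.mem_H1 σ hσ1).memLp_coframe (hφD n)).trans ?_
        exact mul_le_mul (hM σ hσ1).1 hn2 (lTwo_nonneg _) hM0
      · refine (abs_integral_mul_le hf (hφL n)).trans ?_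
        exact mul_le_mul hfp hn1 (lTwo_nonneg _) (hp0 σ)
    · exact intervalIntegrable_of_Icc ((integrable_const _).add (hp.mul_const _)) hs ht
    · filter_upwards [ae_uIoc_of_ae_Icc hae hs ht] with σ hσ hσ'
      obtain ⟨hσ1, -, hf, -, hfp⟩ := hσ hσ'
      exact (tendsto_dirichlet (h.mem_H1 σ hσ1).memLp_coframe hφD hv.memLp_coframe h2).add
        (tendsto_integral_mul_right hf hφL hv.memLp h1)
  refine tendsto_nhds_unique t1 (t2.congr fun n => ?_)
  rw [h.eq_wave (φ n) (hφ n) s hs t ht]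
  congr 1
  refine intervalIntegral.integral_congr_ae ?_
  filter_upwards [ae_uIoc_of_ae_Icc hae hs ht] with σ hσ hσ'
  obtain ⟨hσ1, -, hf, -, hfp⟩ := hσ hσ'
  have i1 := integrable_hypCoMetric (h.mem_H1 σ hσ1).memLp_coframe (hφD n)
  have i2 : Integrable (fun y => forcing V F u σ y * φ n y) (hypVolume d) :=
    hf.integrable_mul (hφL n)
  rw [dirichlet, ← integral_add i1 i2]
  refine integral_congr_ae (Eventually.of_forall fun y => ?_)
  simp only [forcing]; ring

/-- `∂_t u = ut` tested with an `L²` function. -/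
theorem IsEnergySolution.eq_dt_of_memLp (h : IsEnergySolution V F (Icc a c) u Du ut)
    (hd : 2 ≤ d) (hac : a ≤ c) (hV : Continuous V) {B : ℝ}
    (hB : ∀ y, |V y| ≤ B) (hF : Continuous F) {v : HypChart d → ℝ}
    (hv : MemLp v 2 (hypVolume d)) {s t : ℝ} (hs : s ∈ Icc a c) (ht : t ∈ Icc a c) :
    ∫ y, u t y * v y ∂(hypVolume d) - ∫ y, u s y * v y ∂(hypVolume d) =
      ∫ σ in s..t, ∫ y, ut σ y * v y ∂(hypVolume d) := by
  obtain ⟨M, p, hM0, hp, hp0, hM, hae⟩ := h.exists_bound hd hac hV hB hF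
  obtain ⟨φ, hφ, h1⟩ := hv.exists_testFn
  have hφL := fun n => (hφ n).memLp
  have t1 := (tendsto_integral_mul_right (h.mem_H1 t ht).memLp hφL hv h1).sub
    (tendsto_integral_mul_right (h.mem_H1 s hs).memLp hφL hv h1)
  have t2 : Tendsto (fun n => ∫ σ in s..t, ∫ y, ut σ y * φ n y ∂(hypVolume d)) atTop
      (𝓝 (∫ σ in s..t, ∫ y, ut σ y * v y ∂(hypVolume d))) := by
    refine intervalIntegral.tendsto_integral_filter_of_dominated_convergence
      (fun _ => M * (lTwo (hypVolume d) v + 1)) (Eventually.of_forall fun n => ?_) ?_ ?_ ?_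
    · refine AEStronglyMeasurable.mono_set
        (uIoc_subset_uIcc.trans (uIcc_subset_Icc hs ht)) ?_
      exact aestronglyMeasurable_integral_mul h.meas_ut (hφL n).1
    · filter_upwards [eventually_lTwo_le hφL hv h1] with n hn1
      refine Eventually.of_forall fun σ hσ => ?_
      have hσ1 := uIcc_subset_Icc hs ht (uIoc_subset_uIcc hσ)
      refine (abs_integral_mul_le (h.mem_L2 σ hσ1) (hφL n)).trans ?_
      exact mul_le_mul (hM σ hσ1).2.1 hn1 (lTwo_nonneg _) hM0
    · exact intervalIntegrable_const
    · refine Eventually.of_forall fun σ hσ => ?_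
      have hσ1 := uIcc_subset_Icc hs ht (uIoc_subset_uIcc hσ)
      exact tendsto_integral_mul_right (h.mem_L2 σ hσ1) hφL hv h1
  exact tendsto_nhds_unique t1 (t2.congr fun n => (h.eq_dt (φ n) (hφ n) s hs t ht).symm)

theorem aestronglyMeasurable_comp_boost {ν : Measure ℝ} [SFinite ν] {e : HypChart d}
    (he : ‖e‖ = 1) (s : ℝ) {f : ℝ → HypChart d → ℝ}
    (hf : AEStronglyMeasurable (fun p : ℝ × HypChart d => f p.1 p.2) (ν.prod (hypVolume d))) :
    AEStronglyMeasurable (fun p : ℝ × HypChart d => f p.1 (boost e s p.2))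
      (ν.prod (hypVolume d)) :=
  hf.comp_quasiMeasurePreserving
    ((MeasurePreserving.id ν).prod (measurePreserving_boost he s)).quasiMeasurePreserving

theorem aestronglyMeasurable_multOp {ν : Measure ℝ} [SFinite ν] {e : HypChart d}
    (he : ‖e‖ = 1) {b : HypChart d → ℝ} (hb : IsTestFn b) (s : ℝ) {f : ℝ → HypChart d → ℝ}
    (hf : AEStronglyMeasurable (fun p : ℝ × HypChart d => f p.1 p.2) (ν.prod (hypVolume d))) :
    AEStronglyMeasurable (fun p : ℝ × HypChart d => multOp b e s (f p.1) p.2)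
      (ν.prod (hypVolume d)) := by
  have hbc := hb.1.continuous
  have hbb : Continuous fun p : ℝ × HypChart d => b (boost e (-s) p.2) :=
    hbc.comp ((contDiff_boost (n := 0) (-s)).continuous.comp continuous_snd)
  exact (((hbc.comp continuous_snd).aestronglyMeasurable.mul
    (aestronglyMeasurable_comp_boost he s hf)).sub
      (hbb.aestronglyMeasurable.mul (aestronglyMeasurable_comp_boost he (-s) hf))).const_mul _

/-- The weight multiplying `K_e u` in the derivative of the Dirichlet form. -/
noncomputable def dirWeight (b : HypChart d → ℝ) (u : HypChart d → ℝ)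
    (Du : HypChart d → HypChart d) (y : HypChart d) : ℝ :=
  ⟪hypGrad b y, Du y⟫ + 1 / 2 * hypDiv (hypGrad b) y * u y

theorem IsEnergySolution.meas_dirWeight {b : HypChart d → ℝ} (hb : IsTestFn b) {J : Set ℝ}
    (h : IsEnergySolution V F J u Du ut) :
    AEStronglyMeasurable (fun p : ℝ × HypChart d => dirWeight b (u p.1) (Du p.1) p.2)
      ((volume.restrict J).prod (hypVolume d)) := by
  have hY := hb.contDiff_hypGrad
  exact ((hY.continuous.comp continuous_snd).aestronglyMeasurable.inner h.meas_Du).add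
    ((((continuous_hypDiv hY).comp continuous_snd).aestronglyMeasurable.const_mul _).mul h.meas_u)

theorem exists_dirWeight_bound (hd : 2 ≤ d) {b : HypChart d → ℝ} (hb : IsTestFn b) :
    ∃ C : ℝ, 0 ≤ C ∧ ∀ u Du, IsH1 u Du → MemLp (dirWeight b u Du) 2 (hypVolume d) ∧
      lTwo (hypVolume d) (dirWeight b u Du) ≤
        C * lTwo (hypVolume d) (fun y => coframe y (Du y)) := by
  have hY := hb.contDiff_hypGrad
  have hYc := hb.hasCompactSupport_hypGrad
  obtain ⟨A, hA0, hA⟩ := exists_bound_of_hasCompactSupport hY.continuous hYc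
  obtain ⟨D, hD0, hD⟩ := exists_bound_of_hasCompactSupport (continuous_hypDiv hY)
    (hasCompactSupport_hypDiv hYc)
  refine ⟨A + D, by positivity, fun u Du hu => ?_⟩
  have m1 := memLp_inner_field hY.continuous hYc hu.meas hu.memLp_coframe
  have n2 : ∀ y, ‖1 / 2 * hypDiv (hypGrad b) y * u y‖ ≤ 1 / 2 * D * ‖u y‖ := fun y => by
    rw [norm_mul, norm_mul]
    refine mul_le_mul_of_nonneg_right ?_ (norm_nonneg _)
    rw [Real.norm_of_nonneg (by norm_num : (0 : ℝ) ≤ 1 / 2)]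
    exact mul_le_mul_of_nonneg_left (hD y) (by norm_num)
  have m2 : MemLp (fun y => 1 / 2 * hypDiv (hypGrad b) y * u y) 2 (hypVolume d) :=
    hu.memLp.of_norm_le_mul
      (((continuous_hypDiv hY).aestronglyMeasurable.const_mul _).mul hu.memLp.1) n2
  have h1 := lTwo_le_of_norm_le hA0 hu.memLp_coframe
    fun y => norm_inner_le_mul_coframe hA y (Du y)
  have h2 := lTwo_le_of_norm_le (by positivity) hu.memLp n2
  refine ⟨m1.add m2, (lTwo_add_le m1 m2).trans ?_⟩
  have h3 := mul_le_mul_of_nonneg_left (hu.lTwo_le hd) (by positivity : 0 ≤ 1 / 2 * D)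
  linarith

/-- Measurability in time is read off from `IsH1.dirichlet_multOpGrad`, which rewrites the pairing
through jointly measurable functions of (t, y). -/
theorem IsEnergySolution.meas_dirichlet_multOp (h : IsEnergySolution V F (Icc a c) u Du ut)
    {e : HypChart d} (he : ‖e‖ = 1)
    {b : HypChart d → ℝ} (hb : IsTestFn b) {s : ℝ} (hs : s ≠ 0) :
    AEStronglyMeasurable (fun t => dirichlet (Du t) (multOpGrad b e s (u t) (Du t)))
      (volume.restrict (Icc a c)) := by
  have m1 := ((h.meas_dirWeight hb).mul
    (aestronglyMeasurable_comp_boost he s h.meas_u)).integral_prod_right'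
  have m2 := ((h.meas_dirWeight hb).mul h.meas_u).integral_prod_right'
  refine ((m1.sub m2).mul_const s⁻¹).congr ?_
  filter_upwards [ae_restrict_mem measurableSet_Icc] with t ht
  rw [(h.mem_H1 t ht).dirichlet_multOpGrad he hb hs, div_eq_mul_inv]
  rfl

theorem dirichlet_sub_right {ξ η ζ : HypChart d → HypChart d}
    (hξ : MemLp (fun y => coframe y (ξ y)) 2 (hypVolume d))
    (hη : MemLp (fun y => coframe y (η y)) 2 (hypVolume d))
    (hζ : MemLp (fun y => coframe y (ζ y)) 2 (hypVolume d)) :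
    dirichlet ξ (fun y => η y - ζ y) = dirichlet ξ η - dirichlet ξ ζ := by
  unfold dirichlet
  rw [← integral_sub (integrable_hypCoMetric hξ hη) (integrable_hypCoMetric hξ hζ)]
  refine integral_congr_ae (Eventually.of_forall fun y => ?_)
  simp only [hypCoMetric, inner_sub_right]; ring

theorem integral_mul_sub {f g k : HypChart d → ℝ} (hf : MemLp f 2 (hypVolume d))
    (hg : MemLp g 2 (hypVolume d)) (hk : MemLp k 2 (hypVolume d)) :
    ∫ y, f y * (g y - k y) ∂(hypVolume d) =
      ∫ y, f y * g y ∂(hypVolume d) - ∫ y, f y * k y ∂(hypVolume d) := by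
  have i1 : Integrable (fun y => f y * g y) (hypVolume d) := hf.integrable_mul hg
  have i2 : Integrable (fun y => f y * k y) (hypVolume d) := hf.integrable_mul hk
  rw [← integral_sub i1 i2]
  simp only [mul_sub]

/-- The multiplier identity for the difference multiplier. -/
theorem IsEnergySolution.multOp_identity (h : IsEnergySolution V F (Icc a c) u Du ut)
    (hd : 2 ≤ d) (hac : a ≤ c) (hV : Continuous V) {B : ℝ}
    (hB : ∀ y, |V y| ≤ B) (hF : Continuous F) {e : HypChart d} (he : ‖e‖ = 1)
    {b : HypChart d → ℝ} (hb : IsTestFn b) {s : ℝ} (hs : s ≠ 0) :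
    ∫ y, ut c y * multOp b e s (u c) y ∂(hypVolume d) -
        ∫ y, ut a y * multOp b e s (u a) y ∂(hypVolume d) =
      -∫ t in a..c, (dirichlet (Du t) (multOpGrad b e s (u t) (Du t)) +
        ∫ y, forcing V F u t y * multOp b e s (u t) y ∂(hypVolume d)) := by
  obtain ⟨M, p, hM0, hp, hp0, hM, hae⟩ := h.exists_bound hd hac hV hB hF
  obtain ⟨hmD, -⟩ := exists_modulus_lTwo
    (f := fun t y => coframe y (Du t y)) (fun t ht => (h.mem_H1 t ht).memLp_coframe)
    fun t ht => (h.tendsto_lTwo ht).1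
  obtain ⟨hmt, -⟩ := exists_modulus_lTwo (f := ut) h.mem_L2
    fun t ht => (h.tendsto_lTwo ht).2
  obtain ⟨C₁, hC₁0, hC₁⟩ := exists_lTwo_multOp_le he hb s
  obtain ⟨C₂, hC₂0, hC₂⟩ := exists_lTwo_multOpGrad_le hd he hb s
  -- W is the pairing with the multiplier at the current time. W' τ freezes the multiplier at time
  -- τ, so that the equation can be tested with it, and Z is the frozen pairing for ∂_t u.
  let W : ℝ → ℝ := fun t => dirichlet (Du t) (multOpGrad b e s (u t) (Du t)) +
    ∫ y, forcing V F u t y * multOp b e s (u t) y ∂(hypVolume d)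
  let W' : ℝ → ℝ → ℝ := fun τ t => dirichlet (Du t) (multOpGrad b e s (u τ) (Du τ)) +
    ∫ y, forcing V F u t y * multOp b e s (u τ) y ∂(hypVolume d)
  let Z : ℝ → ℝ → ℝ := fun τ t => ∫ y, ut t y * multOp b e s (ut τ) y ∂(hypVolume d)
  have hA : ∀ t ∈ Icc a c, IsH1 (multOp b e s (u t)) (multOpGrad b e s (u t) (Du t)) :=
    fun t ht => (h.mem_H1 t ht).isH1_multOp he hb s
  have hAt : ∀ t ∈ Icc a c, MemLp (multOp b e s (ut t)) 2 (hypVolume d) :=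
    fun t ht => memLp_multOp he hb s (h.mem_L2 t ht)
  have hbound : ∀ τ ∈ Icc a c, ∀ᵐ t ∂(volume.restrict (Icc a c)),
      ‖W' τ t‖ ≤ M * (C₂ * M) + p t * (C₁ * M) := by
    intro τ hτ
    filter_upwards [hae] with t ⟨ht, _, hf, _, hfp⟩
    refine (norm_add_le _ _).trans (add_le_add ?_ ?_)
    · refine (abs_dirichlet_le (h.mem_H1 t ht).memLp_coframe (hA τ hτ).memLp_coframe).trans ?_
      refine mul_le_mul (hM t ht).1 ((hC₂ _ _ (h.mem_H1 τ hτ)).trans ?_) (lTwo_nonneg _) hM0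
      exact mul_le_mul_of_nonneg_left (hM τ hτ).1 hC₂0
    · refine (abs_integral_mul_le hf (hA τ hτ).memLp).trans ?_
      refine mul_le_mul hfp ((hC₁ _ (h.mem_H1 τ hτ).memLp).trans ?_) (lTwo_nonneg _) (hp0 t)
      exact mul_le_mul_of_nonneg_left (hM τ hτ).2.2 hC₁0
  have hboundW : ∀ᵐ t ∂(volume.restrict (Icc a c)),
      ‖W t‖ ≤ M * (C₂ * M) + p t * (C₁ * M) := by
    filter_upwards [hae] with t ⟨ht, _, hf, _, hfp⟩
    refine (norm_add_le _ _).trans (add_le_add ?_ ?_)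
    · refine (abs_dirichlet_le (h.mem_H1 t ht).memLp_coframe (hA t ht).memLp_coframe).trans ?_
      refine mul_le_mul (hM t ht).1 ((hC₂ _ _ (h.mem_H1 t ht)).trans ?_) (lTwo_nonneg _) hM0
      exact mul_le_mul_of_nonneg_left (hM t ht).1 hC₂0
    · refine (abs_integral_mul_le hf (hA t ht).memLp).trans ?_
      refine mul_le_mul hfp ((hC₁ _ (h.mem_H1 t ht).memLp).trans ?_) (lTwo_nonneg _) (hp0 t)
      exact mul_le_mul_of_nonneg_left (hM t ht).2.2 hC₁0
  have hbi : Integrable (fun t => M * (C₂ * M) + p t * (C₁ * M)) (volume.restrict (Icc a c)) :=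
    (integrable_const _).add (hp.mul_const _)
  have hWi : Integrable W (volume.restrict (Icc a c)) := by
    refine hbi.mono' ((h.meas_dirichlet_multOp he hb hs).add ?_) hboundW
    exact ((h.meas_forcing hV hF).mul
      (aestronglyMeasurable_multOp he hb s h.meas_u)).integral_prod_right'
  have hW'i : ∀ τ ∈ Icc a c, Integrable (W' τ) (volume.restrict (Icc a c)) := fun τ hτ =>
    hbi.mono' ((h.meas_dirichlet (hA τ hτ).meas).add
      (aestronglyMeasurable_integral_mul (h.meas_forcing hV hF) (hA τ hτ).memLp.1)) (hbound τ hτ)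
  have hZi : ∀ τ ∈ Icc a c, Integrable (Z τ) (volume.restrict (Icc a c)) := fun τ hτ => by
    refine (integrable_const (M * lTwo (hypVolume d) (multOp b e s (ut τ)))).mono'
      (aestronglyMeasurable_integral_mul h.meas_ut (hAt τ hτ).1) ?_
    filter_upwards [ae_restrict_mem measurableSet_Icc] with t ht
    refine (abs_integral_mul_le (h.mem_L2 t ht) (hAt τ hτ)).trans ?_
    exact mul_le_mul_of_nonneg_right (hM t ht).2.1 (lTwo_nonneg _)
  -- The coefficient of ε in the error bound: Dirichlet term, forcing term (2 is the Poincaré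
  -- constant), kinetic term.
  let K : ℝ → ℝ := fun t => (M * C₂ + p t * (C₁ * 2)) + M * C₁
  have hKi : Integrable K (volume.restrict (Icc a c)) :=
    ((integrable_const _).add (hp.mul_const _)).add (integrable_const _)
  have haI := left_mem_Icc.2 hac
  have hcI := right_mem_Icc.2 hac
  have key := eq_of_abs_sub_le (a := a) (b := c)
    (D := fun t => ∫ y, ut t y * multOp b e s (u t) y ∂(hypVolume d) + ∫ σ in a..t, W σ)
    (P := fun t => ∫ σ in a..t, K σ) hac ?_
  · simp only [intervalIntegral.integral_same, add_zero] at key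
    linarith
  intro ε hε
  obtain ⟨δ₁, hδ₁, H₁⟩ := hmD ε hε
  obtain ⟨δ₂, hδ₂, H₂⟩ := hmt ε hε
  refine ⟨min δ₁ δ₂, lt_min hδ₁ hδ₂, fun r hr t ht hrt hlt => ?_⟩
  have ii := fun {f : ℝ → ℝ} (hf : Integrable f (volume.restrict (Icc a c))) =>
    intervalIntegrable_of_Icc hf haI hr
  have ij := fun {f : ℝ → ℝ} (hf : Integrable f (volume.restrict (Icc a c))) =>
    intervalIntegrable_of_Icc hf hr ht
  have eW := intervalIntegral.integral_add_adjacent_intervals (ii hWi) (ij hWi)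
  have eK := intervalIntegral.integral_add_adjacent_intervals (ii hKi) (ij hKi)
  have e1 := h.eq_wave_of_isH1 hd hac hV hB hF (hA r hr) hr ht
  -- Skewness moves the multiplier onto ∂_t u(t), a fixed L² function, against which the weak form
  -- of ∂_t u = ut applies.
  have e2 : ∫ y, ut t y * multOp b e s (u t) y ∂(hypVolume d) -
      ∫ y, ut t y * multOp b e s (u r) y ∂(hypVolume d) = -∫ σ in r..t, Z t σ := by
    rw [integral_multOp_skew he hb s (h.mem_L2 t ht) (h.mem_H1 t ht).memLp,
      integral_multOp_skew he hb s (h.mem_L2 t ht) (h.mem_H1 r hr).memLp]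
    have := h.eq_dt_of_memLp hd hac hV hB hF (hAt t ht) hr ht
    linarith
  have e3 : (∫ y, ut t y * multOp b e s (u t) y ∂(hypVolume d) + ∫ σ in a..t, W σ) -
      (∫ y, ut r y * multOp b e s (u r) y ∂(hypVolume d) + ∫ σ in a..r, W σ) =
      ∫ σ in r..t, (W σ - W' r σ - Z t σ) := by
    rw [intervalIntegral.integral_sub ((ij hWi).sub (ij (hW'i r hr))) (ij (hZi t ht)),
      intervalIntegral.integral_sub (ij hWi) (ij (hW'i r hr))]
    have e1' : ∫ y, ut t y * multOp b e s (u r) y ∂(hypVolume d) -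
      ∫ y, ut r y * multOp b e s (u r) y ∂(hypVolume d) = -∫ σ in r..t, W' r σ := e1
    linarith
  have e4 : (∫ σ in a..t, K σ) - (∫ σ in a..r, K σ) = ∫ σ in r..t, K σ := by linarith
  rw [e3, e4, ← intervalIntegral.integral_const_mul, ← Real.norm_eq_abs]
  refine intervalIntegral.norm_integral_le_of_norm_le hrt ?_ ((ij hKi).const_mul ε)
  have hae' := ae_uIoc_of_ae_Icc hae hr ht
  rw [uIoc_of_le hrt] at hae'
  filter_upwards [hae'] with σ hσ hσ'
  obtain ⟨hσI, -, hf, -, hfp⟩ := hσ hσ'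
  have hσr : |σ - r| < δ₁ := by
    rw [abs_of_nonneg (by linarith [hσ'.1])]
    linarith [hσ'.2, min_le_left δ₁ δ₂]
  have htσ : |t - σ| < δ₂ := by
    rw [abs_of_nonneg (by linarith [hσ'.2])]
    linarith [hσ'.1, min_le_right δ₁ δ₂]
  have hdiff := (h.mem_H1 σ hσI).sub (h.mem_H1 r hr)
  have hN : lTwo (hypVolume d) (fun y => coframe y (Du σ y - Du r y)) ≤ ε := by
    simp only [coframe_sub]; exact (H₁ σ hσI r hr hσr).le
  have hN' := (hdiff.lTwo_le hd).trans (mul_le_mul_of_nonneg_left hN two_pos.le)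
  have hAd := hdiff.isH1_multOp he hb s
  have b1 : W σ - W' r σ = dirichlet (Du σ) (multOpGrad b e s (fun y => u σ y - u r y)
      (fun y => Du σ y - Du r y)) +
      ∫ y, forcing V F u σ y * multOp b e s (fun y => u σ y - u r y) y ∂(hypVolume d) := by
    have q1 := dirichlet_sub_right (h.mem_H1 σ hσI).memLp_coframe (hA σ hσI).memLp_coframe
      (hA r hr).memLp_coframe
    have q2 := integral_mul_sub hf (hA σ hσI).memLp (hA r hr).memLp
    simp only [← multOpGrad_sub] at q1
    simp only [← multOp_sub] at q2
    change (_ + _) - (_ + _) = _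
    rw [q2]
    have q1' : dirichlet (Du σ) (multOpGrad b e s (fun y => u σ y - u r y)
      (fun y => Du σ y - Du r y)) = _ := q1
    rw [q1']
    ring
  -- By skewness ∂_t u(σ) is orthogonal to its own image under the multiplier. Subtracting this zero
  -- leaves ∂_t u(t) - ∂_t u(σ), which is small by continuity.
  have b2 : Z t σ = ∫ y, ut σ y * multOp b e s (fun y => ut t y - ut σ y) y ∂(hypVolume d) := by
    have q0 : ∫ y, ut σ y * multOp b e s (ut σ) y ∂(hypVolume d) = 0 := by
      have := integral_multOp_skew he hb s (h.mem_L2 σ hσI) (h.mem_L2 σ hσI)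
      linarith
    have q2 := integral_mul_sub (h.mem_L2 σ hσI) (hAt t ht) (hAt σ hσI)
    simp only [← multOp_sub] at q2
    rw [q2, q0, sub_zero]
  have hdt : MemLp (fun y => ut t y - ut σ y) 2 (hypVolume d) := (h.mem_L2 t ht).sub
    (h.mem_L2 σ hσI)
  rw [b1, b2]
  have c1 := (abs_dirichlet_le (h.mem_H1 σ hσI).memLp_coframe hAd.memLp_coframe).trans
    (mul_le_mul (hM σ hσI).1 ((hC₂ _ _ hdiff).trans (mul_le_mul_of_nonneg_left hN hC₂0))
      (lTwo_nonneg _) hM0)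
  have c2 := (abs_integral_mul_le hf hAd.memLp).trans
    (mul_le_mul hfp ((hC₁ _ hdiff.memLp).trans (mul_le_mul_of_nonneg_left hN' hC₁0))
      (lTwo_nonneg _) (hp0 σ))
  have c3 := (abs_integral_mul_le (h.mem_L2 σ hσI) (memLp_multOp he hb s hdt)).trans
    (mul_le_mul (hM σ hσI).2.1 ((hC₁ _ hdt).trans
      (mul_le_mul_of_nonneg_left (H₂ t ht σ hσI htσ).le hC₁0)) (lTwo_nonneg _) hM0)
  refine (norm_sub_le _ _).trans ((add_le_add (norm_add_le _ _) le_rfl).trans ?_)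
  refine (add_le_add (add_le_add c1 c2) c3).trans (le_of_eq ?_)
  simp only [K]; ring

/-- The multiplier identity for the vector field `b K_e`. -/
theorem IsEnergySolution.multLim_identity (h : IsEnergySolution V F (Icc a c) u Du ut)
    (hd : 2 ≤ d) (hac : a ≤ c) (hV : Continuous V) {B : ℝ}
    (hB : ∀ y, |V y| ≤ B) (hF : Continuous F) {e : HypChart d} (he : ‖e‖ = 1)
    {b : HypChart d → ℝ} (hb : IsTestFn b) :
    Integrable (fun t => ∫ y, dirWeight b (u t) (Du t) y * (height y * ⟪e, Du t y⟫)
        ∂(hypVolume d) + ∫ y, forcing V F u t y * multLim b e (u t) (Du t) y ∂(hypVolume d))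
        (volume.restrict (Icc a c)) ∧
    ∫ y, ut c y * multLim b e (u c) (Du c) y ∂(hypVolume d) -
        ∫ y, ut a y * multLim b e (u a) (Du a) y ∂(hypVolume d) =
      -∫ t in a..c, (∫ y, dirWeight b (u t) (Du t) y * (height y * ⟪e, Du t y⟫) ∂(hypVolume d) +
        ∫ y, forcing V F u t y * multLim b e (u t) (Du t) y ∂(hypVolume d)) := by
  obtain ⟨M, p, hM0, hp, hp0, hM, hae⟩ := h.exists_bound hd hac hV hB hF
  obtain ⟨C₁, hC₁0, hC₁⟩ := exists_integral_multOp_le hd he hb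
  obtain ⟨C₂, hC₂0, hC₂⟩ := exists_dirWeight_bound hd hb
  obtain ⟨R, hR0, hR⟩ := hb.exists_support
  have hw : ∀ t, ∀ y, R < ‖y‖ → dirWeight b (u t) (Du t) y = 0 := fun t y hy => by
    have hb0 : b =ᶠ[𝓝 y] fun _ => 0 := by
      have : ∀ᶠ z in 𝓝 y, R < ‖z‖ := continuous_norm.continuousAt.eventually (lt_mem_nhds hy)
      filter_upwards [this] with z hz using hR z hz
    have hg0 : hypGrad b =ᶠ[𝓝 y] fun _ => 0 := by
      filter_upwards [hb0.eventually_nhds] with z hz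
      have hz' : b =ᶠ[𝓝 z] fun _ => 0 := hz
      have : gradient b z = 0 := by rw [hz'.gradient_eq]; simp
      simp [hypGrad, this]
    have h1 : hypDiv (hypGrad b) y = 0 := by
      have := hg0.self_of_nhds
      simp only [hypDiv, euclDiv, hg0.fderiv_eq, this]
      simp
    simp [dirWeight, h1, hg0.self_of_nhds]
  let s : ℕ → ℝ := fun n => 1 / ((n : ℝ) + 1)
  have hs0 : ∀ n, s n ≠ 0 := fun n => by positivity
  have hs1 : ∀ n, |s n| ≤ 1 := fun n => by
    rw [abs_of_pos (by positivity)]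
    exact (div_le_one (by positivity)).2 (by linarith [(Nat.cast_nonneg n : (0 : ℝ) ≤ n)])
  have hst : Tendsto s atTop (𝓝[≠] 0) := tendsto_nhdsWithin_iff.2
    ⟨tendsto_one_div_add_atTop_nhds_zero_nat, Eventually.of_forall hs0⟩
  let W : ℕ → ℝ → ℝ := fun n t => dirichlet (Du t) (multOpGrad b e (s n) (u t) (Du t)) +
    ∫ y, forcing V F u t y * multOp b e (s n) (u t) y ∂(hypVolume d)
  let Q : ℝ → ℝ := fun t => ∫ y, dirWeight b (u t) (Du t) y * (height y * ⟪e, Du t y⟫)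
    ∂(hypVolume d) + ∫ y, forcing V F u t y * multLim b e (u t) (Du t) y ∂(hypVolume d)
  have hlim : ∀ᵐ t ∂(volume.restrict (Icc a c)), Tendsto (fun n => W n t) atTop (𝓝 (Q t)) := by
    filter_upwards [hae] with t ⟨ht, _, hf, _, _⟩
    have hu := h.mem_H1 t ht
    refine Tendsto.add ?_ ((hu.tendsto_integral_multOp he hb hf).comp hst)
    refine ((hu.tendsto_boost he hR0 (hC₂ _ _ hu).1 (hw t)).comp hst).congr fun n => ?_
    exact (hu.dirichlet_multOpGrad he hb (hs0 n)).symm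
  have hmeas : ∀ n, AEStronglyMeasurable (W n) (volume.restrict (Icc a c)) := fun n =>
    (h.meas_dirichlet_multOp he hb (hs0 n)).add ((h.meas_forcing hV hF).mul
      (aestronglyMeasurable_multOp he hb (s n) h.meas_u)).integral_prod_right'
  -- A bound on W n independent of n: the Lipschitz bound along boosts for the Dirichlet term,
  -- `exists_integral_multOp_le` for the forcing.
  let K : ℝ → ℝ := fun t => 3 * (1 + R) * (C₂ * M) * M + C₁ * p t * M
  have hK : Integrable K (volume.restrict (Icc a c)) :=
    (integrable_const _).add ((hp.const_mul C₁).mul_const M)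
  have hbd : ∀ n, ∀ᵐ t ∂(volume.restrict (Icc a c)), ‖W n t‖ ≤ K t := fun n => by
    filter_upwards [hae] with t ⟨ht, _, hf, _, hfp⟩
    have hu := h.mem_H1 t ht
    obtain ⟨hM1, -, -⟩ := hM t ht
    refine (norm_add_le _ _).trans (add_le_add ?_ ?_)
    · rw [hu.dirichlet_multOpGrad he hb (hs0 n), norm_div, div_le_iff₀ (norm_pos_iff.2 (hs0 n))]
      refine (hu.abs_boost_sub_le he hR0 (hC₂ _ _ hu).1 (hw t) (hs1 n)).trans ?_
      refine mul_le_mul_of_nonneg_right ?_ (abs_nonneg _)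
      refine mul_le_mul (mul_le_mul_of_nonneg_left ((hC₂ _ _ hu).2.trans
        (mul_le_mul_of_nonneg_left hM1 hC₂0)) (by positivity)) hM1 (lTwo_nonneg _) (by positivity)
    · refine (hC₁ _ _ _ _ hu hf (hs0 n) (hs1 n)).trans ?_
      exact mul_le_mul (mul_le_mul_of_nonneg_left hfp hC₁0) hM1 (lTwo_nonneg _)
        (mul_nonneg hC₁0 (hp0 t))
  have hQi : Integrable Q (volume.restrict (Icc a c)) := by
    refine hK.mono' (aestronglyMeasurable_of_tendsto_ae atTop hmeas hlim) ?_
    filter_upwards [hlim, ae_all_iff.2 hbd] with t h1 h2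
    exact le_of_tendsto' h1.norm h2
  refine ⟨hQi, ?_⟩
  have haI := left_mem_Icc.2 hac
  have hcI := right_mem_Icc.2 hac
  have t1 := (((h.mem_H1 c hcI).tendsto_integral_multOp he hb (h.mem_L2 c hcI)).comp hst).sub
    (((h.mem_H1 a haI).tendsto_integral_multOp he hb (h.mem_L2 a haI)).comp hst)
  have t2 : Tendsto (fun n => -∫ t in a..c, W n t) atTop (𝓝 (-∫ t in a..c, Q t)) := by
    refine (intervalIntegral.tendsto_integral_filter_of_dominated_convergence K
      (Eventually.of_forall fun n => ?_) (Eventually.of_forall fun n => ?_)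
      (intervalIntegrable_of_Icc hK haI hcI) ?_).neg
    · exact (hmeas n).mono_set (uIoc_subset_uIcc.trans (uIcc_subset_Icc haI hcI))
    · exact ae_uIoc_of_ae_Icc (hbd n) haI hcI
    · exact ae_uIoc_of_ae_Icc hlim haI hcI
  exact tendsto_nhds_unique t1 (t2.congr fun n =>
    (h.multOp_identity hd hac hV hB hF he hb (hs0 n)).symm)

end Solution

/-! ### The radial multiplier -/

section FixedTime
variable {d : ℕ} {u : HypChart d → ℝ} {Du : HypChart d → HypChart d} {V : HypChart d → ℝ}
  {F : ℝ → ℝ} {R : ℝ}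

theorem sum_inner_mul_inner_basisFun (v w : HypChart d) :
    ∑ j, ⟪EuclideanSpace.basisFun (Fin d) ℝ j, v⟫ * ⟪EuclideanSpace.basisFun (Fin d) ℝ j, w⟫ =
      ⟪v, w⟫ := by
  rw [← (EuclideanSpace.basisFun (Fin d) ℝ).sum_inner_mul_inner v w]
  exact Finset.sum_congr rfl fun j _ => by rw [real_inner_comm v]

/-- The identity ∑ ⟨e_j,y⟩ e_j = y assembles the fields b_j K_j into the radial field. As the K_j
are divergence free, ∑ K_j b_j is its divergence. -/
theorem sum_multLim (R : ℝ) (u : HypChart d → ℝ) (Du : HypChart d → HypChart d) (y : HypChart d) :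
    ∑ j, multLim (radialTest d R (EuclideanSpace.basisFun (Fin d) ℝ j))
      (EuclideanSpace.basisFun (Fin d) ℝ j) u Du y =
      ⟪multField d R y, Du y⟫ + 1 / 2 * hypDiv (multField d R) y * u y := by
  have h1 : ∀ j, multLim (radialTest d R (EuclideanSpace.basisFun (Fin d) ℝ j))
      (EuclideanSpace.basisFun (Fin d) ℝ j) u Du y =
      height y * prof d R (‖y‖ ^ 2) * (⟪EuclideanSpace.basisFun (Fin d) ℝ j, y⟫ *
        ⟪EuclideanSpace.basisFun (Fin d) ℝ j, Du y⟫) + 1 / 2 * (height y * u y) *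
        (prof d R (‖y‖ ^ 2) + 2 * prof₁ d R (‖y‖ ^ 2) *
          (⟪EuclideanSpace.basisFun (Fin d) ℝ j, y⟫ *
            ⟪EuclideanSpace.basisFun (Fin d) ℝ j, y⟫)) := by
    intro j
    have hn : ⟪EuclideanSpace.basisFun (Fin d) ℝ j, EuclideanSpace.basisFun (Fin d) ℝ j⟫ =
        (1 : ℝ) := by
      rw [real_inner_self_eq_norm_sq, OrthonormalBasis.norm_eq_one, one_pow]
    rw [multLim, gradient_radialTest, radialTest, inner_add_right, inner_smul_right,
      inner_smul_right, hn]
    ring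
  rw [Finset.sum_congr rfl fun j _ => h1 j, Finset.sum_add_distrib, ← Finset.mul_sum,
    ← Finset.mul_sum, Finset.sum_add_distrib, ← Finset.mul_sum, sum_inner_mul_inner_basisFun,
    sum_inner_mul_inner_basisFun, hypDiv_multField, inner_multField, divCoef,
    real_inner_self_eq_norm_sq, Finset.sum_const, Finset.card_univ, Fintype.card_fin, nsmul_eq_mul]
  change _ = _ + 1 / 2 * (height y * _) * _
  ring

/-- The first-order parts add up to the quadratic form ∇X(∇u,∇u), and the Laplacians of the b_j to a
remainder that vanishes as R → ∞. -/
theorem sum_dirWeight (R : ℝ) (u : HypChart d → ℝ) (Du : HypChart d → HypChart d)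
    (y : HypChart d) :
    ∑ j, dirWeight (radialTest d R (EuclideanSpace.basisFun (Fin d) ℝ j)) u Du y *
      (height y * ⟪EuclideanSpace.basisFun (Fin d) ℝ j, Du y⟫) =
      quadForm d R y (Du y) +
        1 / 2 * (height y * lapCoef d R (‖y‖ ^ 2)) * (⟪y, Du y⟫ * u y) := by
  have h1 : ∀ j, dirWeight (radialTest d R (EuclideanSpace.basisFun (Fin d) ℝ j)) u Du y *
      (height y * ⟪EuclideanSpace.basisFun (Fin d) ℝ j, Du y⟫) =
      height y * prof d R (‖y‖ ^ 2) * (⟪EuclideanSpace.basisFun (Fin d) ℝ j, Du y⟫ *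
        ⟪EuclideanSpace.basisFun (Fin d) ℝ j, Du y⟫) +
      height y * (quadCoef d R (‖y‖ ^ 2) * ⟪y, Du y⟫ + 1 / 2 * lapCoef d R (‖y‖ ^ 2) * u y) *
        (⟪EuclideanSpace.basisFun (Fin d) ℝ j, y⟫ *
          ⟪EuclideanSpace.basisFun (Fin d) ℝ j, Du y⟫) := by
    intro j
    rw [dirWeight, hypDiv_hypGrad_radialTest, hypGrad_radialTest]
    simp only [inner_add_left, inner_smul_left, RCLike.conj_to_real]
    ring
  rw [Finset.sum_congr rfl fun j _ => h1 j, Finset.sum_add_distrib, ← Finset.mul_sum,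
    ← Finset.mul_sum, sum_inner_mul_inner_basisFun, sum_inner_mul_inner_basisFun,
    real_inner_self_eq_norm_sq, quadForm]
  ring

theorem IsH1.memLp_multLim {b : HypChart d → ℝ} (hb : IsTestFn b) (e : HypChart d)
    (hu : IsH1 u Du) : MemLp (multLim b e u Du) 2 (hypVolume d) := by
  have hh := (contDiff_height (d := d) (n := 0)).continuous
  have c1 : Continuous fun y => (b y * height y) • e := (hb.1.continuous.mul hh).smul continuous_const
  have s1 : HasCompactSupport fun y => (b y * height y) • e :=
    hb.2.mono' fun y hy => subset_tsupport _ fun h0 => hy (by simp [h0])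
  have c2 : Continuous fun y => 1 / 2 * (height y * ⟪e, gradient b y⟫) :=
    (hh.mul (continuous_const.inner hb.continuous_gradient)).const_mul _
  have s2 : HasCompactSupport fun y => 1 / 2 * (height y * ⟪e, gradient b y⟫) :=
    (hasCompactSupport_gradient hb.2).mono' fun y hy => subset_tsupport _ fun h0 =>
      hy (by simp [h0])
  refine ((memLp_inner_field c1 s1 hu.meas hu.memLp_coframe).add
    (memLp_bdd_mul c2 s2 hu.memLp)).ae_eq (Eventually.of_forall fun y => ?_)
  simp only [Pi.add_apply, multLim, inner_smul_left, RCLike.conj_to_real]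
  ring

theorem IsH1.memLp_inner_left (e : HypChart d) (hu : IsH1 u Du) :
    MemLp (fun y => ⟪e, Du y⟫) 2 (hypVolume d) :=
  hu.memLp_coframe.of_norm_le_mul (aestronglyMeasurable_const.inner hu.meas) fun y =>
    norm_inner_le_mul_coframe (Y := fun _ => e) (C := ‖e‖) (fun _ => le_rfl) y _

theorem IsH1.integrable_dirWeight_mul {b : HypChart d → ℝ} (hb : IsTestFn b) (e : HypChart d)
    (hu : IsH1 u Du) :
    Integrable (fun y => dirWeight b u Du y * (height y * ⟪e, Du y⟫)) (hypVolume d) := by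
  have hh := (contDiff_height (d := d) (n := 0)).continuous
  have hY := hb.contDiff_hypGrad
  have hYc := hb.hasCompactSupport_hypGrad
  have c1 : Continuous fun y => height y • hypGrad b y := hh.smul hY.continuous
  have s1 : HasCompactSupport fun y => height y • hypGrad b y :=
    hYc.mono' fun y hy => subset_tsupport _ fun h0 => hy (by simp [h0])
  have c2 : Continuous fun y => 1 / 2 * (height y * hypDiv (hypGrad b) y) :=
    (hh.mul (continuous_hypDiv hY)).const_mul _
  have s2 : HasCompactSupport fun y => 1 / 2 * (height y * hypDiv (hypGrad b) y) :=
    (hasCompactSupport_hypDiv hYc).mono' fun y hy => subset_tsupport _ fun h0 =>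
      hy (by simp [h0])
  refine (((memLp_inner_field c1 s1 hu.meas hu.memLp_coframe).add
    (memLp_bdd_mul c2 s2 hu.memLp)).integrable_mul (hu.memLp_inner_left e)).congr
    (Eventually.of_forall fun y => ?_)
  simp only [Pi.add_apply, Pi.mul_apply, dirWeight, inner_smul_left, RCLike.conj_to_real]
  ring

/-- The space density of the virial identity with multiplier `multField d R`. -/
noncomputable def virial (R : ℝ) (V : HypChart d → ℝ) (F : ℝ → ℝ) (u : HypChart d → ℝ)
    (Du : HypChart d → HypChart d) (y : HypChart d) : ℝ :=
  quadForm d R y (Du y) + 1 / 2 * (height y * lapCoef d R (‖y‖ ^ 2)) * (⟪y, Du y⟫ * u y) +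
    -(1 / 2) * (⟪gradient V y, multField d R y⟫ * u y ^ 2) +
    hypDiv (multField d R) y * (1 / 2 * u y * F (u y) - primitiveOf F (u y))

theorem IsH1.sum_multiplier (hd : 2 ≤ d) (hR : 0 < R) (hu : IsH1 u Du) (hV : ContDiff ℝ 1 V)
    (hVL : MemLp (fun y => V y * u y) 2 (hypVolume d)) (hF : Continuous F)
    (hFu : MemLp (fun y => F (u y)) 2 (hypVolume d)) :
    ∑ j, (∫ y, dirWeight (radialTest d R (EuclideanSpace.basisFun (Fin d) ℝ j)) u Du y *
        (height y * ⟪EuclideanSpace.basisFun (Fin d) ℝ j, Du y⟫) ∂(hypVolume d) +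
      ∫ y, (V y * u y + F (u y)) * multLim (radialTest d R (EuclideanSpace.basisFun (Fin d) ℝ j))
        (EuclideanSpace.basisFun (Fin d) ℝ j) u Du y ∂(hypVolume d)) =
      ∫ y, virial R V F u Du y ∂(hypVolume d) := by
  have hY := contDiff_multField (d := d) R
  have hYc := hasCompactSupport_multField (d := d) hR
  have hb := fun j => isTestFn_radialTest (d := d) hR (EuclideanSpace.basisFun (Fin d) ℝ j)
  have i1 := fun j => hu.integrable_dirWeight_mul (hb j) (EuclideanSpace.basisFun (Fin d) ℝ j)
  have i2 : ∀ j, Integrable (fun y => (V y * u y + F (u y)) *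
      multLim (radialTest d R (EuclideanSpace.basisFun (Fin d) ℝ j))
        (EuclideanSpace.basisFun (Fin d) ℝ j) u Du y) (hypVolume d) := fun j =>
    (hVL.add hFu).integrable_mul (hu.memLp_multLim (hb j) _)
  have hm : MemLp (fun y => ⟪multField d R y, Du y⟫ + 1 / 2 * hypDiv (multField d R) y * u y) 2
      (hypVolume d) := by
    have c2 : Continuous fun y => 1 / 2 * hypDiv (multField d R) y :=
      (continuous_hypDiv hY).const_mul _
    exact (memLp_inner_field hY.continuous hYc hu.meas hu.memLp_coframe).add
      (memLp_bdd_mul c2 (hasCompactSupport_hypDiv hYc).mul_left hu.memLp)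
  have j1 : Integrable (fun y => V y * u y * (⟪multField d R y, Du y⟫ +
      1 / 2 * hypDiv (multField d R) y * u y)) (hypVolume d) := hVL.integrable_mul hm
  have j2 : Integrable (fun y => F (u y) * (⟪multField d R y, Du y⟫ +
      1 / 2 * hypDiv (multField d R) y * u y)) (hypVolume d) := hFu.integrable_mul hm
  have hgc : Continuous fun y => ⟪gradient V y, multField d R y⟫ :=
    (contDiff_gradient (m := 0) hV (by norm_num)).continuous.inner hY.continuous
  have hgcs : HasCompactSupport fun y => ⟪gradient V y, multField d R y⟫ :=
    hYc.mono' fun y hy => subset_tsupport _ fun h0 => hy (by simp [h0])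
  obtain ⟨A, -, hA⟩ := exists_bound_of_hasCompactSupport hgc hgcs
  obtain ⟨B, -, hB⟩ := exists_bound_of_hasCompactSupport (continuous_hypDiv hY)
    (hasCompactSupport_hypDiv hYc)
  have k1 : Integrable (fun y => ⟪gradient V y, multField d R y⟫ * u y ^ 2) (hypVolume d) :=
    hu.memLp.integrable_sq.bdd_mul hgc.aestronglyMeasurable (Eventually.of_forall hA)
  have k2 : Integrable (fun y => hypDiv (multField d R) y *
      (1 / 2 * u y * F (u y) - primitiveOf F (u y))) (hypVolume d) := by
    refine Integrable.bdd_mul ?_ (continuous_hypDiv hY).aestronglyMeasurable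
      (Eventually.of_forall hB)
    refine Integrable.sub ?_ (hu.integrable_primitiveOf hd hF hFu).1
    simp only [mul_assoc]
    exact (hu.memLp.integrable_mul hFu).const_mul _
  rw [Finset.sum_add_distrib, ← integral_finsetSum _ fun j _ => i1 j,
    ← integral_finsetSum _ fun j _ => i2 j]
  simp only [sum_dirWeight, ← Finset.mul_sum, sum_multLim]
  have e1 : ∫ y, (V y * u y + F (u y)) * (⟪multField d R y, Du y⟫ +
      1 / 2 * hypDiv (multField d R) y * u y) ∂(hypVolume d) =
      -(1 / 2) * ∫ y, ⟪gradient V y, multField d R y⟫ * u y ^ 2 ∂(hypVolume d) +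
      ∫ y, hypDiv (multField d R) y * (1 / 2 * u y * F (u y) - primitiveOf F (u y))
        ∂(hypVolume d) := by
    simp only [add_mul]
    rw [integral_add j1 j2, hu.integral_potential hV hY hYc,
      hu.integral_nonlinear hd hF hFu hY hYc]
    ring
  have k0 : Integrable (fun y => quadForm d R y (Du y) +
        1 / 2 * (height y * lapCoef d R (‖y‖ ^ 2)) * (⟪y, Du y⟫ * u y)) (hypVolume d) := by
    refine (integrable_finsetSum Finset.univ fun j _ => i1 j).congr (Eventually.of_forall fun y => ?_)
    simp only [sum_dirWeight]
  have k3 : Integrable (fun y => quadForm d R y (Du y) +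
        1 / 2 * (height y * lapCoef d R (‖y‖ ^ 2)) * (⟪y, Du y⟫ * u y) +
        -(1 / 2) * (⟪gradient V y, multField d R y⟫ * u y ^ 2)) (hypVolume d) :=
    k0.add (k1.const_mul _)
  rw [e1, ← integral_const_mul, ← add_assoc, ← integral_add k0 (k1.const_mul _),
    ← integral_add k3 k2]
  rfl

end FixedTime

/-! ### Measurability of the radial coefficients -/

section Coefficients
variable {d : ℕ}

/-- Every derivative of a real function is measurable, so no continuity of the derivatives of the
profile has to be checked. -/
theorem measurable_prof₁_normSq (R : ℝ) : Measurable fun y : HypChart d => prof₁ d R (‖y‖ ^ 2) := by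
  have : (fun y : HypChart d => prof₁ d R (‖y‖ ^ 2)) = fun y => deriv (prof d R) (‖y‖ ^ 2) :=
    funext fun y => (hasDerivAt_prof R (neg_one_lt_normSq y)).deriv.symm
  rw [this]
  exact (measurable_deriv _).comp (by fun_prop)

theorem measurable_prof₂_normSq (R : ℝ) : Measurable fun y : HypChart d => prof₂ d R (‖y‖ ^ 2) := by
  have : (fun y : HypChart d => prof₂ d R (‖y‖ ^ 2)) = fun y => deriv (prof₁ d R) (‖y‖ ^ 2) :=
    funext fun y => (hasDerivAt_prof₁ R (neg_one_lt_normSq y)).deriv.symm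
  rw [this]
  exact (measurable_deriv _).comp (by fun_prop)

theorem measurable_prof_normSq (R : ℝ) : Measurable fun y : HypChart d => prof d R (‖y‖ ^ 2) :=
  (contDiff_prof_normSq (n := 0) R (by simp)).continuous.measurable

theorem measurable_quadCoef_normSq (R : ℝ) :
    Measurable fun y : HypChart d => quadCoef d R (‖y‖ ^ 2) := by
  have h1 := measurable_prof₁_normSq (d := d) R
  have h2 := measurable_prof_normSq (d := d) R
  unfold quadCoef
  fun_prop

theorem measurable_lapCoef_normSq (R : ℝ) :
    Measurable fun y : HypChart d => lapCoef d R (‖y‖ ^ 2) := by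
  have h1 := measurable_prof₁_normSq (d := d) R
  have h2 := measurable_prof_normSq (d := d) R
  have h3 := measurable_prof₂_normSq (d := d) R
  unfold lapCoef
  fun_prop

end Coefficients

/-! ### The radial derivative of the potential -/

section Radius
variable {d : ℕ}

/-- In the chart ∂_r is cosh r ω, so tanh r ∂_r is the Euler field y, which is regular at the
origin. There the factor tanh 0 = 0 makes the value of `radialDeriv` harmless. -/
theorem tanh_mul_radialDeriv {V : HypChart d → ℝ} (hV : ContDiff ℝ 1 V) (y : HypChart d) :
    Real.tanh (hypRadius y) * radialDeriv V y = ⟪gradient V y, y⟫ := by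
  by_cases hy : y = 0
  · simp [hy, hypRadius]
  have hn : ‖y‖ ≠ 0 := norm_ne_zero_iff.2 hy
  have h1 : HasDerivAt (fun s : ℝ => Real.sinh s • (‖y‖⁻¹ • y))
      (Real.cosh (hypRadius y) • (‖y‖⁻¹ • y)) (hypRadius y) :=
    (Real.hasDerivAt_sinh _).smul_const _
  have h2 : Real.sinh (hypRadius y) • (‖y‖⁻¹ • y) = y := by
    rw [sinh_hypRadius, smul_smul, mul_inv_cancel₀ hn, one_smul]
  have h3 : HasFDerivAt V (fderiv ℝ V y) (Real.sinh (hypRadius y) • (‖y‖⁻¹ • y)) := by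
    rw [h2]; exact (hV.differentiable (by norm_num) y).hasFDerivAt
  have h4 := (h3.comp_hasDerivAt _ h1).deriv
  have h5 : radialDeriv V y = fderiv ℝ V y (Real.cosh (hypRadius y) • (‖y‖⁻¹ • y)) := h4
  have h6 : fderiv ℝ V y y = ⟪gradient V y, y⟫ := by
    rw [gradient_eq_toDual_symm]
    simp
  rw [h5, map_smul, map_smul, Real.tanh_eq_sinh_div_cosh, sinh_hypRadius, ← h6]
  have hc : Real.cosh (hypRadius y) ≠ 0 := (Real.cosh_pos _).ne'
  simp only [smul_eq_mul]
  field_simp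

theorem inner_gradient_nonpos {V : HypChart d → ℝ} (hV : ContDiff ℝ 1 V)
    (hrep : ∀ y, y ≠ 0 → 0 ≤ -radialDeriv V y) (y : HypChart d) : 0 ≤ -⟪gradient V y, y⟫ := by
  by_cases hy : y = 0
  · simp [hy]
  · rw [← tanh_mul_radialDeriv hV, ← mul_neg]
    refine mul_nonneg ?_ (hrep y hy)
    rw [Real.tanh_eq_sinh_div_cosh, sinh_hypRadius, cosh_hypRadius]
    have := height_pos y
    positivity

theorem potDensity_eq {V : HypChart d → ℝ} (hV : ContDiff ℝ 1 V) (u : ℝ → HypChart d → ℝ) :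
    potDensity V u = fun p => -⟪gradient V p.2, p.2⟫ * u p.1 p.2 ^ 2 := by
  funext p
  rw [potDensity, mul_neg, tanh_mul_radialDeriv hV]

end Radius

/-! ### The estimate on a compact time interval -/

theorem integrable_prod_of_bound {α : Type*} [MeasurableSpace α] {μ : Measure α} [SFinite μ]
    {ν : Measure ℝ} [SFinite ν] {f : ℝ × α → ℝ} {B : ℝ → ℝ}
    (hm : AEStronglyMeasurable f (ν.prod μ))
    (hi : ∀ᵐ t ∂ν, Integrable (fun y => f (t, y)) μ ∧ ∫ y, ‖f (t, y)‖ ∂μ ≤ B t)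
    (hB : Integrable B ν) : Integrable f (ν.prod μ) := by
  refine (integrable_prod_iff hm).2 ⟨hi.mono fun t ht => ht.1,
    hB.mono' hm.norm.integral_prod_right' (hi.mono fun t ht => ?_)⟩
  rw [Real.norm_of_nonneg (integral_nonneg fun y => norm_nonneg _)]
  exact ht.2

section Interval
variable {d : ℕ} {V : HypChart d → ℝ} {F : ℝ → ℝ} {u ut : ℝ → HypChart d → ℝ}
  {Du : ℝ → HypChart d → HypChart d} {a c : ℝ}

theorem IsEnergySolution.meas_nonlinDensity {J : Set ℝ} (h : IsEnergySolution V F J u Du ut)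
    (hF : Continuous F) : AEStronglyMeasurable (nonlinDensity F u)
      ((volume.restrict J).prod (hypVolume d)) :=
  ((h.meas_u.const_mul (1 / 2)).mul (h.meas_nonlin hF)).sub
    ((continuous_primitiveOf hF).comp_aestronglyMeasurable h.meas_u)

theorem IsEnergySolution.meas_gradDensity {J : Set ℝ} (h : IsEnergySolution V F J u Du ut) :
    AEStronglyMeasurable (gradDensity Du) ((volume.restrict J).prod (hypVolume d)) := by
  have h1 : Measurable fun p : ℝ × HypChart d => weightSq d (hypRadius p.2) :=
    (measurable_weightSq d).comp
      ((Real.continuous_arsinh.comp (continuous_norm.comp continuous_snd)).measurable)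
  have h2 := h1.aestronglyMeasurable.mul (h.meas_coframe.inner (𝕜 := ℝ) h.meas_coframe)
  simp only [inner_coframe] at h2
  exact h2

theorem IsEnergySolution.meas_potDensity {J : Set ℝ} (h : IsEnergySolution V F J u Du ut)
    (hV : ContDiff ℝ 1 V) :
    AEStronglyMeasurable (potDensity V u) ((volume.restrict J).prod (hypVolume d)) := by
  rw [potDensity_eq hV]
  have hg : Continuous fun p : ℝ × HypChart d => -⟪gradient V p.2, p.2⟫ :=
    (((contDiff_gradient (m := 0) hV (by norm_num)).continuous.comp continuous_snd).inner
      continuous_snd).neg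
  exact hg.aestronglyMeasurable.mul (h.meas_u.pow 2)

theorem IsEnergySolution.integrable_sq (h : IsEnergySolution V F (Icc a c) u Du ut)
    (hd : 2 ≤ d) (hac : a ≤ c) (hV : Continuous V) {B : ℝ}
    (hB : ∀ y, |V y| ≤ B) (hF : Continuous F) :
    Integrable (fun p : ℝ × HypChart d => ‖coframe p.2 (Du p.1 p.2)‖ ^ 2)
      ((volume.restrict (Icc a c)).prod (hypVolume d)) ∧
    Integrable (fun p : ℝ × HypChart d => u p.1 p.2 ^ 2)
      ((volume.restrict (Icc a c)).prod (hypVolume d)) := by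
  obtain ⟨M, p, hM0, hp, hp0, hM, hae⟩ := h.exists_bound hd hac hV hB hF
  constructor
  · refine integrable_prod_of_bound (B := fun _ => M ^ 2) (h.meas_coframe.norm.pow 2) ?_
      (integrable_const _)
    filter_upwards [ae_restrict_mem measurableSet_Icc] with t ht
    have hL := (h.mem_H1 t ht).memLp_coframe
    refine ⟨hL.norm.integrable_sq, ?_⟩
    simp only [norm_pow, norm_norm]
    rw [← lTwo_sq hL.1]
    exact pow_le_pow_left₀ (lTwo_nonneg _) (hM t ht).1 2
  · refine integrable_prod_of_bound (B := fun _ => M ^ 2) (h.meas_u.pow 2) ?_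
      (integrable_const _)
    filter_upwards [ae_restrict_mem measurableSet_Icc] with t ht
    have hL := (h.mem_H1 t ht).memLp
    refine ⟨hL.integrable_sq, ?_⟩
    simp only [norm_pow]
    rw [← lTwo_sq hL.1]
    exact pow_le_pow_left₀ (lTwo_nonneg _) (hM t ht).2.2 2

/-- |N(u)| ≤ |u F(u)| + |G(u)|, and for a.e. t both terms have L¹ norm in space at most M p(t), by
Cauchy–Schwarz and `IsH1.integrable_primitiveOf`. -/
theorem IsEnergySolution.integrable_nonlinDensity (h : IsEnergySolution V F (Icc a c) u Du ut)
    (hd : 2 ≤ d) (hac : a ≤ c) (hV : Continuous V) {B : ℝ}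
    (hB : ∀ y, |V y| ≤ B) (hF : Continuous F) :
    Integrable (nonlinDensity F u) ((volume.restrict (Icc a c)).prod (hypVolume d)) := by
  obtain ⟨M, p, hM0, hp, hp0, hM, hae⟩ := h.exists_bound hd hac hV hB hF
  refine integrable_prod_of_bound (B := fun t => M * p t + p t * M) (h.meas_nonlinDensity hF) ?_
    ((hp.const_mul M).add (hp.mul_const M))
  filter_upwards [hae] with t ⟨ht, hFu, _, hFp, _⟩
  have hu := h.mem_H1 t ht
  obtain ⟨hG, hG'⟩ := hu.integrable_primitiveOf hd hF hFu
  have i1 : Integrable (fun y => u t y * F (u t y)) (hypVolume d) := hu.memLp.integrable_mul hFu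
  have i2 : Integrable (fun y => ‖u t y‖ * ‖F (u t y)‖) (hypVolume d) :=
    hu.memLp.norm.integrable_mul hFu.norm
  have hi : Integrable (fun y => nonlinDensity F u (t, y)) (hypVolume d) := by
    refine ((i1.const_mul (1 / 2)).sub hG).congr (Eventually.of_forall fun y => ?_)
    simp only [nonlinDensity, Pi.sub_apply]; ring
  refine ⟨hi, ?_⟩
  have hle : ∫ y, ‖nonlinDensity F u (t, y)‖ ∂(hypVolume d) ≤
      ∫ y, (‖u t y‖ * ‖F (u t y)‖ + |primitiveOf F (u t y)|) ∂(hypVolume d) := by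
    refine integral_mono hi.norm (i2.add hG.abs) fun y => ?_
    simp only [nonlinDensity, Real.norm_eq_abs, ← abs_mul]
    refine (abs_sub _ _).trans (add_le_add ?_ le_rfl)
    rw [mul_assoc, abs_mul, abs_of_pos (by norm_num : (0 : ℝ) < 1 / 2)]
    linarith [abs_nonneg (u t y * F (u t y))]
  rw [integral_add i2 hG.abs] at hle
  refine hle.trans (add_le_add ?_ ?_)
  · exact (integral_norm_mul_norm_le hu.memLp hFu).trans
      (mul_le_mul (hM t ht).2.2 hFp (lTwo_nonneg _) hM0)
  · exact hG'.trans (mul_le_mul hFp (hM t ht).1 (lTwo_nonneg _) (hp0 t))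

theorem IsEnergySolution.meas_quadForm {J : Set ℝ} (h : IsEnergySolution V F J u Du ut) (R : ℝ) :
    AEStronglyMeasurable (fun p : ℝ × HypChart d => quadForm d R p.2 (Du p.1 p.2))
      ((volume.restrict J).prod (hypVolume d)) := by
  have hh := ((contDiff_height (d := d) (n := 0)).continuous.comp
    (continuous_snd (X := ℝ))).aestronglyMeasurable
    (μ := (volume.restrict J).prod (hypVolume d))
  have h1 : AEStronglyMeasurable (fun p : ℝ × HypChart d => prof d R (‖p.2‖ ^ 2))
      ((volume.restrict J).prod (hypVolume d)) :=
    (measurable_prof_normSq (d := d) R).aestronglyMeasurable.comp_snd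
  have h2 : AEStronglyMeasurable (fun p : ℝ × HypChart d => quadCoef d R (‖p.2‖ ^ 2))
      ((volume.restrict J).prod (hypVolume d)) :=
    (measurable_quadCoef_normSq (d := d) R).aestronglyMeasurable.comp_snd
  have h3 := continuous_snd.aestronglyMeasurable.inner (𝕜 := ℝ) h.meas_Du
  exact hh.mul ((h1.mul (h.meas_Du.norm.pow 2)).add (h2.mul (h3.pow 2)))

/-- The part of `virial` without potential. -/
noncomputable def virialMain (R : ℝ) (F : ℝ → ℝ) (u : HypChart d → ℝ)
    (Du : HypChart d → HypChart d) (y : HypChart d) : ℝ :=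
  quadForm d R y (Du y) + 1 / 2 * (height y * lapCoef d R (‖y‖ ^ 2)) * (⟪y, Du y⟫ * u y) +
    hypDiv (multField d R) y * (1 / 2 * u y * F (u y) - primitiveOf F (u y))

theorem virial_eq (R : ℝ) (V : HypChart d → ℝ) (F : ℝ → ℝ) (u : HypChart d → ℝ)
    (Du : HypChart d → HypChart d) (y : HypChart d) :
    virial R V F u Du y = virialMain R F u Du y +
      -(1 / 2) * (⟪gradient V y, multField d R y⟫ * u y ^ 2) := by
  simp only [virial, virialMain]; ring

theorem IsEnergySolution.meas_virialMain {J : Set ℝ} (h : IsEnergySolution V F J u Du ut)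
    (hF : Continuous F) (R : ℝ) :
    AEStronglyMeasurable (fun p : ℝ × HypChart d => virialMain R F (u p.1) (Du p.1) p.2)
      ((volume.restrict J).prod (hypVolume d)) := by
  have hh := ((contDiff_height (d := d) (n := 0)).continuous.comp
    (continuous_snd (X := ℝ))).aestronglyMeasurable
    (μ := (volume.restrict J).prod (hypVolume d))
  have h2 : AEStronglyMeasurable (fun p : ℝ × HypChart d => lapCoef d R (‖p.2‖ ^ 2))
      ((volume.restrict J).prod (hypVolume d)) :=
    (measurable_lapCoef_normSq (d := d) R).aestronglyMeasurable.comp_snd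
  have h3 := continuous_snd.aestronglyMeasurable.inner (𝕜 := ℝ) h.meas_Du
  have h4 := ((continuous_hypDiv (contDiff_multField (d := d) R)).comp
    (continuous_snd (X := ℝ))).aestronglyMeasurable
    (μ := (volume.restrict J).prod (hypVolume d))
  exact ((h.meas_quadForm R).add (((hh.mul h2).const_mul _).mul (h3.mul h.meas_u))).add
    (h4.mul (h.meas_nonlinDensity hF))

/-- Uniform in the cutoff radius, hence a dominating function for the limit n → ∞. The potential
term is excluded because ∇V is not assumed bounded. -/
theorem exists_virialMain_bound (hd : 2 ≤ d) : ∃ K : ℝ, 0 ≤ K ∧ ∀ (n : ℕ) (F : ℝ → ℝ)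
    (u : HypChart d → ℝ) (Du : HypChart d → HypChart d) (y : HypChart d),
    |virialMain (n + 1) F u Du y| ≤ K * (‖coframe y (Du y)‖ ^ 2 + u y ^ 2 +
      |1 / 2 * u y * F (u y) - primitiveOf F (u y)|) := by
  obtain ⟨C, hC0, hC⟩ := exists_cutBase_bound
  refine ⟨1 + 2 * C + (6 * d + 10) * C, by positivity, fun n F u Du y => ?_⟩
  have hR := one_le_cut_index n
  have h1 := abs_quadForm_le hC hd hR y (Du y)
  have h2 : |height y * lapCoef d (n + 1) (‖y‖ ^ 2)| ≤ (6 * d + 10) * C :=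
    abs_lapCoef_le hC hd hR (sq_nonneg ‖y‖)
  have h3 : |hypDiv (multField d (n + 1)) y| ≤ 1 + 2 * C := by
    rw [hypDiv_multField]; exact abs_divCoef_le hC hd hR (sq_nonneg _)
  have h4 := abs_inner_le_norm_coframe y (Du y)
  set N := 1 / 2 * u y * F (u y) - primitiveOf F (u y)
  set X := ‖coframe y (Du y)‖
  have hX : 0 ≤ X := norm_nonneg _
  have h5 : |⟪y, Du y⟫ * u y| ≤ X ^ 2 + u y ^ 2 := by
    rw [abs_mul, ← sq_abs (u y)]
    have := mul_le_mul_of_nonneg_right h4 (abs_nonneg (u y))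
    nlinarith [sq_nonneg (X - |u y|), abs_nonneg (u y)]
  have h6 : |1 / 2 * (height y * lapCoef d (n + 1) (‖y‖ ^ 2)) * (⟪y, Du y⟫ * u y)| ≤
      (6 * d + 10) * C * (X ^ 2 + u y ^ 2) := by
    rw [abs_mul, abs_mul, abs_of_pos (by norm_num : (0 : ℝ) < 1 / 2)]
    refine mul_le_mul ?_ h5 (abs_nonneg _) (by positivity)
    linarith [abs_nonneg (height y * lapCoef d (n + 1) (‖y‖ ^ 2))]
  have h7 : |hypDiv (multField d (n + 1)) y * N| ≤ (1 + 2 * C) * |N| := by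
    rw [abs_mul]; exact mul_le_mul_of_nonneg_right h3 (abs_nonneg _)
  refine (abs_add_three _ _ _).trans ?_
  have q1 : 0 ≤ (6 * d + 10) * C := by positivity
  have q2 : 0 ≤ 2 * C := by positivity
  nlinarith [abs_nonneg N, sq_nonneg X, sq_nonneg (u y), mul_nonneg q1 (abs_nonneg N),
    mul_nonneg q2 (sq_nonneg (u y)), mul_nonneg q1 (sq_nonneg X)]

/-- The virial identity with a compactly supported radial multiplier. -/
theorem IsEnergySolution.virial_identity (h : IsEnergySolution V F (Icc a c) u Du ut)
    (hd : 2 ≤ d) (hac : a ≤ c) (hV : ContDiff ℝ 1 V) {B : ℝ}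
    (hB : ∀ y, |V y| ≤ B) (hF : Continuous F) {R : ℝ} (hR : 0 < R) :
    ∫ t in Icc a c, ∫ y, virial R V F (u t) (Du t) y ∂(hypVolume d) =
      ∫ y, ut a y * (⟪multField d R y, Du a y⟫ + 1 / 2 * hypDiv (multField d R) y * u a y)
        ∂(hypVolume d) -
      ∫ y, ut c y * (⟪multField d R y, Du c y⟫ + 1 / 2 * hypDiv (multField d R) y * u c y)
        ∂(hypVolume d) := by
  obtain ⟨M, p, hM0, hp, hp0, hM, hae⟩ := h.exists_bound hd hac hV.continuous hB hF
  have hb := fun j => isTestFn_radialTest (d := d) hR (EuclideanSpace.basisFun (Fin d) ℝ j)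
  have key := fun j => h.multLim_identity hd hac hV.continuous hB hF
    ((EuclideanSpace.basisFun (Fin d) ℝ).norm_eq_one j) (hb j)
  have haI := left_mem_Icc.2 hac
  have hcI := right_mem_Icc.2 hac
  have hsum : ∀ t ∈ Icc a c, ∑ j, ∫ y, ut t y *
      multLim (radialTest d R (EuclideanSpace.basisFun (Fin d) ℝ j))
        (EuclideanSpace.basisFun (Fin d) ℝ j) (u t) (Du t) y ∂(hypVolume d) =
      ∫ y, ut t y * (⟪multField d R y, Du t y⟫ + 1 / 2 * hypDiv (multField d R) y * u t y)
        ∂(hypVolume d) := fun t ht => by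
    have i2 : ∀ j, Integrable (fun y => ut t y *
      multLim (radialTest d R (EuclideanSpace.basisFun (Fin d) ℝ j))
        (EuclideanSpace.basisFun (Fin d) ℝ j) (u t) (Du t) y) (hypVolume d) := fun j =>
      (h.mem_L2 t ht).integrable_mul ((h.mem_H1 t ht).memLp_multLim (hb j) _)
    rw [← integral_finsetSum _ fun j _ => i2 j]
    simp only [← Finset.mul_sum, sum_multLim]
  have hfin := Finset.sum_congr rfl fun j (_ : j ∈ Finset.univ) => (key j).2
  rw [Finset.sum_sub_distrib, hsum c hcI, hsum a haI, Finset.sum_neg_distrib,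
    ← intervalIntegral.integral_finsetSum fun j _ =>
      intervalIntegrable_of_Icc (key j).1 haI hcI] at hfin
  have e1 : ∫ t in Icc a c, ∫ y, virial R V F (u t) (Du t) y ∂(hypVolume d) =
      ∫ t in a..c, ∑ j, (∫ y, dirWeight (radialTest d R (EuclideanSpace.basisFun (Fin d) ℝ j))
        (u t) (Du t) y * (height y * ⟪EuclideanSpace.basisFun (Fin d) ℝ j, Du t y⟫)
          ∂(hypVolume d) +
        ∫ y, forcing V F u t y *
          multLim (radialTest d R (EuclideanSpace.basisFun (Fin d) ℝ j))
            (EuclideanSpace.basisFun (Fin d) ℝ j) (u t) (Du t) y ∂(hypVolume d)) := by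
    rw [intervalIntegral.integral_of_le hac, ← integral_Icc_eq_integral_Ioc]
    refine integral_congr_ae ?_
    filter_upwards [hae] with t ⟨ht, hFu, hf, _, _⟩
    refine ((h.mem_H1 t ht).sum_multiplier hd hR hV ?_ hF hFu).symm
    refine (hf.sub hFu).ae_eq (Eventually.of_forall fun y => ?_)
    simp [forcing]
  rw [e1]
  linarith

/-- From |X_n u| ≤ |∇u|, |div X_n| ≤ C and the Poincaré inequality, the multiplier has L² norm at
most (1+C)‖∇u‖; then 2ab ≤ a² + b². -/
theorem IsH1.abs_momentum_le (hd : 2 ≤ d) {C : ℝ} {n : ℕ}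
    (hC : ∀ y : HypChart d, |hypDiv (multField d (n + 1)) y| ≤ C) {u w : HypChart d → ℝ}
    {Du : HypChart d → HypChart d} (hu : IsH1 u Du) (hw : MemLp w 2 (hypVolume d)) :
    |∫ y, w y * (⟪multField d (n + 1) y, Du y⟫ +
      1 / 2 * hypDiv (multField d (n + 1)) y * u y) ∂(hypVolume d)| ≤
      (1 + C) / 2 * (lTwo (hypVolume d) (fun y => coframe y (Du y)) ^ 2 +
        lTwo (hypVolume d) w ^ 2) := by
  have hC0 : 0 ≤ C := (abs_nonneg _).trans (hC 0)
  have hc := hasCompactSupport_multField (d := d) (cut_index_pos n)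
  have hY := contDiff_multField (d := d) ((n : ℝ) + 1)
  have m1 := memLp_inner_field hY.continuous hc hu.meas hu.memLp_coframe
  have n1 := lTwo_le_of_norm_le (f := fun y => ⟪multField d (n + 1) y, Du y⟫) zero_le_one
    hu.memLp_coframe fun y => by rw [one_mul]; exact abs_inner_multField_le hd _ _ _
  have c2 : Continuous fun y : HypChart d => 1 / 2 * hypDiv (multField d (n + 1)) y :=
    (continuous_hypDiv hY).const_mul _
  have m2 := memLp_bdd_mul c2 (hasCompactSupport_hypDiv hc).mul_left hu.memLp
  have n2 := lTwo_le_of_norm_le (f := fun y => 1 / 2 * hypDiv (multField d (n + 1)) y * u y)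
    (c := 1 / 2 * C) (by positivity) hu.memLp fun y => by
      rw [norm_mul, norm_mul, Real.norm_of_nonneg (by norm_num : (0 : ℝ) ≤ 1 / 2)]
      exact mul_le_mul_of_nonneg_right (mul_le_mul_of_nonneg_left (hC y) (by norm_num))
        (norm_nonneg _)
  have n3 := mul_le_mul_of_nonneg_left (hu.lTwo_le hd) (by positivity : 0 ≤ 1 / 2 * C)
  have n4 := lTwo_add_le m1 m2
  have n5 := abs_integral_mul_le hw (m1.add m2)
  refine n5.trans ?_
  set X := lTwo (hypVolume d) (fun y => coframe y (Du y))
  have hX : 0 ≤ X := lTwo_nonneg _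
  have hW : 0 ≤ lTwo (hypVolume d) w := lTwo_nonneg _
  have n6 := mul_le_mul_of_nonneg_left (n4.trans (by linarith :
    _ ≤ (1 + C) * X)) hW
  refine n6.trans ?_
  nlinarith [mul_nonneg (by positivity : 0 ≤ 1 + C) (sq_nonneg (X - lTwo (hypVolume d) w))]

/-- The integrated local energy decay estimate on a compact interval. -/
theorem exists_interval_estimate (hd : 2 ≤ d) : ∃ K : ℝ, 0 ≤ K ∧ ∀ (V : HypChart d → ℝ)
    (F : ℝ → ℝ) (u : ℝ → HypChart d → ℝ) (Du : ℝ → HypChart d → HypChart d)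
    (ut : ℝ → HypChart d → ℝ) (a c B E : ℝ), ContDiff ℝ 1 V → (∀ y, |V y| ≤ B) →
    (∀ y, y ≠ 0 → 0 ≤ -radialDeriv V y) → Continuous F → a ≤ c →
    IsEnergySolution V F (Icc a c) u Du ut →
    (∀ t ∈ Icc a c, lTwo (hypVolume d) (fun y => coframe y (Du t y)) ^ 2 +
      lTwo (hypVolume d) (ut t) ^ 2 ≤ E) →
    Integrable (gradDensity Du) ((volume.restrict (Icc a c)).prod (hypVolume d)) ∧
    Integrable (potDensity V u) ((volume.restrict (Icc a c)).prod (hypVolume d)) ∧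
    ∫ p, (gradDensity Du p + 1 / (2 * d) * potDensity V u p + nonlinDensity F u p)
      ∂((volume.restrict (Icc a c)).prod (hypVolume d)) ≤ K * E := by
  obtain ⟨C, hC0, hC⟩ := exists_bound_hypDiv hd
  obtain ⟨K, hK0, hK⟩ := exists_virialMain_bound hd
  -- Each of the two endpoint momenta contributes (1+C)/2 times the energy.
  refine ⟨1 + C, by positivity, fun V F u Du ut a c B E hV hB hrep hF hac h hE => ?_⟩
  set π := (volume.restrict (Icc a c)).prod (hypVolume d)
  obtain ⟨hi1, hi2⟩ := h.integrable_sq hd hac hV.continuous hB hF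
  have hiN := h.integrable_nonlinDensity hd hac hV.continuous hB hF
  have haI := left_mem_Icc.2 hac
  have hcI := right_mem_Icc.2 hac
  -- A n gathers the terms with a dominating function independent of n; P n is the potential term,
  -- of which only the sign is controlled uniformly.
  let A : ℕ → ℝ × HypChart d → ℝ := fun n p => virialMain (n + 1) F (u p.1) (Du p.1) p.2
  let P : ℕ → ℝ × HypChart d → ℝ := fun n p =>
    -(1 / 2) * (⟪gradient V p.2, multField d (n + 1) p.2⟫ * u p.1 p.2 ^ 2)
  have hdom : Integrable (fun p : ℝ × HypChart d => K * (‖coframe p.2 (Du p.1 p.2)‖ ^ 2 +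
      u p.1 p.2 ^ 2 + |nonlinDensity F u p|)) π := ((hi1.add hi2).add hiN.abs).const_mul K
  have hAm := fun n : ℕ => h.meas_virialMain hF ((n : ℝ) + 1)
  have hAle : ∀ n p, ‖A n p‖ ≤ K * (‖coframe p.2 (Du p.1 p.2)‖ ^ 2 +
      u p.1 p.2 ^ 2 + |nonlinDensity F u p|) := fun n p => hK n F (u p.1) (Du p.1) p.2
  have hAi : ∀ n, Integrable (A n) π := fun n =>
    hdom.mono' (hAm n) (Eventually.of_forall (hAle n))
  have hPi : ∀ n, Integrable (P n) π := fun n => by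
    have hY := contDiff_multField (d := d) ((n : ℝ) + 1)
    have hYc := hasCompactSupport_multField (d := d) (cut_index_pos n)
    have hgc : Continuous fun y => ⟪gradient V y, multField d (n + 1) y⟫ :=
      (contDiff_gradient (m := 0) hV (by norm_num)).continuous.inner hY.continuous
    have hgcs : HasCompactSupport fun y => ⟪gradient V y, multField d (n + 1) y⟫ :=
      hYc.mono' fun y hy => subset_tsupport _ fun h0 => hy (by simp [h0])
    obtain ⟨D, -, hD⟩ := exists_bound_of_hasCompactSupport hgc hgcs
    exact (hi2.bdd_mul (hgc.comp continuous_snd).aestronglyMeasurable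
      (Eventually.of_forall fun p => hD p.2)).const_mul _
  have hP0 : ∀ n p, 0 ≤ P n p := fun n p => by
    have h1 := sqrt_mul_prof_nonneg (d := d) ((n : ℝ) + 1) (sq_nonneg ‖p.2‖)
    have h2 := inner_gradient_nonpos hV hrep p.2
    have e : P n p = 1 / 2 * ((√(1 + ‖p.2‖ ^ 2) * prof d (n + 1) (‖p.2‖ ^ 2)) *
        (-⟪gradient V p.2, p.2⟫)) * u p.1 p.2 ^ 2 := by
      simp only [P, multField, inner_smul_right, height]; ring
    rw [e]; positivity
  have hbal : ∀ n, ∫ p, A n p ∂π + ∫ p, P n p ∂π ≤ (1 + C) * E := fun n => by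
    rw [← integral_add (hAi n) (hPi n)]
    have hint : Integrable (fun p : ℝ × HypChart d =>
        virial (n + 1) V F (u p.1) (Du p.1) p.2) π :=
      ((hAi n).add (hPi n)).congr (Eventually.of_forall fun p =>
        (virial_eq _ V F (u p.1) (Du p.1) p.2).symm)
    have e : ∫ p, (A n p + P n p) ∂π = ∫ p : ℝ × HypChart d,
        virial (n + 1) V F (u p.1) (Du p.1) p.2 ∂π :=
      integral_congr_ae (Eventually.of_forall fun p =>
        (virial_eq _ V F (u p.1) (Du p.1) p.2).symm)
    rw [e, integral_prod _ hint, h.virial_identity hd hac hV hB hF (cut_index_pos n)]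
    have m1 := (h.mem_H1 a haI).abs_momentum_le hd (hC n) (h.mem_L2 a haI)
    have m2 := (h.mem_H1 c hcI).abs_momentum_le hd (hC n) (h.mem_L2 c hcI)
    have q1 := mul_le_mul_of_nonneg_left (hE a haI) (by positivity : 0 ≤ (1 + C) / 2)
    have q2 := mul_le_mul_of_nonneg_left (hE c hcI) (by positivity : 0 ≤ (1 + C) / 2)
    have r1 := (le_abs_self _).trans m1
    have r2 := (neg_le_abs _).trans m2
    linarith
  have hAlim : ∀ p, Tendsto (fun n => A n p) atTop
      (𝓝 (quadLim p.2 (Du p.1 p.2) + nonlinDensity F u p)) := fun p => by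
    refine tendsto_const_nhds.congr' ?_
    filter_upwards [eventually_quadForm p.2 (Du p.1 p.2),
      eventually_coef hd (sq_nonneg ‖p.2‖)] with n h1 h2
    have h3 : height p.2 * lapCoef d (n + 1) (‖p.2‖ ^ 2) = 0 := h2.2.2
    simp only [A, virialMain, h1, h3, hypDiv_multField, h2.2.1, nonlinDensity]
    ring
  have hlim : Tendsto (fun n => ∫ p, A n p ∂π) atTop
      (𝓝 (∫ p, (quadLim p.2 (Du p.1 p.2) + nonlinDensity F u p) ∂π)) :=
    tendsto_integral_of_dominated_convergence _ hAm hdom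
      (fun n => Eventually.of_forall (hAle n)) (Eventually.of_forall hAlim)
  have hLi : Integrable (fun p : ℝ × HypChart d =>
      quadLim p.2 (Du p.1 p.2) + nonlinDensity F u p) π :=
    hdom.mono' (aestronglyMeasurable_of_tendsto_ae atTop hAm (Eventually.of_forall hAlim))
      (Eventually.of_forall fun p => le_of_tendsto' (hAlim p).norm fun n => hAle n p)
  have hGi : Integrable (gradDensity Du) π := by
    refine hi1.mono' h.meas_gradDensity (Eventually.of_forall fun p => ?_)
    have h0 := weightSq_nonneg p.2 hd
    have h1 := (weightSq_mul_le_quadLim hd p.2 (Du p.1 p.2)).trans (quadLim_le hd _ _)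
    rw [gradDensity, Real.norm_of_nonneg]
    · exact h1
    · rw [← inner_coframe, real_inner_self_eq_norm_sq]; positivity
  set S := ∫ p, (quadLim p.2 (Du p.1 p.2) + nonlinDensity F u p) ∂π
  have hd0 : (0 : ℝ) < d := by exact_mod_cast (by omega : 0 < d)
  have hpot0 : ∀ p, 0 ≤ 1 / (2 * d) * potDensity V u p := fun p => by
    rw [potDensity_eq hV]
    have := inner_gradient_nonpos hV hrep p.2
    positivity
  have hpot : ∀ p, ∀ᶠ n in atTop, 1 / (2 * d) * potDensity V u p ≤ P n p := fun p => by
    filter_upwards [eventually_coef hd (sq_nonneg ‖p.2‖)] with n hn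
    have h1 := one_le_mul_sqrt_mul_kap hd (sq_nonneg ‖p.2‖)
    have h2 := inner_gradient_nonpos hV hrep p.2
    have e : P n p = 1 / 2 * (√(1 + ‖p.2‖ ^ 2) * kap d (‖p.2‖ ^ 2)) *
        (-⟪gradient V p.2, p.2⟫ * u p.1 p.2 ^ 2) := by
      simp only [P, multField, inner_smul_right, height, hn.1]; ring
    rw [e, potDensity_eq hV]
    refine mul_le_mul_of_nonneg_right ?_ (by positivity)
    rw [div_le_iff₀ (by positivity)]
    linarith
  have hSE : 0 ≤ (1 + C) * E - S := by
    refine ge_of_tendsto' (hlim.const_sub ((1 + C) * E)) fun n => ?_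
    have : 0 ≤ ∫ p, P n p ∂π := integral_nonneg fun p => hP0 n p
    linarith [hbal n]
  -- The virial balance bounds ∫ P n by (1+C)E - ∫ A n, whose limit is known. At each point P n
  -- eventually exceeds the potential density times 1/(2d), because d √(1+x) κ ≥ 1, and Fatou's
  -- lemma concludes.
  have hFatou : ∫⁻ p, ENNReal.ofReal (1 / (2 * d) * potDensity V u p) ∂π ≤
      ENNReal.ofReal ((1 + C) * E - S) := by
    have t1 : Tendsto (fun n => ENNReal.ofReal ((1 + C) * E - ∫ p, A n p ∂π)) atTop
        (𝓝 (ENNReal.ofReal ((1 + C) * E - S))) :=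
      ENNReal.tendsto_ofReal (hlim.const_sub _)
    calc _ ≤ ∫⁻ p, liminf (fun n => ENNReal.ofReal (P n p)) atTop ∂π :=
          lintegral_mono fun p => le_liminf_of_le (by isBoundedDefault)
            ((hpot p).mono fun n hn => ENNReal.ofReal_le_ofReal hn)
      _ ≤ liminf (fun n => ∫⁻ p, ENNReal.ofReal (P n p) ∂π) atTop :=
          lintegral_liminf_le' fun n => (hPi n).1.aemeasurable.ennreal_ofReal
      _ ≤ liminf (fun n => ENNReal.ofReal ((1 + C) * E - ∫ p, A n p ∂π)) atTop := by
          refine liminf_le_liminf (Eventually.of_forall fun n => ?_)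
          rw [← ofReal_integral_eq_lintegral_ofReal (hPi n) (Eventually.of_forall (hP0 n))]
          exact ENNReal.ofReal_le_ofReal (by linarith [hbal n])
      _ = _ := t1.liminf_eq
  have hpm : AEStronglyMeasurable (fun p => 1 / (2 * d) * potDensity V u p) π :=
    (h.meas_potDensity hV).const_mul _
  have hpi : Integrable (fun p => 1 / (2 * d) * potDensity V u p) π :=
    ⟨hpm, (hasFiniteIntegral_iff_ofReal (Eventually.of_forall hpot0)).2
      (hFatou.trans_lt ENNReal.ofReal_lt_top)⟩
  have hple : ∫ p, 1 / (2 * d) * potDensity V u p ∂π ≤ (1 + C) * E - S := by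
    rw [← ofReal_integral_eq_lintegral_ofReal hpi (Eventually.of_forall hpot0)] at hFatou
    exact (ENNReal.ofReal_le_ofReal_iff hSE).1 hFatou
  refine ⟨hGi, ?_, ?_⟩
  · refine (hpi.const_mul (2 * d)).congr (Eventually.of_forall fun p => ?_)
    simp only
    field_simp
  · have hle : ∫ p, (gradDensity Du p + nonlinDensity F u p) ∂π ≤ S :=
      integral_mono (hGi.add hiN) hLi fun p =>
        add_le_add (weightSq_mul_le_quadLim hd p.2 (Du p.1 p.2)) le_rfl
    have e : ∫ p, (gradDensity Du p + 1 / (2 * d) * potDensity V u p + nonlinDensity F u p) ∂π =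
        ∫ p, (gradDensity Du p + nonlinDensity F u p) ∂π +
          ∫ p, 1 / (2 * d) * potDensity V u p ∂π := by
      have hGN : Integrable (fun p => gradDensity Du p + nonlinDensity F u p) π := hGi.add hiN
      rw [← integral_add hGN hpi]
      exact integral_congr_ae (Eventually.of_forall fun p => by simp only; ring)
    rw [e]
    linarith

end Interval

/-! ### Exhaustion of the time interval -/

/-- Up to its endpoints, which are null, J is the union of the compact intervals whose ends belong
to a dense sequence of J. This countable family is directed, so monotone convergence applies. -/
theorem lintegral_restrict_prod_le {α : Type*} [MeasurableSpace α] {μ : Measure α} [SFinite μ]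
    {J : Set ℝ} (hJ : J.OrdConnected) {f : ℝ × α → ℝ≥0∞} {K : ℝ≥0∞}
    (h : ∀ a ∈ J, ∀ c ∈ J, a ≤ c → ∫⁻ p, f p ∂((volume.restrict (Icc a c)).prod μ) ≤ K) :
    ∫⁻ p, f p ∂((volume.restrict J).prod μ) ≤ K := by
  rcases J.eq_empty_or_nonempty with rfl | hne
  · simp
  have : Nonempty J := hne.to_subtype
  let x : ℕ → J := TopologicalSpace.denseSeq J
  let S : ℕ × ℕ → Set ℝ := fun k => Icc (x k.1 : ℝ) (x k.2)
  have hsub : ⋃ k, S k ⊆ J := iUnion_subset fun k => hJ.out (x k.1).2 (x k.2).2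
  have hdiff : J \ ⋃ k, S k ⊆ {t | IsLeast J t} ∪ {t | IsGreatest J t} := by
    rintro t ⟨ht, hn⟩
    by_contra hcon
    rw [mem_union, not_or] at hcon
    obtain ⟨h1, h2⟩ := hcon
    have h1' : ∃ s ∈ J, s < t := by
      by_contra! hc
      exact h1 ⟨ht, hc⟩
    have h2' : ∃ s ∈ J, t < s := by
      by_contra! hc
      exact h2 ⟨ht, hc⟩
    obtain ⟨s₁, hs₁, hlt₁⟩ := h1'
    obtain ⟨s₂, hs₂, hlt₂⟩ := h2'
    have hd := TopologicalSpace.denseRange_denseSeq J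
    obtain ⟨i, hi⟩ := hd.exists_mem_open
      (isOpen_Iio.preimage (continuous_subtype_val (p := (· ∈ J))) : IsOpen (Subtype.val ⁻¹' Iio t))
      ⟨⟨s₁, hs₁⟩, hlt₁⟩
    obtain ⟨j, hj⟩ := hd.exists_mem_open
      (isOpen_Ioi.preimage (continuous_subtype_val (p := (· ∈ J))) : IsOpen (Subtype.val ⁻¹' Ioi t))
      ⟨⟨s₂, hs₂⟩, hlt₂⟩
    exact hn (mem_iUnion.2 ⟨(i, j), le_of_lt hi, le_of_lt hj⟩)
  have hnull : volume (J \ ⋃ k, S k) = 0 := by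
    refine measure_mono_null hdiff (measure_union_null ?_ ?_)
    · exact Subsingleton.measure_zero (fun s hs t ht => hs.unique ht) _
    · exact Subsingleton.measure_zero (fun s hs t ht => hs.unique ht) _
  have hae : J =ᵐ[volume] ⋃ k, S k :=
    (ae_le_set.2 hnull).antisymm (LE.le.eventuallyLE hsub)
  have hprod : ∀ U : Set ℝ, (volume.restrict U).prod μ = (volume.prod μ).restrict (U ×ˢ univ) :=
    fun U => by rw [← Measure.prod_restrict, Measure.restrict_univ]
  have hdir : Directed (· ⊆ ·) fun k => S k ×ˢ (univ : Set α) := by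
    rintro ⟨i, j⟩ ⟨i', j'⟩
    rcases le_total (x i) (x i') with hi | hi <;> rcases le_total (x j) (x j') with hj | hj
    · exact ⟨(i, j'), prod_mono (Icc_subset_Icc le_rfl hj) le_rfl,
        prod_mono (Icc_subset_Icc hi le_rfl) le_rfl⟩
    · exact ⟨(i, j), prod_mono (Icc_subset_Icc le_rfl le_rfl) le_rfl,
        prod_mono (Icc_subset_Icc hi hj) le_rfl⟩
    · exact ⟨(i', j'), prod_mono (Icc_subset_Icc hi hj) le_rfl,
        prod_mono (Icc_subset_Icc le_rfl le_rfl) le_rfl⟩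
    · exact ⟨(i', j), prod_mono (Icc_subset_Icc hi le_rfl) le_rfl,
        prod_mono (Icc_subset_Icc le_rfl hj) le_rfl⟩
  rw [Measure.restrict_congr_set hae, hprod, iUnion_prod_const,
    setLIntegral_iUnion_of_directed _ hdir]
  refine iSup_le fun k => ?_
  rw [← hprod]
  rcases le_or_gt (x k.1 : ℝ) (x k.2) with hk | hk
  · exact h _ (x k.1).2 _ (x k.2).2 hk
  · simp [S, Icc_eq_empty (not_le.2 hk)]

section Main
variable {d : ℕ} {V : HypChart d → ℝ} {F : ℝ → ℝ} {u ut : ℝ → HypChart d → ℝ}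
  {Du : ℝ → HypChart d → HypChart d} {J : Set ℝ}

theorem gradDensity_nonneg (hd : 2 ≤ d) (Du : ℝ → HypChart d → HypChart d) (p : ℝ × HypChart d) :
    0 ≤ gradDensity Du p := by
  have := weightSq_nonneg p.2 hd
  rw [gradDensity, ← inner_coframe, real_inner_self_eq_norm_sq]
  positivity

theorem potDensity_nonneg (hV : ContDiff ℝ 1 V) (hrep : ∀ y, y ≠ 0 → 0 ≤ -radialDeriv V y)
    (u : ℝ → HypChart d → ℝ) (p : ℝ × HypChart d) : 0 ≤ potDensity V u p := by
  rw [potDensity_eq hV]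
  have := inner_gradient_nonpos hV hrep p.2
  positivity

theorem IsEnergySolution.lTwo_sq_add_le (h : IsEnergySolution V F J u Du ut)
    (hE : energySupSq J Du ut < ⊤) {t : ℝ} (ht : t ∈ J) :
    lTwo (hypVolume d) (fun y => coframe y (Du t y)) ^ 2 + lTwo (hypVolume d) (ut t) ^ 2 ≤
      (energySupSq J Du ut).toReal := by
  have h1 : energyNormSq (Du t) (ut t) ≤ energySupSq J Du ut :=
    le_iSup₂ (f := fun t (_ : t ∈ J) => energyNormSq (Du t) (ut t)) t ht
  rw [energyNormSq_eq (h.mem_H1 t ht).memLp_coframe (h.mem_L2 t ht)] at h1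
  exact (ENNReal.ofReal_le_iff_le_toReal hE.ne).1 h1

/-- The estimate without sign condition on the nonlinearity. -/
theorem exists_estimate (hd : 2 ≤ d) : ∃ K : ℝ, 0 ≤ K ∧ ∀ (V : HypChart d → ℝ)
    (F : ℝ → ℝ) (J : Set ℝ) (u : ℝ → HypChart d → ℝ) (Du : ℝ → HypChart d → HypChart d)
    (ut : ℝ → HypChart d → ℝ), ContDiff ℝ 1 V → (∃ B : ℝ, ∀ y, |V y| ≤ B) →
    (∀ y, y ≠ 0 → 0 ≤ -radialDeriv V y) → Continuous F → J.OrdConnected →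
    IsEnergySolution V F J u Du ut → energySupSq J Du ut < ⊤ →
    Integrable (fun p => max (-nonlinDensity F u p) 0)
      ((volume.restrict J).prod (hypVolume d)) →
    Integrable (gradDensity Du) ((volume.restrict J).prod (hypVolume d)) ∧
    Integrable (potDensity V u) ((volume.restrict J).prod (hypVolume d)) ∧
    Integrable (nonlinDensity F u) ((volume.restrict J).prod (hypVolume d)) ∧
    ∫ p, (gradDensity Du p + 1 / (2 * d) * potDensity V u p + nonlinDensity F u p)
      ∂((volume.restrict J).prod (hypVolume d)) ≤ K * (energySupSq J Du ut).toReal := by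
  obtain ⟨K, hK0, hK⟩ := exists_interval_estimate hd
  refine ⟨K, hK0, fun V F J u Du ut hV ⟨B, hB⟩ hrep hF hJ h hE hneg => ?_⟩
  set E := (energySupSq J Du ut).toReal
  set π := (volume.restrict J).prod (hypVolume d)
  have hd0 : (0 : ℝ) < d := by exact_mod_cast (by omega : 0 < d)
  -- Replacing N by its positive part gives a nonnegative density, to which exhaustion by compact
  -- intervals applies. The negative part, integrable by hypothesis, costs the constant I, which
  -- cancels at the end.
  let f : ℝ × HypChart d → ℝ := fun p =>
    gradDensity Du p + 1 / (2 * d) * potDensity V u p + max (nonlinDensity F u p) 0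
  have hg0 := gradDensity_nonneg hd Du
  have hp0 : ∀ p, 0 ≤ 1 / (2 * d) * potDensity V u p := fun p =>
    mul_nonneg (by positivity) (potDensity_nonneg hV hrep u p)
  have hf0 : ∀ p, 0 ≤ f p := fun p =>
    add_nonneg (add_nonneg (hg0 p) (hp0 p)) (le_max_right _ _)
  have hfeq : ∀ p, f p = (gradDensity Du p + 1 / (2 * d) * potDensity V u p +
      nonlinDensity F u p) + max (-nonlinDensity F u p) 0 := fun p => by
    have : max (nonlinDensity F u p) 0 = nonlinDensity F u p + max (-nonlinDensity F u p) 0 := by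
      rcases le_total 0 (nonlinDensity F u p) with h0 | h0
      · rw [max_eq_left h0, max_eq_right (by linarith), add_zero]
      · rw [max_eq_right h0, max_eq_left (by linarith)]; ring
    simp only [f, this]; ring
  set I := ∫ p, max (-nonlinDensity F u p) 0 ∂π
  have hbound : ∫⁻ p, ENNReal.ofReal (f p) ∂π ≤ ENNReal.ofReal (K * E + I) := by
    refine lintegral_restrict_prod_le hJ fun a ha c hc hac => ?_
    have hsub : Icc a c ⊆ J := hJ.out ha hc
    have h' := h.mono hsub
    have hμ : (volume.restrict (Icc a c)).prod (hypVolume d) ≤ π :=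
      Measure.prod_mono (Measure.restrict_mono hsub le_rfl) le_rfl
    obtain ⟨i1, i2, i3⟩ := hK V F u Du ut a c B E hV hB hrep hF hac h'
      fun t ht => h.lTwo_sq_add_le hE (hsub ht)
    have iN := h'.integrable_nonlinDensity hd hac hV.continuous hB hF
    have isum : Integrable (fun p => gradDensity Du p + 1 / (2 * d) * potDensity V u p +
        nonlinDensity F u p) ((volume.restrict (Icc a c)).prod (hypVolume d)) :=
      (i1.add (i2.const_mul _)).add iN
    have ineg := hneg.mono_measure hμ
    have hfi : Integrable f ((volume.restrict (Icc a c)).prod (hypVolume d)) :=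
      (isum.add ineg).congr (Eventually.of_forall fun p => (hfeq p).symm)
    rw [← ofReal_integral_eq_lintegral_ofReal hfi (Eventually.of_forall hf0)]
    refine ENNReal.ofReal_le_ofReal ?_
    simp only [hfeq]
    rw [integral_add isum ineg]
    refine add_le_add i3 (integral_mono_measure hμ
      (Eventually.of_forall fun p => le_max_right _ _) hneg)
  have hgm := h.meas_gradDensity
  have hpm := h.meas_potDensity hV
  have hNm := h.meas_nonlinDensity hF
  have hNpm : AEStronglyMeasurable (fun p => max (nonlinDensity F u p) 0) π :=
    (continuous_id.max continuous_const).comp_aestronglyMeasurable hNm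
  have hfm : AEStronglyMeasurable f π := (hgm.add (hpm.const_mul _)).add hNpm
  have hfi : Integrable f π := ⟨hfm, (hasFiniteIntegral_iff_ofReal (Eventually.of_forall hf0)).2
    (hbound.trans_lt ENNReal.ofReal_lt_top)⟩
  have hgi : Integrable (gradDensity Du) π :=
    hfi.mono' hgm (Eventually.of_forall fun p => by
      rw [Real.norm_of_nonneg (hg0 p)]
      have := hp0 p
      have := le_max_right (nonlinDensity F u p) 0
      simp only [f]; linarith)
  have hpi : Integrable (fun p => 1 / (2 * d) * potDensity V u p) π :=
    hfi.mono' (hpm.const_mul _) (Eventually.of_forall fun p => by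
      rw [Real.norm_of_nonneg (hp0 p)]
      have := hg0 p
      have := le_max_right (nonlinDensity F u p) 0
      simp only [f]; linarith)
  have hNi : Integrable (nonlinDensity F u) π := by
    refine (hfi.add hneg).mono' hNm (Eventually.of_forall fun p => ?_)
    have := hg0 p
    have := hp0 p
    have := le_max_left (nonlinDensity F u p) 0
    have := le_max_right (nonlinDensity F u p) 0
    have := le_max_left (-nonlinDensity F u p) 0
    have := le_max_right (-nonlinDensity F u p) 0
    simp only [Pi.add_apply, f, Real.norm_eq_abs]
    rw [abs_le]
    constructor <;> linarith
  have hpi' : Integrable (potDensity V u) π := by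
    refine (hpi.const_mul (2 * d)).congr (Eventually.of_forall fun p => ?_)
    simp only
    field_simp
  refine ⟨hgi, hpi', hNi, ?_⟩
  have hsum : Integrable (fun p => gradDensity Du p + 1 / (2 * d) * potDensity V u p +
      nonlinDensity F u p) π := (hgi.add hpi).add hNi
  have hle : ∫ p, f p ∂π ≤ K * E + I := by
    rw [← ofReal_integral_eq_lintegral_ofReal hfi (Eventually.of_forall hf0)] at hbound
    refine (ENNReal.ofReal_le_ofReal_iff ?_).1 hbound
    have : 0 ≤ I := integral_nonneg fun p => le_max_right _ _
    have : 0 ≤ E := ENNReal.toReal_nonneg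
    positivity
  simp only [hfeq] at hle
  rw [integral_add hsum hneg] at hle
  linarith

end Main

theorem lemma10p1 (d : ℕ) (hd : 2 ≤ d) :
    (∀ r : ℝ, 0 < r → 0 < weightSq d r) ∧
    ∃ C : ℝ, ∀ (V : HypChart d → ℝ) (F : ℝ → ℝ) (J : Set ℝ)
      (u : ℝ → HypChart d → ℝ) (Du : ℝ → HypChart d → HypChart d) (ut : ℝ → HypChart d → ℝ),
      ContDiff ℝ 1 V → (∃ B : ℝ, ∀ y, |V y| ≤ B) → (∀ y, y ≠ 0 → 0 ≤ -radialDeriv V y) →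
      Continuous F → J.OrdConnected → IsEnergySolution V F J u Du ut →
      -- the nonlinear density is integrable locally in time
      (∀ t₁ ∈ J, ∀ t₂ ∈ J, Integrable (nonlinDensity F u)
        ((volume.restrict (Icc t₁ t₂)).prod (hypVolume d))) ∧
      (energySupSq J Du ut < ⊤ →
        -- no sign condition, whenever the negative part of the nonlinear density is integrable
        (Integrable (fun p => max (-nonlinDensity F u p) 0)
            ((volume.restrict J).prod (hypVolume d)) →
          Integrable (gradDensity Du) ((volume.restrict J).prod (hypVolume d)) ∧
          Integrable (potDensity V u) ((volume.restrict J).prod (hypVolume d)) ∧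
          Integrable (nonlinDensity F u) ((volume.restrict J).prod (hypVolume d)) ∧
          ∫ p, (gradDensity Du p + 1 / (2 * d) * potDensity V u p + nonlinDensity F u p)
              ∂((volume.restrict J).prod (hypVolume d))
            ≤ C * (energySupSq J Du ut).toReal) ∧
        -- the defocusing case
        ((∀ σ : ℝ, primitiveOf F σ ≤ 1 / 2 * σ * F σ) →
          Integrable (gradDensity Du) ((volume.restrict J).prod (hypVolume d)) ∧
          Integrable (potDensity V u) ((volume.restrict J).prod (hypVolume d)) ∧
          Integrable (nonlinDensity F u) ((volume.restrict J).prod (hypVolume d)) ∧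
          ∫ p, (gradDensity Du p + potDensity V u p + nonlinDensity F u p)
              ∂((volume.restrict J).prod (hypVolume d))
            ≤ C * (energySupSq J Du ut).toReal)) := by
  refine ⟨fun r hr => weightSq_pos d hr, ?_⟩
  obtain ⟨K, hK0, hK⟩ := exists_estimate (d := d) hd
  have hd1 : (1 : ℝ) ≤ 2 * d := by
    have : (2 : ℝ) ≤ d := by exact_mod_cast hd
    linarith
  -- The factor 2d raises the coefficient 1/(2d) of the potential term to 1 in the defocusing case;
  -- the other case only needs K ≤ 2dK.
  refine ⟨2 * d * K, fun V F J u Du ut hV hB hrep hF hJ h => ⟨fun s hs t ht => ?_, fun hE =>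
    ⟨fun hneg => ?_, fun hpos => ?_⟩⟩⟩
  · rcases le_or_gt s t with hst | hst
    · obtain ⟨B, hB⟩ := hB
      exact (h.mono (hJ.out hs ht)).integrable_nonlinDensity hd hst hV.continuous hB hF
    · simp [Icc_eq_empty (not_le.2 hst)]
  · obtain ⟨h1, h2, h3, h4⟩ := hK V F J u Du ut hV hB hrep hF hJ h hE hneg
    refine ⟨h1, h2, h3, h4.trans ?_⟩
    have hE0 : 0 ≤ (energySupSq J Du ut).toReal := ENNReal.toReal_nonneg
    have := mul_nonneg hK0 hE0
    nlinarith
  · have hN0 : ∀ p, 0 ≤ nonlinDensity F u p := fun p => by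
      have := hpos (u p.1 p.2)
      simp only [nonlinDensity]; linarith
    have hneg : Integrable (fun p => max (-nonlinDensity F u p) 0)
        ((volume.restrict J).prod (hypVolume d)) := by
      have : (fun p => max (-nonlinDensity F u p) 0) = fun _ => 0 := funext fun p =>
        max_eq_right (by linarith [hN0 p])
      rw [this]
      exact integrable_zero _ _ _
    obtain ⟨h1, h2, h3, h4⟩ := hK V F J u Du ut hV hB hrep hF hJ h hE hneg
    refine ⟨h1, h2, h3, ?_⟩
    -- The gradient and nonlinear densities are nonnegative, so multiplying them by 2d ≥ 1 only
    -- increases the integral.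
    have hle : ∫ p, (gradDensity Du p + potDensity V u p + nonlinDensity F u p)
        ∂((volume.restrict J).prod (hypVolume d)) ≤ ∫ p, 2 * d * (gradDensity Du p +
          1 / (2 * d) * potDensity V u p + nonlinDensity F u p)
        ∂((volume.restrict J).prod (hypVolume d)) := by
      refine integral_mono ((h1.add h2).add h3)
        (((h1.add (h2.const_mul _)).add h3).const_mul _) fun p => ?_
      have q1 := mul_le_mul_of_nonneg_right hd1 (gradDensity_nonneg hd Du p)
      have q2 := mul_le_mul_of_nonneg_right hd1 (hN0 p)
      have q3 : 2 * (d : ℝ) * (1 / (2 * d) * potDensity V u p) = potDensity V u p := by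
        have : (2 * (d : ℝ)) ≠ 0 := by positivity
        field_simp
      simp only [mul_add, q3]
      linarith
    rw [integral_const_mul] at hle
    refine hle.trans ?_
    have := mul_le_mul_of_nonneg_left h4 (by positivity : (0 : ℝ) ≤ 2 * d)
    rwa [← mul_assoc] at this
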